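/- A \emph{flow category} is a category $\mathscr C$ with finitely many objects and a grading $|\cdot|\colon \mathrm{Ob}(\mathscr C)\to\mathbb Z$ such that: \begin{enumerate} \item $\mathrm{Hom}(x,x)=\{\mathrm{id}\}$, and for $x\neq y$ the set $\mathcal M(x,y)=\mathrm{Hom}(x,y)$ is a smooth compact $n$-dimensional manifold with faces, $n=|x|-|y|-1$, with an $n$-face structure $(\partial_1\mathcal M(x,y),\dots,\partial_n\mathcal M(x,y))$; this means that the $\partial_i$ are faces (unions of pairwise disjoint closures of components of the codimension one boundary) with union $\partial\mathcal M(x,y)$, and that $\partial_i\cap\partial_j$ is a face of both $\partial_i$ and $\partial_j$ for $i\ne j$ (so $\mathcal M(x,y)=\emptyset$ if $|x|\le|y|$, $x\neq y$); \item for $|y|<|z|<|x|$ and $m=|z|-|y|$, composition $\circ\colon\mathcal M(z,y)\times\mathcal M(x,z)\to\mathcal M(x,y)$ is an embedding into $\partial_m\mathcal M(x,y)$, and $\circ^{-1}(\partial_i\mathcal M(x,y))$ equals $\partial_i\mathcal M(z,y)\times\mathcal M(x,z)$ for $i<m$ and $\mathcal M(z,y)\times\partial_{i-m}\mathcal M(x,z)$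 for $i>m$; \item $\circ$ induces a diffeomorphism $\coprod_{|z|=|y|+i}\mathcal M(z,y)\times\mathcal M(x,z)\cong\partial_i\mathcal M(x,y)$ for $x\ne y$ and $1\le i\le |x|-|y|-1$. \end{enumerate} A \emph{morphism} of flow categories is a grading-preserving functor that is a local diffeomorphism on all morphism spaces. A morphism $\mathscr C_1\to\mathscr C_2$ is a \emph{disc cover} if every morphism space of $\mathscr C_2$ is a disjoint union of discs, that is, if every component of each (say $d$-dimensional) morphism space of $\mathscr C_2$ is homeomorphic to the closed ball $D^d$. Let $\widetilde{\mathrm{Ob}}_1$ be a finite $\mathbb Z$-graded set, and for each $i\in\mathbb{Z}$ let $\widetilde{\mathscr C}_{1,i}$ be a flow category whose objects are the elements of $\widetilde{\mathrm{Ob}}_1$ of grading $i,i+1,i+2$, the morphism sets of these categories agreeing on common objects. Let $\widetilde{\mathscr C}_1$ be the category with object set $\widetilde{\mathrm{Ob}}_1$ and the smallest morphism sets such that each $\widetilde{\mathscr C}_{1,i}$ is a full subcategory: every morphism is a composition of morphisms of the $\widetilde{\mathscr C}_{1,i}$, and the only relations between such compositions are those that follow from the relations inside the $\widetilde{\mathscr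 C}_{1,i}$. Let $\mathscr C_2$ be a flow category in which each morphism space is a disjoint union of discs, and let $\widetilde\Psi\colon\widetilde{\mathscr C}_1\to\mathscr C_2$ be a grading-preserving functor whose restriction to each $\widetilde{\mathscr C}_{1,i}$ is a morphism of flow categories. Then for all $a,b\in\widetilde{\mathrm{Ob}}_1$ with $|b|-|a|=3$, the space $$\mathrm{Hom}_{\widetilde{\mathscr C}_1}(b,a)=\bigcup_{|a|<|c|<|b|}\mathrm{Hom}_{\widetilde{\mathscr C}_1}(c,a)\times\mathrm{Hom}_{\widetilde{\mathscr C}_1}(b,c)$$ (with the final topology of the composition maps, each of which is injective) is homeomorphic to a finite disjoint union of circles, and $\widetilde\Psi$ induces a covering map (possibly with some empty fibres) $$\widetilde\Psi_{b,a}\colon\mathrm{Hom}_{\widetilde{\mathscr C}_1}(b,a)\to\partial\,\mathrm{Hom}_{\mathscr C_2}(\widetilde\Psi(b),\widetilde\Psi(a)).$$ Suppose that for all such $a,b$ the map $\widetilde\Psi_{b,a}$ restricts, on each component of $\mathrm{Hom}_{\widetilde{\mathscr C}_1}(b,a)$, to a trivial covering map onto its image. Then there are a flow category $\mathscr C_1$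 and a disc cover $\Psi\colon\mathscr C_1\to\mathscr C_2$ such that \begin{itemize} \item $\mathscr C_1$ has the graded object set $\widetilde{\mathrm{Ob}}_1$; \item the restriction of $\mathscr C_1$ to the objects of grading $i,i+1,i+2$ is the flow category $\widetilde{\mathscr C}_{1,i}$, for every $i$; \item $\widetilde{\mathscr C}_1$ is a subcategory of $\mathscr C_1$; \item $\widetilde\Psi$ is the restriction of $\Psi$ to $\widetilde{\mathscr C}_1$. \end{itemize} Moreover $(\mathscr C_1,\Psi)$ is unique up to unique isomorphism: for any two such pairs $(\mathscr C_1,\Psi)$ and $(\mathscr C_1',\Psi')$ there is exactly one morphism of flow categories $\mathscr C_1\to\mathscr C_1'$ that is the identity on $\widetilde{\mathscr C}_1$ and commutes with $\Psi$ and $\Psi'$, and it is an isomorphism of flow categories. -/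

import Mathlib

open CategoryTheory Set
open scoped Manifold ContDiff Topology

universe u v u₂ v₂

noncomputable section

namespace FlowCat

/-! ### Manifolds with faces -/

section Faces

variable (n : ℕ) {X : Type v} [TopologicalSpace X] [ChartedSpace (EuclideanQuadrant n) X]

/-- `c(x)`: the number of coordinates of `x`, in a chart with values in `[0,∞)ⁿ`, that vanish. -/
def depth (x : X) : ℕ :=
  Set.ncard {j : Fin n | (chartAt (EuclideanQuadrant n) x x).1 j = 0}

variable (X) in
/-- The boundary `∂X`: the closure of the codimension one boundary `∂¹X = {x | c(x) = 1}`. -/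
def bdry : Set X := closure {x : X | depth n x = 1}

/-- The connected components (as subsets of `X`) of a subset `S` of `X`. -/
def componentsOf {X : Type v} [TopologicalSpace X] (S : Set X) : Set (Set X) :=
  {K | ∃ p ∈ S, K = connectedComponentIn S p}

variable (X) in
/-- A manifold with corners is a manifold with faces if every `x` lies in the closure of exactly
`c(x)` components of `∂¹X`. -/
def IsManifoldWithFaces : Prop :=
  ∀ x : X, Set.encard {K ∈ componentsOf {y : X | depth n y = 1} | x ∈ closure K} = depth n x

/-- `G` is a face of `F`, where `F` is either `X` (with `k = 0`) or a face of `X` (with `k = 1`),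
regarded as a manifold with faces in its own right; a point `x` of such an `F` lies in the
codimension one boundary of `F` exactly if `c(x) = k + 1`. A connected face of `F` is the closure
of a component of its codimension one boundary, and a face is a union of pairwise disjoint
connected faces. -/
def IsFaceOf (k : ℕ) (F G : Set X) : Prop :=
  ∃ 𝒦 : Set (Set X), 𝒦 ⊆ componentsOf {x | x ∈ F ∧ depth n x = k + 1} ∧
    (closure '' 𝒦).PairwiseDisjoint id ∧ G = ⋃₀ (closure '' 𝒦)

/-- `(∂₁X, …, ∂ₘX)` is an `m`-face structure on `X`. The tuple is written as a function on `ℕ` with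
the value `∅` outside `{1, …, m}`. -/
structure IsFaceStructure (m : ℕ) (D : ℕ → Set X) : Prop where
  outside : ∀ i, ¬ (1 ≤ i ∧ i ≤ m) → D i = ∅
  isFace : ∀ i, 1 ≤ i → i ≤ m → IsFaceOf n 0 univ (D i)
  union : ⋃ i ∈ Set.Icc 1 m, D i = bdry n X
  inter : ∀ i j, 1 ≤ i → i ≤ m → 1 ≤ j → j ≤ m → i ≠ j →
    IsFaceOf n 1 (D i) (D i ∩ D j) ∧ IsFaceOf n 1 (D j) (D i ∩ D j)

end Faces

/-! ### Flow categories -/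

section Flow

variable {C : Type u} [Category.{v} C] {gr : C → ℤ}

/-- The dimension `|x| - |y| - 1` of the moduli space from `x` to `y`. (It is only used where
`|x| > |y|`: the other morphism sets are empty, or consist of one identity, a `0`-manifold.) -/
def mdim (gr : C → ℤ) (x y : C) : ℕ := (gr x - gr y - 1).toNat

variable (C gr) in
/-- Charts with corners and subsets `∂ᵢ`, for the morphism sets of a graded category. -/
structure ModuliData where
  top : ∀ x y : C, TopologicalSpace (x ⟶ y)
  charts : ∀ x y : C, @ChartedSpace (EuclideanQuadrant (mdim gr x y)) _ (x ⟶ y) (top x y)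
  face : ∀ x y : C, ℕ → Set (x ⟶ y)

/-- The morphism set `Hom(x, y)`, with the topology and the charts given by `F`. -/
def ModuliData.Mod (_F : ModuliData C gr) (x y : C) : Type v := x ⟶ y

instance (F : ModuliData C gr) (x y : C) : TopologicalSpace (F.Mod x y) := F.top x y

instance (F : ModuliData C gr) (x y : C) :
    ChartedSpace (EuclideanQuadrant (mdim gr x y)) (F.Mod x y) := F.charts x y

/-- The model `[0,∞)ᵈ` of the moduli space from `x` to `y`. -/
abbrev mmodel (gr : C → ℤ) (x y : C) :=
  modelWithCornersEuclideanQuadrant (mdim gr x y)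

/-- The composition `M(z,y) × M(x,z) → M(x,y)`, `(p, q) ↦ p ∘ q`. -/
def ModuliData.comp (F : ModuliData C gr) (x z y : C) :
    F.Mod z y × F.Mod x z → F.Mod x y :=
  fun pq => CategoryStruct.comp (obj := C) pq.2 pq.1

variable (C gr) in
/-- The structure of a flow category on a category `C` with grading `gr`. -/
structure FlowStructure extends ModuliData C gr where
  finite : Finite C
  hom_self : ∀ (x : C) (f : x ⟶ x), f = 𝟙 x
  hom_empty : ∀ x y : C, x ≠ y → gr x ≤ gr y → IsEmpty (x ⟶ y)
  t2 : ∀ x y : C, T2Space (toModuliData.Mod x y)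
  compact : ∀ x y : C, CompactSpace (toModuliData.Mod x y)
  smooth : ∀ x y : C, IsManifold (mmodel gr x y) ∞ (toModuliData.Mod x y)
  withFaces : ∀ x y : C, IsManifoldWithFaces (mdim gr x y) (toModuliData.Mod x y)
  faceStructure : ∀ x y : C,
    IsFaceStructure (X := toModuliData.Mod x y) (mdim gr x y) (mdim gr x y) (face x y)
  /-- Composition is an embedding into `∂ₘ M(x,y)`, where `m = |z| - |y|`. -/
  comp_embedding : ∀ x z y : C, gr y < gr z → gr z < gr x →
    Manifold.IsSmoothEmbedding ((mmodel gr z y).prod (mmodel gr x z)) (mmodel gr x y) ∞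
      (toModuliData.comp x z y)
  comp_mem : ∀ (x z y : C) (m : ℕ), 1 ≤ m → gr z = gr y + m → gr z < gr x →
    range (toModuliData.comp x z y) ⊆ face x y m
  comp_face_lt : ∀ (x z y : C) (m : ℕ), 1 ≤ m → gr z = gr y + m → gr z < gr x →
    ∀ i < m, toModuliData.comp x z y ⁻¹' face x y i = {pq | pq.1 ∈ face z y i}
  comp_face_gt : ∀ (x z y : C) (m : ℕ), 1 ≤ m → gr z = gr y + m → gr z < gr x →
    ∀ i > m, toModuliData.comp x z y ⁻¹' face x y i = {pq | pq.2 ∈ face x z (i - m)}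
  /-- Composition induces a diffeomorphism from the disjoint union, over all `z` with
  `|z| = |y| + i`, of the `M(z,y) × M(x,z)` onto `∂ᵢ M(x,y)`: the images of these smooth embeddings
  are disjoint, and cover `∂ᵢ M(x,y)`. -/
  face_eq : ∀ (x y : C) (i : ℕ), x ≠ y → 1 ≤ i → i ≤ mdim gr x y →
    face x y i = ⋃ z ∈ {z : C | gr z = gr y + i}, range (toModuliData.comp x z y)
  face_disjoint : ∀ (x y : C) (i : ℕ), x ≠ y → 1 ≤ i → i ≤ mdim gr x y →
    {z : C | gr z = gr y + i}.PairwiseDisjoint fun z => range (toModuliData.comp x z y)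

/-- Each morphism space is a disc, or more generally a disjoint union of discs: every connected
component of the `d`-dimensional space `Hom(x, y)` is homeomorphic to the closed unit ball
of `ℝᵈ`. -/
def FlowStructure.IsDisc (F : FlowStructure C gr) : Prop :=
  ∀ (x y : C) (p : F.Mod x y), Nonempty
    (connectedComponent p ≃ₜ
      Metric.closedBall (0 : EuclideanSpace ℝ (Fin (mdim gr x y))) 1)

variable {C₂ : Type u₂} [Category.{v₂} C₂] {gr₂ : C₂ → ℤ}

/-- The map on moduli spaces given by a functor. -/
def modMap (F : FlowStructure C gr) (F₂ : FlowStructure C₂ gr₂) (Ψ : C ⥤ C₂) (x y : C) :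
    F.Mod x y → F₂.Mod (Ψ.obj x) (Ψ.obj y) :=
  fun (f : x ⟶ y) => Ψ.map f

/-- Morphisms of flow categories: grading-preserving functors that are local diffeomorphisms
on morphism spaces. -/
structure IsFlowMorphism (F : FlowStructure C gr) (F₂ : FlowStructure C₂ gr₂)
    (Ψ : C ⥤ C₂) : Prop where
  gr_obj : ∀ x, gr₂ (Ψ.obj x) = gr x
  localDiffeo : ∀ x y, IsLocalDiffeomorph (mmodel gr x y) (mmodel gr₂ (Ψ.obj x) (Ψ.obj y)) ∞
    (modMap F F₂ Ψ x y)

/-- A disc cover of a flow category. -/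
structure IsDiscCover (F : FlowStructure C gr) (F₂ : FlowStructure C₂ gr₂)
    (Ψ : C ⥤ C₂) : Prop where
  isFlowMorphism : IsFlowMorphism F F₂ Ψ
  isDisc : F₂.IsDisc

/-- The functor `Ψ` identifies the flow category `C` with the full subcategory of the flow
category `C₂` on the objects in `S`: it is bijective on objects and on morphism sets, it preserves
the grading and the faces, and it is a diffeomorphism on all morphism spaces. -/
structure IsFlowIsoOnto (F : FlowStructure C gr) (F₂ : FlowStructure C₂ gr₂)
    (Ψ : C ⥤ C₂) (S : Set C₂) : Prop where
  isFlowMorphism : IsFlowMorphism F F₂ Ψ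
  obj_injective : Function.Injective Ψ.obj
  obj_range : range Ψ.obj = S
  map_bijective : ∀ x y, Function.Bijective (modMap F F₂ Ψ x y)
  map_face : ∀ (x y : C) (i : ℕ),
    modMap F F₂ Ψ x y ⁻¹' F₂.face (Ψ.obj x) (Ψ.obj y) i = F.face x y i

end Flow

/-! ### The category glued from the grading windows -/

section Windows

variable {C : Type u} [Category.{v} C] {gr : C → ℤ}

/-- The objects of grading `i`, `i + 1`, `i + 2`. -/
def InWindow (gr : C → ℤ) (i : ℤ) : ObjectProperty C := fun x => i ≤ gr x ∧ gr x ≤ i + 2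

/-- The full subcategory on the objects of grading `i`, `i + 1`, `i + 2`. -/
abbrev Window (gr : C → ℤ) (i : ℤ) := (InWindow gr i).FullSubcategory

/-- The grading of the window. -/
abbrev windowGr (gr : C → ℤ) (i : ℤ) : Window gr i → ℤ := fun x => gr x.obj

/-- The objects of `C`, with an arrow for every morphism of `C` that lies in a window. -/
def WindowQuiver (_gr : C → ℤ) : Type u := C

instance (gr : C → ℤ) : Quiver (WindowQuiver gr) where
  Hom x y := {_f : @Quiver.Hom C _ x y // ∃ i, InWindow gr i x ∧ InWindow gr i y}

/-- Regard a morphism of a window as a path of length one. -/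
def windowPath (gr : C → ℤ) {x y : C} (f : x ⟶ y) (h : ∃ i, InWindow gr i x ∧ InWindow gr i y) :
    (Quiver.Path (V := WindowQuiver gr) x y) :=
  Quiver.Hom.toPath (V := WindowQuiver gr) ⟨f, h⟩

/-- The relations between paths that hold in the windows: identities and compositions. -/
inductive WindowRel (gr : C → ℤ) : HomRel (Paths (WindowQuiver gr))
  | id (x : C) (h : ∃ i, InWindow gr i x ∧ InWindow gr i x) :
      WindowRel gr (windowPath gr (𝟙 x) h) (Quiver.Path.nil (V := WindowQuiver gr) (a := x))
  | comp {x z y : C} (f : x ⟶ z) (g : z ⟶ y) (i : ℤ)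
      (hx : InWindow gr i x) (hz : InWindow gr i z) (hy : InWindow gr i y) :
      WindowRel gr
        (Quiver.Path.comp (windowPath gr f ⟨i, hx, hz⟩) (windowPath gr g ⟨i, hz, hy⟩))
        (windowPath gr (f ≫ g) ⟨i, hx, hy⟩)

/-- The composition in `C` of a path of morphisms that lie in windows. -/
def evalPath (gr : C → ℤ) : Paths (WindowQuiver gr) ⥤ C :=
  Paths.lift { obj := fun x => x, map := fun f => f.1 }

/-- `C` has the smallest morphism sets that its full subcategories on the windows allow, i.e. it is
obtained by gluing the windows: each morphism is a composition of morphisms of windows, and two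
such compositions agree only where this follows from the compositions inside the windows. -/
structure IsGluedFromWindows (gr : C → ℤ) : Prop where
  full : ∀ (x y : Paths (WindowQuiver gr))
    (f : (evalPath gr).obj x ⟶ (evalPath gr).obj y), ∃ p : x ⟶ y, (evalPath gr).map p = f
  faithful : ∀ (x y : Paths (WindowQuiver gr)) (p q : x ⟶ y),
    (evalPath gr).map p = (evalPath gr).map q →
      (Quotient.functor (WindowRel gr)).map p = (Quotient.functor (WindowRel gr)).map q

/-- Flow category structures on all the windows. -/
abbrev WindowFlows (gr : C → ℤ) := ∀ i : ℤ, FlowStructure (Window gr i) (windowGr gr i)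

/-- The morphisms `b ⟶ a`, where `|b| = |a| + 3`. -/
def BrokenHom (_W : WindowFlows gr) (b a : C) (_h : gr b = gr a + 3) : Type v := b ⟶ a

/-- The composition `Hom(c,a) × Hom(b,c) → Hom(b,a)`, where `|b| = |a| + 3` and
`|a| < |c| < |b|`. -/
def glueMap (W : WindowFlows gr) (b a : C) (h : gr b = gr a + 3)
    (c : {c : C // gr a < gr c ∧ gr c < gr b}) :
    (W (gr a)).Mod ⟨c.1, by have := c.2; constructor <;> omega⟩ ⟨a, by constructor <;> omega⟩ ×
      (W (gr a + 1)).Mod ⟨b, by constructor <;> omega⟩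
        ⟨c.1, by have := c.2; constructor <;> omega⟩ →
      BrokenHom W b a h :=
  fun pq => CategoryStruct.comp (obj := C)
    (InducedCategory.Hom.hom pq.2) (InducedCategory.Hom.hom pq.1)

/-- `Hom(b,a)`, for `|b| = |a| + 3`, has the topology of the union of the spaces
`Hom(c,a) × Hom(b,c)`, i.e. the final topology of the composition maps. -/
instance (W : WindowFlows gr) (b a : C) (h : gr b = gr a + 3) :
    TopologicalSpace (BrokenHom W b a h) :=
  ⨆ c, TopologicalSpace.coinduced (glueMap W b a h c) inferInstance

/-- A trivial covering map: a product with a discrete fibre. -/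
def IsTrivialCovering {E B : Type v} [TopologicalSpace E] [TopologicalSpace B] (p : E → B) :
    Prop :=
  ∃ (F : Type v) (_ : TopologicalSpace F), DiscreteTopology F ∧
    IsHomeomorphicTrivialFiberBundle F p

variable {C₂ : Type u₂} [Category.{v} C₂] {gr₂ : C₂ → ℤ}

/-- The map `Hom(b,a) → Hom(Ψ b, Ψ a)`, for `|b| = |a| + 3`. -/
def brokenMap (W : WindowFlows gr) (F₂ : FlowStructure C₂ gr₂) (Ψ : C ⥤ C₂)
    (b a : C) (h : gr b = gr a + 3) :
    BrokenHom W b a h → F₂.Mod (Ψ.obj b) (Ψ.obj a) :=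
  fun (f : b ⟶ a) => Ψ.map f

/-- A flow category `C₁` with a disc cover `C₁ ⥤ C₂` that extends the given data: `C` is a
subcategory of `C₁` with the same graded object set, the windows of `C₁` are the given flow
categories, and the disc cover restricts to the given functor on `C`. -/
structure DiscCoverExtension (W : WindowFlows gr) (F₂ : FlowStructure C₂ gr₂) (Ψ : C ⥤ C₂) where
  C₁ : Type u
  [cat : Category.{v} C₁]
  gr₁ : C₁ → ℤ
  flow : FlowStructure C₁ gr₁
  cover : C₁ ⥤ C₂
  isDiscCover : IsDiscCover flow F₂ cover
  incl : C ⥤ C₁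
  incl_obj : Function.Bijective incl.obj
  incl_gr : ∀ x, gr₁ (incl.obj x) = gr x
  incl_faithful : incl.Faithful
  incl_window : ∀ i : ℤ, IsFlowIsoOnto (W i) flow ((InWindow gr i).ι ⋙ incl)
    {x | i ≤ gr₁ x ∧ gr₁ x ≤ i + 2}
  incl_cover : incl ⋙ cover = Ψ

attribute [instance] DiscCoverExtension.cat

end Windows

end FlowCat

end

open FlowCat

open FlowCat

/-!
The boundary of each disc of `C₁` is forced: it consists of the compositions of morphisms of smaller
degree, and covers the boundary sphere of a disc of `C₂`. The disc can be filled in exactly if this covering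
of a sphere is trivial, and only in degree three, where the spheres are circles, can it fail to be
trivial.

*Topology of faces.* The points of the boundary of a manifold with corners are characterized
topologically, as *edge points* (`IsEdgePoint`, `bdry_eq_isEdgePoint`): the space can be deformed near
such a point so as to miss it, whereas near an interior point this contradicts Brouwer's theorem
(`mem_range_of_eqOn_compl_ball`). So local homeomorphisms preserve and reflect the boundary, and a
morphism of flow categories preserves and reflects faces (`FlowCat.IsFlowMorphism.map_mem_face_iff`).
A compact space that is locally homeomorphic to a disjoint union of discs is a finite cover of it, hence
maps each of its components homeomorphically onto a disc
(`IsLocalHomeomorph.hasComponentSections_of_disc`); smooth structures, faces and immersions can then be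
pulled back.

*The category `C₁`.* Let `Pi0 b a` be the set of morphisms of the category obtained from `C` by
identifying any two morphisms in a component of a moduli space of a window. A morphism of `C₁`
(`FlowCat.CanHom`) is a class in `Pi0 b a` with a point in the component of the moduli space of `C₂` to
which the class is mapped. In the windows these are the given morphisms. What has to be proved is that
a morphism of `C₁` in `∂ᵢ` factors uniquely through an object of grading `|a| + i`
(`FlowCat.GluingData.uniqueFactorization`). This goes by induction on the degree `|b| - |a|`.

If the morphisms of smaller degree factor uniquely, then the pairs of composable morphisms of `C₁` from
`b` to `a`, modulo `(f ≫ h, g) ∼ (f, h ≫ g)`, form a space that is glued from closed pieces, one for each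
intermediate object and each pair of classes. Each piece is embedded in the boundary of the moduli space
of `C₂`, and near each point the pieces that contain it cover the boundary. Therefore the glued space is
a covering space of the boundary (`Patching.isCoveringMap`, `FlowCat.Factorization.patching`), which
is a disjoint union of spheres. In degree three it is the space of broken morphisms
(`FlowCat.GluingData.exists_homeomorph_total`); this gives the first claim, and the covering is trivial on
components by assumption. In higher degrees the spheres are simply connected
(`IsCoveringMap.exists_lift_sphere`). So each component is mapped homeomorphically onto a sphere,
the components correspond to the classes in `Pi0 b a`, and the boundary of each disc of `C₁` is identified
with the glued space (`FlowCat.Factorization.uniqueFactorization_step`).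

*Uniqueness.* In any extension, every component of a moduli space is a disc, and following it to its
boundary, factoring and arguing by induction, it contains a morphism of `C`
(`FlowCat.IsExtension.exists_component_eq`). The class in `Pi0` of such morphisms is locally constant on
the boundary of the disc, which is connected in degrees above two, so it is well defined
(`FlowCat.IsExtension.pi0_eq_of_component_eq`). Hence the extension is isomorphic to `C₁`
(`FlowCat.GluingData.exists_iso_extension`). A morphism of flow categories over `C₂` that is defined on
`C₁` is determined on `C`, hence on every disc (`FlowCat.GluingData.eq_of_canIncl_comp_eq`).
-/

/-! ### Brouwer's theorem -/

section Brouwer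
open MeasureTheory Metric

/-- A map that is Lipschitz on the closed unit ball and vanishes on the unit sphere stays Lipschitz
when it is extended by zero. -/
theorem lipschitzWith_indicator_closedBall {E F : Type*} [NormedAddCommGroup E] [NormedSpace ℝ E]
    [NormedAddCommGroup F] {g : E → F} {L : NNReal}
    (hg : LipschitzOnWith L g (closedBall 0 1)) (h0 : ∀ x, ‖x‖ = 1 → g x = 0) :
    LipschitzWith L ((closedBall (0 : E) 1).indicator g) := by
  have key : ∀ x y : E, x ∈ closedBall (0 : E) 1 → y ∉ closedBall (0 : E) 1 →
      dist (g x) 0 ≤ L * dist x y := by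
    intro x y hx hy
    have hx' : ‖x‖ ≤ 1 := by simpa using hx
    have hy' : 1 < ‖y‖ := by simpa using hy
    have hc : ContinuousOn (fun t : ℝ => ‖AffineMap.lineMap x y t‖) (Icc 0 1) := by
      fun_prop
    obtain ⟨t, ht, htw⟩ := intermediate_value_Icc zero_le_one hc
      (show (1 : ℝ) ∈ Icc _ _ by simp [hx', hy'.le])
    have hw : AffineMap.lineMap x y t ∈ closedBall (0 : E) 1 := by
      simpa using (show ‖AffineMap.lineMap x y t‖ ≤ 1 from le_of_eq htw)
    have h1 := hg.dist_le_mul x hx _ hw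
    rw [h0 _ htw] at h1
    refine h1.trans ?_
    gcongr
    rw [dist_left_lineMap]
    have : ‖t‖ ≤ 1 := by rw [Real.norm_of_nonneg ht.1]; exact ht.2
    nlinarith [dist_nonneg (x := x) (y := y)]
  refine LipschitzWith.of_dist_le_mul fun x y => ?_
  by_cases hx : x ∈ closedBall (0 : E) 1 <;> by_cases hy : y ∈ closedBall (0 : E) 1
  · rw [indicator_of_mem hx, indicator_of_mem hy]; exact hg.dist_le_mul x hx y hy
  · rw [indicator_of_mem hx, indicator_of_notMem hy]; exact key x y hx hy
  · rw [indicator_of_notMem hx, indicator_of_mem hy, dist_comm, dist_comm x]; exact key y x hy hx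
  · rw [indicator_of_notMem hx, indicator_of_notMem hy, dist_self]; positivity

/-- A small Lipschitz perturbation of the identity is bijective. -/
theorem bijective_id_add_of_lipschitz {E : Type*} [NormedAddCommGroup E] [CompleteSpace E]
    {G : E → E} {K : NNReal} (hK : K < 1) (hG : LipschitzWith K G) :
    Function.Bijective fun x => x + G x := by
  constructor
  · intro x y hxy
    have h1 : dist x y = dist (G y) (G x) := by
      simp only [dist_eq_norm]; congr 1
      rw [sub_eq_sub_iff_add_eq_add, add_comm (G y)]; exact hxy
    have h2 := hG.dist_le_mul y x
    rw [← h1, dist_comm y x] at h2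
    have hK' : (K : ℝ) < 1 := hK
    have : dist x y ≤ 0 := by nlinarith [dist_nonneg (x := x) (y := y)]
    exact dist_le_zero.1 this
  · intro y
    have hc : ContractingWith K (fun x => y - G x) := by
      refine ⟨hK, LipschitzWith.of_dist_le_mul fun a b => ?_⟩
      rw [dist_sub_left]; exact hG.dist_le_mul a b
    have : Nonempty E := ⟨y⟩
    refine ⟨hc.fixedPoint, ?_⟩
    have h : y - G hc.fixedPoint = hc.fixedPoint := hc.fixedPoint_isFixedPt
    calc hc.fixedPoint + G hc.fixedPoint = (y - G hc.fixedPoint) + G hc.fixedPoint := by rw [h]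
      _ = y := sub_add_cancel _ _

/-- For distinct nodes `v 0, …, v n`, the value at `1` of `t ↦ det (1 + t A)`, a polynomial of
degree at most `n`, is obtained from its values at the nodes by Lagrange interpolation. -/
theorem exists_interpolation_det {E : Type*} [NormedAddCommGroup E] [NormedSpace ℝ E]
    [FiniteDimensional ℝ E] {n : ℕ} (hn : Module.finrank ℝ E = n) (v : Fin (n + 1) → ℝ) (hv : Function.Injective v) :
    ∃ l : Fin (n + 1) → ℝ, ∑ j, l j = 1 ∧
      ∀ A : E →L[ℝ] E,
        (ContinuousLinearMap.id ℝ _ + A).det =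
          ∑ j, l j * (ContinuousLinearMap.id ℝ _ + v j • A).det := by
  classical
  refine ⟨fun j => (Lagrange.basis Finset.univ v j).eval 1, ?_, fun A => ?_⟩
  · rw [← Polynomial.eval_finsetSum, Lagrange.sum_basis hv.injOn Finset.univ_nonempty]
    simp
  · set b := Module.finBasisOfFinrankEq ℝ E hn
    set M := LinearMap.toMatrix b b (A : E →ₗ[ℝ] E)
    set p : Polynomial ℝ := Matrix.det ((Polynomial.X : Polynomial ℝ) • M.map Polynomial.C +
      (1 : Matrix (Fin n) (Fin n) ℝ).map Polynomial.C)
    have hp : ∀ t : ℝ, p.eval t = (ContinuousLinearMap.id ℝ _ + t • A).det := by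
      intro t
      have h1 : p.eval t = Matrix.det (t • M + 1) := by
        simp only [p]
        rw [← Polynomial.coe_evalRingHom, RingHom.map_det]
        congr 1
        ext i j
        by_cases h : i = j
        · subst h
          simp only [Matrix.add_apply, Matrix.smul_apply, Matrix.map_apply, smul_eq_mul,
            RingHom.mapMatrix_apply, Polynomial.coe_evalRingHom, Polynomial.eval_add, Polynomial.eval_mul,
            Polynomial.eval_X, Polynomial.eval_C, Matrix.one_apply_eq]
        · simp only [Matrix.add_apply, Matrix.smul_apply, Matrix.map_apply, smul_eq_mul,
            RingHom.mapMatrix_apply, Polynomial.coe_evalRingHom, Polynomial.eval_add, Polynomial.eval_mul,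
            Polynomial.eval_X, Polynomial.eval_C, Matrix.one_apply_ne h]
      rw [h1, ContinuousLinearMap.det, ← LinearMap.det_toMatrix b]
      congr 1
      simp only [ContinuousLinearMap.toLinearMap_add, ContinuousLinearMap.toLinearMap_smul, map_add,
        map_smul]
      rw [add_comm]
      congr 1
      exact (LinearMap.toMatrix_id b).symm
    have hd : p.degree < (Finset.univ : Finset (Fin (n + 1))).card := by
      refine lt_of_le_of_lt Polynomial.degree_le_natDegree ?_
      have := Polynomial.natDegree_det_X_add_C_le M 1
      simp only [Fintype.card_fin] at this
      simp only [Finset.card_univ, Fintype.card_fin]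
      exact_mod_cast Nat.lt_succ_of_le this
    have h2 := congrArg (Polynomial.eval 1) (Lagrange.eq_interpolate hv.injOn hd)
    rw [hp 1, one_smul] at h2
    rw [h2, Lagrange.interpolate_apply, Polynomial.eval_finsetSum]
    refine Finset.sum_congr rfl fun j _ => ?_
    rw [Polynomial.eval_mul, Polynomial.eval_C, hp, mul_comm]

set_option maxHeartbeats 1000000 in
/-- There is no `C¹` map of the closed unit ball to the unit sphere that fixes the sphere. For small
`t` the map `x ↦ x + t (r x - x)` permutes the ball, so the integral of its Jacobian determinant is
the volume of the ball. The integral is a polynomial in `t`, so this persists at `t = 1`, where the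
determinant vanishes. -/
theorem not_exists_smooth_retraction {E : Type*} [NormedAddCommGroup E] [InnerProductSpace ℝ E]
    [FiniteDimensional ℝ E] {r : E → E} (hr : ContDiff ℝ 1 r)
    (h1 : ∀ x, ‖x‖ ≤ 1 → ‖r x‖ = 1) (h2 : ∀ x, ‖x‖ = 1 → r x = x) : False := by
  borelize E
  set n := Module.finrank ℝ E
  set B : Set E := closedBall 0 1 with hB
  set g : E → E := fun x => r x - x with hgdef
  have hg : ContDiff ℝ 1 g := hr.sub contDiff_id
  have hBc : IsCompact B := isCompact_closedBall 0 1
  have hg' : Continuous (fderiv ℝ g) := hg.continuous_fderiv one_ne_zero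
  -- a Lipschitz constant for `g` on the ball
  obtain ⟨L, hL⟩ : ∃ L : NNReal, LipschitzOnWith L g B := by
    obtain ⟨c, hc⟩ := hBc.exists_bound_of_continuousOn hg'.continuousOn
    refine ⟨c.toNNReal, Convex.lipschitzOnWith_of_nnnorm_fderiv_le (𝕜 := ℝ)
      (fun x _ => (hg.differentiable one_ne_zero) x) (fun x hx => ?_) (convex_closedBall 0 1)⟩
    rw [← NNReal.coe_le_coe, coe_nnnorm]
    exact (hc x hx).trans (Real.le_coe_toNNReal c)
  have hG := lipschitzWith_indicator_closedBall hL (fun x hx => by simp [hgdef, h2 x hx])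
  set G := B.indicator g
  have himage : ∀ t : ℝ, 0 ≤ t → t ≤ 1 → t * L < 1 →
      InjOn (fun x => x + t • g x) B ∧ (fun x => x + t • g x) '' B = B := by
    intro t ht0 ht1 htL
    have hlip : LipschitzWith (t.toNNReal * L) (fun x => t • G x) := by
      refine LipschitzWith.of_dist_le_mul fun x y => ?_
      rw [dist_smul₀, Real.norm_of_nonneg ht0, NNReal.coe_mul, Real.coe_toNNReal t ht0, mul_assoc]
      exact mul_le_mul_of_nonneg_left (hG.dist_le_mul x y) ht0
    have hbij := bijective_id_add_of_lipschitz (K := t.toNNReal * L) (by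
      rw [← NNReal.coe_lt_coe, NNReal.coe_mul, Real.coe_toNNReal t ht0]; exact htL) hlip
    have heq : ∀ x ∈ B, x + t • G x = x + t • g x := fun x hx => by
      simp only [G, indicator_of_mem hx]
    have hmaps : ∀ x ∈ B, x + t • g x ∈ B := by
      intro x hx
      have hx1 : ‖x‖ ≤ 1 := by simpa [hB] using hx
      have : x + t • g x = (1 - t) • x + t • r x := by
        simp only [hgdef, smul_sub, sub_smul, one_smul]; abel
      rw [this]
      have h3 : ‖(1 - t) • x + t • r x‖ ≤ (1 - t) * 1 + t * 1 := by
        refine (norm_add_le _ _).trans ?_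
        rw [norm_smul, norm_smul, Real.norm_of_nonneg ht0, Real.norm_of_nonneg (by linarith),
          h1 x hx1]
        gcongr
      simp only [hB, mem_closedBall, dist_zero_right]; linarith
    refine ⟨fun x hx y hy hxy => hbij.1 ?_, Subset.antisymm (image_subset_iff.2 hmaps) ?_⟩
    · change x + t • G x = y + t • G y
      rw [heq x hx, heq y hy]; exact hxy
    · intro y hy
      obtain ⟨x, hx⟩ := hbij.2 y
      have hx' : x + t • G x = y := hx
      by_cases hxB : x ∈ B
      · exact ⟨x, hxB, by rw [← hx', heq x hxB]⟩
      · simp only [G, indicator_of_notMem hxB, smul_zero, add_zero] at hx'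
        exact absurd (hx' ▸ hy) hxB
  set D : ℝ → E → ℝ := fun t x => (ContinuousLinearMap.id ℝ E + t • fderiv ℝ g x).det with hD
  have hDc : Continuous (fun q : ℝ × E => D q.1 q.2) := by
    refine ContinuousLinearMap.continuous_det.comp ?_
    exact continuous_const.add (continuous_fst.smul (hg'.comp continuous_snd))
  -- positivity of the determinant for small `t`
  obtain ⟨ε, hε, hpos⟩ : ∃ ε > 0, ∀ t : ℝ, |t| < ε → ∀ x ∈ B, 0 < D t x := by
    obtain ⟨u, w, hu, -, h0u, hBw, huw⟩ := generalized_tube_lemma (isCompact_singleton (x := (0 : ℝ)))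
      hBc (hDc.isOpen_preimage _ isOpen_Ioi) (n := (fun q : ℝ × E => D q.1 q.2) ⁻¹' Ioi 0) (by
        rintro ⟨t, x⟩ ⟨ht, -⟩
        have ht' : t = 0 := ht
        subst ht'
        simp [hD, ContinuousLinearMap.det])
    obtain ⟨ε, hε, hεu⟩ := Metric.isOpen_iff.1 hu 0 (h0u rfl)
    exact ⟨ε, hε, fun t ht x hx => huw (a := (t, x)) ⟨hεu (by
      rw [mem_ball, Real.dist_eq, sub_zero]; exact ht), hBw hx⟩⟩
  have hint : ∀ t : ℝ, 0 ≤ t → t ≤ 1 → t * L < 1 → t < ε → ∫ x in B, D t x = volume.real B := by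
    intro t ht0 ht1 htL htε
    obtain ⟨hinj, him⟩ := himage t ht0 ht1 htL
    have h3 := integral_image_eq_integral_abs_det_fderiv_smul volume
      (s := B) (f := fun x => x + t • g x) (f' := fun x => ContinuousLinearMap.id ℝ E + t • fderiv ℝ g x)
      isClosed_closedBall.measurableSet
      (fun x _ => ((hasFDerivAt_id x).add
        (((hg.differentiable one_ne_zero) x).hasFDerivAt.const_smul t)).hasFDerivWithinAt) hinj
      (fun _ => (1 : ℝ))
    rw [him] at h3
    simp only [integral_const, MeasurableSet.univ, measureReal_restrict_apply, univ_inter,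
      smul_eq_mul, mul_one] at h3
    rw [h3]
    refine setIntegral_congr_fun isClosed_closedBall.measurableSet fun x hx => ?_
    exact (abs_of_pos (hpos t (by rwa [abs_of_nonneg ht0]) x hx)).symm
  -- `n + 1` nodes in the range where the integral is known
  obtain ⟨δ, hδ, hδ1, hδL, hδε⟩ : ∃ δ : ℝ, 0 < δ ∧ δ ≤ 1 ∧ δ * L < 1 ∧ δ < ε := by
    have hLp : (0 : ℝ) < L + 1 := by positivity
    refine ⟨min (min 1 (1 / (L + 1))) (ε / 2), by positivity,
      (min_le_left _ _).trans (min_le_left _ _), ?_, (min_le_right _ _).trans_lt (by linarith)⟩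
    have : min (min 1 (1 / ((L : ℝ) + 1))) (ε / 2) ≤ 1 / (L + 1) :=
      (min_le_left _ _).trans (min_le_right _ _)
    calc _ ≤ 1 / ((L : ℝ) + 1) * L := by gcongr
      _ < 1 := by rw [div_mul_eq_mul_div, one_mul, div_lt_one hLp]; linarith
  set v : Fin (n + 1) → ℝ := fun j => δ * ((j : ℝ) / (n + 1)) with hv
  have hvinj : Function.Injective v := by
    intro i j hij
    have hn : (n : ℝ) + 1 ≠ 0 := by positivity
    simp only [hv] at hij
    have := mul_left_cancel₀ hδ.ne' hij
    rw [div_left_inj' hn] at this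
    exact Fin.ext (by exact_mod_cast this)
  have hv0 : ∀ j, 0 ≤ v j := fun j => by positivity
  have hvδ : ∀ j, v j ≤ δ := fun j => by
    have : (j : ℝ) / (n + 1) ≤ 1 := by
      rw [div_le_one (by positivity)]
      have := j.2
      exact_mod_cast this.le
    simp only [hv]; nlinarith
  obtain ⟨l, hl1, hl⟩ := exists_interpolation_det (E := E) (n := n) rfl v hvinj
  have hD1 : ∫ x in B, D 1 x = volume.real B := by
    have h4 : ∀ x, D 1 x = ∑ j, l j * D (v j) x := fun x => by
      simp only [hD, one_smul]; exact hl _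
    simp only [h4]
    rw [integral_finsetSum]
    · simp only [integral_const_mul]
      rw [Finset.sum_congr rfl fun j _ => by
        rw [hint (v j) (hv0 j) ((hvδ j).trans hδ1)
          (lt_of_le_of_lt (mul_le_mul_of_nonneg_right (hvδ j) L.coe_nonneg) hδL) ((hvδ j).trans_lt hδε)],
        ← Finset.sum_mul, hl1, one_mul]
    · intro j _
      refine ContinuousOn.integrableOn_compact hBc ?_
      exact (continuous_const.mul (hDc.comp (continuous_const.prodMk continuous_id))).continuousOn
  -- at `t = 1` the determinant vanishes inside the ball
  have hD0 : ∀ x ∈ ball (0 : E) 1, D 1 x = 0 := by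
    intro x hx
    have hxr : ‖r x‖ = 1 := h1 x (by simpa using (mem_ball_zero_iff.1 hx).le)
    have hrx : HasFDerivAt r (fderiv ℝ r x) x := ((hr.differentiable one_ne_zero) x).hasFDerivAt
    have hid : ContinuousLinearMap.id ℝ E + (1 : ℝ) • fderiv ℝ g x = fderiv ℝ r x := by
      have : fderiv ℝ g x = fderiv ℝ r x - ContinuousLinearMap.id ℝ E :=
        (hrx.sub (hasFDerivAt_id x)).fderiv
      rw [this, one_smul]; abel
    have horth : ∀ w, inner ℝ (r x) (fderiv ℝ r x w) = 0 := by
      intro w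
      have h5 := hrx.norm_sq
      have h6 : HasFDerivAt (fun y => ‖r y‖ ^ 2) (0 : E →L[ℝ] ℝ) x := by
        refine (hasFDerivAt_const (1 : ℝ) x).congr_of_eventuallyEq ?_
        filter_upwards [isOpen_ball.mem_nhds hx] with y hy
        rw [h1 y (by simpa using (mem_ball_zero_iff.1 hy).le), one_pow]
      have h7 := congrArg (fun A => A w) (h5.unique h6)
      simpa using h7
    by_contra hne
    simp only [hD, hid] at hne
    have hsurj := LinearEquiv.surjective (LinearMap.equivOfDetNeZero (fderiv ℝ r x).toLinearMap hne)
    obtain ⟨w, hw⟩ := hsurj (r x)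
    have hw' : fderiv ℝ r x w = r x := hw
    have := horth w
    rw [hw', real_inner_self_eq_norm_sq, hxr] at this
    norm_num at this
  have hzero : ∫ x in B, D 1 x = 0 := by
    have : ∫ x in B, D 1 x = ∫ x in ball (0 : E) 1, D 1 x := by
      refine setIntegral_congr_set ?_
      by_cases hn : Nontrivial E
      · exact (ae_eq_of_subset_of_measure_ge ball_subset_closedBall
          (Measure.addHaar_closedBall_eq_addHaar_ball volume 0 1).le
          measurableSet_ball.nullMeasurableSet (measure_closedBall_lt_top.ne)).symm
      · rw [not_nontrivial_iff_subsingleton] at hn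
        have := h1 0 (by simp)
        rw [Subsingleton.elim (r 0) 0] at this
        simp at this
    rw [this]
    exact setIntegral_eq_zero_of_forall_eq_zero hD0
  have hvol : 0 < volume.real B := by
    rw [measureReal_def]
    exact ENNReal.toReal_pos (measure_closedBall_pos volume 0 one_pos).ne'
      measure_closedBall_lt_top.ne
  rw [hD1] at hzero
  exact hvol.ne' hzero

/-- A continuous self-map of Euclidean space that is the identity outside a ball hits the centre of
the ball. -/
theorem mem_range_of_eqOn_compl_ball {E : Type*} [NormedAddCommGroup E] [InnerProductSpace ℝ E]
    [FiniteDimensional ℝ E] {f : E → E} (hf : Continuous f) {q : E} {R : ℝ} (hR : 0 < R) (h : ∀ x, R ≤ dist x q → f x = x) :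
    q ∈ range f := by
  by_contra hq
  -- rescale the ball to the ball of radius `1/2` around `0`
  set F : E → E := fun x => (2 * R)⁻¹ • (f (q + (2 * R) • x) - q) with hF
  have hFc : Continuous F := by fun_prop
  have hR2 : (2 * R) ≠ 0 := by positivity
  have hFid : ∀ x, 1 / 2 ≤ ‖x‖ → F x = x := by
    intro x hx
    have : f (q + (2 * R) • x) = q + (2 * R) • x := h _ (by
      rw [dist_eq_norm, add_sub_cancel_left, norm_smul, Real.norm_of_nonneg (by positivity)]
      nlinarith [mul_le_mul_of_nonneg_left hx hR.le])
    simp only [hF, this, add_sub_cancel_left]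
    exact inv_smul_smul₀ hR2 x
  have hF0 : ∀ x, F x ≠ 0 := by
    intro x hx
    simp only [hF, smul_eq_zero, inv_eq_zero, hR2, false_or, sub_eq_zero] at hx
    exact hq ⟨_, hx⟩
  obtain ⟨G, hG, hGF, hGs⟩ := (hFc.sub continuous_id).exists_contDiff_approx 1
    (ε := fun x => ‖F x‖) hFc.norm (fun x => norm_pos_iff.2 (hF0 x))
  have hGid : ∀ x, 1 / 2 ≤ ‖x‖ → G x = 0 := by
    intro x hx
    by_contra hne
    have : x ∈ Function.support (F - id) := hGs hne
    simp [hFid x hx] at this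
  have hne : ∀ x, x + G x ≠ 0 := by
    intro x hx
    have h3 := hGF x
    rw [eq_neg_of_add_eq_zero_right hx] at h3
    simp only [dist_eq_norm, Pi.sub_apply, id] at h3
    rw [show -x - (F x - x) = - F x by abel, norm_neg] at h3
    exact lt_irrefl _ h3
  refine not_exists_smooth_retraction (r := fun x => ‖x + G x‖⁻¹ • (x + G x)) ?_ ?_ ?_
  · have hs : ContDiff ℝ 1 fun x => x + G x := contDiff_id.add hG
    exact ((hs.norm ℝ hne).inv fun x => norm_ne_zero_iff.2 (hne x)).smul hs
  · intro x _
    rw [norm_smul, norm_inv, norm_norm, inv_mul_cancel₀ (norm_ne_zero_iff.2 (hne x))]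
  · intro x hx
    rw [hGid x (by rw [hx]; norm_num), add_zero, hx, inv_one, one_smul]

end Brouwer

/-! ### Edge points of manifolds with corners -/

section EdgePoints
open Metric

/-- `x` is an edge point of `X` if, arbitrarily close to `x`, the space can be deformed so as to
miss `x`. For manifolds with corners this describes the points of the boundary without reference
to charts. -/
def IsEdgePoint {X : Type*} [TopologicalSpace X] (x : X) : Prop :=
  ∀ U ∈ 𝓝 x, ∃ f : X → X, Continuous f ∧ (∀ y ∉ U, f y = y) ∧ MapsTo f U U ∧ x ∉ range f

theorem IsEdgePoint.of_openPartialHomeomorph {X Y : Type*} [TopologicalSpace X]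
    [TopologicalSpace Y] [RegularSpace Y] (φ : OpenPartialHomeomorph Y X) {y : Y}
    (hy : y ∈ φ.source) (h : IsEdgePoint (φ y)) : IsEdgePoint y := by
  classical
  intro U hU
  obtain ⟨K, hK, hKc, hKV⟩ := exists_mem_nhds_isClosed_subset
    (Filter.inter_mem (φ.open_source.mem_nhds hy) hU)
  have hKs : interior K ⊆ φ.source := fun z hz => (hKV (interior_subset hz)).1
  have hKU : interior K ⊆ U := fun z hz => (hKV (interior_subset hz)).2
  have hyK : y ∈ interior K := mem_interior_iff_mem_nhds.2 hK
  have hopen : IsOpen (φ '' interior K) := φ.isOpen_image_of_subset_source isOpen_interior hKs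
  obtain ⟨f, hf, hid, hmaps, hrange⟩ := h _ (hopen.mem_nhds ⟨y, hyK, rfl⟩)
  have hcases : ∀ z ∈ φ.source, (z ∈ interior K ∧ f (φ z) ∈ φ '' interior K) ∨
      (z ∉ interior K ∧ f (φ z) = φ z) := by
    intro z hz
    by_cases hzK : z ∈ interior K
    · exact .inl ⟨hzK, hmaps ⟨z, hzK, rfl⟩⟩
    · refine .inr ⟨hzK, hid _ ?_⟩
      rintro ⟨w, hw, hwz⟩
      exact hzK (φ.injOn (hKs hw) hz hwz ▸ hw)
  have htarget : ∀ z ∈ φ.source, f (φ z) ∈ φ.target := by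
    intro z hz
    rcases hcases z hz with ⟨-, w, hw, hwz⟩ | ⟨-, h1⟩
    · exact hwz ▸ φ.map_source (hKs hw)
    · rw [h1]; exact φ.map_source hz
  -- the deformation in the chart, extended by the identity; the closed neighbourhood `K` makes this
  -- continuous at the frontier of the chart
  set g : Y → Y := fun z => if z ∈ φ.source then φ.symm (f (φ z)) else z with hg
  have hgs : ∀ z ∈ φ.source, g z = φ.symm (f (φ z)) := fun z hz => if_pos hz
  have hgid : ∀ z ∉ interior K, g z = z := by
    intro z hzK
    by_cases hz : z ∈ φ.source
    · rcases hcases z hz with ⟨h1, -⟩ | ⟨-, h1⟩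
      · exact absurd h1 hzK
      · rw [hgs z hz, h1, φ.left_inv hz]
    · exact if_neg hz
  refine ⟨g, continuous_iff_continuousAt.2 fun z => ?_, fun z hz => hgid z fun h1 => hz (hKU h1),
    fun z hz => ?_, ?_⟩
  · by_cases hz : z ∈ φ.source
    · have h1 : ContinuousAt (fun w => φ.symm (f (φ w))) z :=
        (φ.continuousAt_symm (htarget z hz)).comp (f := fun w => f (φ w))
          (hf.continuousAt.comp (φ.continuousAt hz))
      refine h1.congr ?_
      filter_upwards [φ.open_source.mem_nhds hz] with w hw
      exact (hgs w hw).symm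
    · refine continuousAt_id.congr ?_
      have : z ∈ Kᶜ := fun h1 => hz (hKV h1).1
      filter_upwards [hKc.isOpen_compl.mem_nhds this] with w hw
      exact (hgid w fun h1 => hw (interior_subset h1)).symm
  · by_cases hzK : z ∈ interior K
    · rcases hcases z (hKs hzK) with ⟨-, w, hw, hwz⟩ | ⟨h1, -⟩
      · rw [hgs z (hKs hzK), ← hwz, φ.left_inv (hKs hw)]
        exact hKU hw
      · exact absurd hzK h1
    · rw [hgid z hzK]; exact hz
  · rintro ⟨z, hz⟩
    by_cases hzs : z ∈ φ.source
    · rw [hgs z hzs] at hz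
      refine hrange ⟨φ z, ?_⟩
      rw [← hz, φ.right_inv (htarget z hzs)]
    · rw [hgid z fun h1 => hzs (hKs h1)] at hz
      exact hzs (hz ▸ hy)

theorem isEdgePoint_openPartialHomeomorph_iff {X Y : Type*} [TopologicalSpace X]
    [TopologicalSpace Y] [RegularSpace Y] [RegularSpace X] (φ : OpenPartialHomeomorph Y X) {y : Y}
    (hy : y ∈ φ.source) : IsEdgePoint (φ y) ↔ IsEdgePoint y := by
  refine ⟨fun h => h.of_openPartialHomeomorph φ hy, fun h => ?_⟩
  refine IsEdgePoint.of_openPartialHomeomorph φ.symm (φ.map_source hy) ?_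
  rwa [φ.left_inv hy]

theorem IsLocalHomeomorph.isEdgePoint_iff {X Y : Type*} [TopologicalSpace X]
    [TopologicalSpace Y] [RegularSpace Y] [RegularSpace X] {p : Y → X} (hp : IsLocalHomeomorph p)
    (y : Y) : IsEdgePoint (p y) ↔ IsEdgePoint y := by
  obtain ⟨φ, hy, rfl⟩ := hp y
  exact isEdgePoint_openPartialHomeomorph_iff φ hy

/-- A point `q` of a subset `S` of a normed space is an edge point of `S` if the flow of a bounded
vector field pushes `S` into itself and away from `q`. -/
theorem isEdgePoint_of_vectorField {E : Type*} [NormedAddCommGroup E] [NormedSpace ℝ E] {S : Set E}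
    (q : S) {V : E → E} (hV : Continuous V) (hV1 : ∀ y ∈ S, ‖V y‖ ≤ 1)
    (hVS : ∀ y ∈ S, ∀ c : ℝ, 0 ≤ c → c ≤ 1 / 2 → y + c • V y ∈ S)
    (hVq : ∀ y ∈ S, ∀ c : ℝ, 0 < c → c ≤ 1 / 2 → y + c • V y ≠ q) : IsEdgePoint q := by
  intro U hU
  obtain ⟨ε, hε, hεU⟩ := Metric.mem_nhds_iff.1 hU
  set δ := min ε 1
  have hδ : 0 < δ := lt_min hε one_pos
  have hδU : ball q δ ⊆ U := (ball_subset_ball (min_le_left _ _)).trans hεU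
  -- the time of the flow, supported in the ball of radius `δ`; the factor `1 / 2` keeps this ball
  -- invariant, as `V` has norm at most one
  set c : S → ℝ := fun y => max 0 (δ - dist y q) / 2
  have hc0 : ∀ y, 0 ≤ c y := fun y => by positivity
  have hc1 : ∀ y, c y ≤ 1 / 2 := fun y => by
    have h1 : δ ≤ 1 := min_le_right _ _
    have h2 := dist_nonneg (x := y) (y := q)
    have : max 0 (δ - dist y q) ≤ 1 := max_le zero_le_one (by linarith)
    simp only [c]; linarith
  have hout : ∀ y, δ ≤ dist y q → c y = 0 := fun y hy => by
    simp only [c, max_eq_left (sub_nonpos.2 hy), zero_div]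
  refine ⟨fun y => ⟨y + c y • V y, hVS y y.2 _ (hc0 y) (hc1 y)⟩, ?_, fun y hy => ?_,
    fun y hy => ?_, ?_⟩
  · refine Continuous.subtype_mk ?_ _
    have hcc : Continuous c := by fun_prop
    exact continuous_subtype_val.add (hcc.smul (hV.comp continuous_subtype_val))
  · have : c y = 0 := hout y (not_lt.1 fun h => hy (hδU h))
    simp [this]
  · by_cases h : dist y q < δ
    · refine hδU ?_
      have h1 : c y = (δ - dist y q) / 2 := by simp only [c, max_eq_right (sub_nonneg.2 h.le)]
      rw [mem_ball, Subtype.dist_eq, dist_eq_norm]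
      have h2 : ‖(y : E) - q‖ = dist y q := by rw [Subtype.dist_eq, dist_eq_norm]
      calc ‖(y : E) + c y • V y - q‖ = ‖((y : E) - q) + c y • V y‖ := by congr 1; abel
        _ ≤ dist y q + c y * 1 := by
          refine (norm_add_le _ _).trans ?_
          rw [h2, norm_smul, Real.norm_of_nonneg (hc0 y)]
          gcongr
          exact hV1 y y.2
        _ < δ := by rw [h1]; linarith
    · have : c y = 0 := hout y (not_lt.1 h)
      simpa [this] using hy
  · rintro ⟨y, hy⟩
    have hy' : (y : E) + c y • V y = q := congrArg Subtype.val hy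
    rcases (hc0 y).eq_or_lt with h | h
    · rw [← h, zero_smul, add_zero] at hy'
      have h1 : y = q := Subtype.ext hy'
      have : c y = δ / 2 := by simp [c, h1, hδ.le]
      linarith
    · exact hVq y y.2 _ h (hc1 y) hy'

/-- By Brouwer's theorem, an interior point of a subset of Euclidean space is not an edge point. -/
theorem not_isEdgePoint_of_mem_interior {E : Type*} [NormedAddCommGroup E] [InnerProductSpace ℝ E]
    [FiniteDimensional ℝ E] {S : Set E} (q : S) (hq : (q : E) ∈ interior S) : ¬ IsEdgePoint q := by
  classical
  intro h
  obtain ⟨ε, hε, hεS⟩ := Metric.isOpen_iff.1 isOpen_interior _ hq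
  replace hεS := hεS.trans interior_subset
  obtain ⟨f, hf, hid, -, hrange⟩ := h (ball q (ε / 2)) (ball_mem_nhds q (half_pos hε))
  set F : E → E := fun x => if hx : x ∈ S then f ⟨x, hx⟩ else x with hF
  have hFS : ∀ x : S, F x = f x := fun x => by simp [hF]
  have hFid : ∀ x, ε / 2 ≤ dist x (q : E) → F x = x := by
    intro x hx
    by_cases hxS : x ∈ S
    · have := hid ⟨x, hxS⟩ (by simpa [Subtype.dist_eq] using hx)
      rw [hFS ⟨x, hxS⟩, this]
    · simp [hF, hxS]
  have hFc : Continuous F := by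
    refine continuous_iff_continuousAt.2 fun x => ?_
    by_cases hx : dist x (q : E) < ε
    · have hxS : S ∈ 𝓝 x := Filter.mem_of_superset (isOpen_ball.mem_nhds hx) hεS
      have h1 : ContinuousOn F S := by
        rw [continuousOn_iff_continuous_domRestrict]
        have : S.domRestrict F = fun x => (f x : E) := funext hFS
        rw [this]; exact continuous_subtype_val.comp hf
      exact h1.continuousAt hxS
    · refine continuousAt_id.congr ?_
      have hx' : x ∈ (closedBall (q : E) (ε / 2))ᶜ := by
        rw [mem_compl_iff, mem_closedBall]; linarith
      filter_upwards [isClosed_closedBall.isOpen_compl.mem_nhds hx'] with y hy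
      rw [mem_compl_iff, mem_closedBall, not_le] at hy
      exact (hFid y hy.le).symm
  obtain ⟨x, hx⟩ := mem_range_of_eqOn_compl_ball hFc (half_pos hε) hFid
  by_cases hxS : x ∈ S
  · rw [hFS ⟨x, hxS⟩] at hx
    exact hrange ⟨_, Subtype.ext hx⟩
  · simp only [hF, hxS, dif_neg, not_false_eq_true] at hx
    exact hxS (hx ▸ q.2)

theorem isEdgePoint_closedBall_iff {E : Type*} [NormedAddCommGroup E] [InnerProductSpace ℝ E]
    [FiniteDimensional ℝ E] (q : closedBall (0 : E) 1) : IsEdgePoint q ↔ ‖(q : E)‖ = 1 := by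
  refine ⟨fun h => ?_, fun h => ?_⟩
  · have hle : ‖(q : E)‖ ≤ 1 := mem_closedBall_zero_iff.1 q.2
    by_contra hne
    refine not_isEdgePoint_of_mem_interior q ?_ h
    refine interior_mono ball_subset_closedBall ?_
    rw [isOpen_ball.interior_eq, mem_ball_zero_iff]
    exact lt_of_le_of_ne hle hne
  · refine isEdgePoint_of_vectorField q (V := fun y => -y) continuous_neg (fun y hy => ?_)
      (fun y hy c hc0 hc1 => ?_) (fun y hy c hc0 hc1 heq => ?_)
    · simpa using hy
    all_goals
      have hy' : ‖y‖ ≤ 1 := by simpa using hy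
      have h1 : y + c • -y = (1 - c) • y := by rw [sub_smul, one_smul, smul_neg, sub_eq_add_neg]
      have h2 : ‖y + c • -y‖ = (1 - c) * ‖y‖ := by
        rw [h1, norm_smul, Real.norm_of_nonneg (by linarith)]
    · rw [mem_closedBall_zero_iff, h2]
      nlinarith [norm_nonneg y]
    · rw [heq, h] at h2
      nlinarith [norm_nonneg y]

theorem isEdgePoint_euclideanQuadrant_iff {n : ℕ} (q : EuclideanQuadrant n) :
    IsEdgePoint q ↔ ∃ j, q.1 j = 0 := by
  refine ⟨fun h => ?_, fun ⟨j, hj⟩ => ?_⟩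
  · by_contra! hne
    refine not_isEdgePoint_of_mem_interior (S := {x : EuclideanSpace ℝ (Fin n) | ∀ i, 0 ≤ x i}) q ?_ h
    rw [mem_interior]
    refine ⟨{x | ∀ i, 0 < x i}, fun x hx i => (hx i).le, ?_, fun i => (q.2 i).lt_of_ne (hne i).symm⟩
    simp only [ofPred_forall]
    exact isOpen_iInter_of_finite fun i => isOpen_lt continuous_const (by fun_prop)
  · refine isEdgePoint_of_vectorField (S := {x : EuclideanSpace ℝ (Fin n) | ∀ i, 0 ≤ x i}) q
      (V := fun _ => EuclideanSpace.single j 1) continuous_const (fun y hy => by simp)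
      (fun y hy c hc0 hc1 i => ?_) (fun y hy c hc0 hc1 heq => ?_)
    · have : 0 ≤ (EuclideanSpace.single j (1 : ℝ) : EuclideanSpace ℝ (Fin n)) i := by
        rw [PiLp.single_apply]; split_ifs <;> norm_num
      have h1 := hy i
      simp only [PiLp.add_apply, PiLp.smul_apply, smul_eq_mul]
      positivity
    · have h1 := congrArg (fun x : EuclideanSpace ℝ (Fin n) => x j) heq
      have h2 : 0 ≤ y j := hy j
      simp only [PiLp.add_apply, PiLp.smul_apply, PiLp.single_apply, if_true, smul_eq_mul,
        hj] at h1
      linarith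

variable {n : ℕ} {X : Type v} [TopologicalSpace X] [ChartedSpace (EuclideanQuadrant n) X]

theorem isEdgePoint_iff_depth_pos [RegularSpace X] (x : X) : IsEdgePoint x ↔ 0 < depth n x := by
  have : RegularSpace (EuclideanQuadrant n) :=
    inferInstanceAs (RegularSpace {x : EuclideanSpace ℝ (Fin n) // ∀ i, 0 ≤ x i})
  rw [← isEdgePoint_openPartialHomeomorph_iff (chartAt (EuclideanQuadrant n) x)
    (mem_chart_source _ x), isEdgePoint_euclideanQuadrant_iff, depth, Set.ncard_pos (toFinite _)]
  rfl

theorem bdry_eq_isEdgePoint [RegularSpace X] (h : IsManifoldWithFaces n X) :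
    bdry n X = {x : X | IsEdgePoint x} := by
  have hq : RegularSpace (EuclideanQuadrant n) :=
    inferInstanceAs (RegularSpace {x : EuclideanSpace ℝ (Fin n) // ∀ i, 0 ≤ x i})
  refine Subset.antisymm ?_ fun x hx => ?_
  · refine closure_minimal (fun x hx => ?_) (isOpen_compl_iff.1 (isOpen_iff_mem_nhds.2 fun x hx => ?_))
    · exact (isEdgePoint_iff_depth_pos x).2 (by rw [show depth n x = 1 from hx]; exact one_pos)
    · have hφ := mem_chart_source (EuclideanQuadrant n) x
      set φ := chartAt (EuclideanQuadrant n) x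
      have hx' : ¬ IsEdgePoint x := hx
      rw [← isEdgePoint_openPartialHomeomorph_iff φ hφ, isEdgePoint_euclideanQuadrant_iff] at hx'
      have hopen : IsOpen {q : EuclideanQuadrant n | ¬ ∃ j, q.1 j = 0} := by
        simp only [not_exists, ofPred_forall]
        refine isOpen_iInter_of_finite fun j => isOpen_ne_fun ?_ continuous_const
        exact (by fun_prop : Continuous fun y : EuclideanSpace ℝ (Fin n) => y j).comp
          continuous_subtype_val
      filter_upwards [φ.open_source.mem_nhds hφ,
        (φ.continuousAt hφ).preimage_mem_nhds (hopen.mem_nhds hx')] with y hy hy'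
      change ¬ IsEdgePoint y
      rwa [← isEdgePoint_openPartialHomeomorph_iff φ hy, isEdgePoint_euclideanQuadrant_iff]
  · have h1 := (isEdgePoint_iff_depth_pos (n := n) x).1 hx
    have h2 := h x
    have h3 : {K ∈ componentsOf {y : X | depth n y = 1} | x ∈ closure K}.Nonempty := by
      rw [← Set.encard_ne_zero, h2]
      exact_mod_cast h1.ne'
    obtain ⟨K, ⟨p, hp, rfl⟩, hK⟩ := h3
    exact closure_mono (connectedComponentIn_subset {y : X | depth n y = 1} p) hK

end EdgePoints

/-! ### Lifting discs and spheres to covering spaces -/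

section Coverings
open Metric

variable {Y X A : Type*} [TopologicalSpace Y] [TopologicalSpace X] [TopologicalSpace A]

/-- A connected set over the image of a section `s`, meeting the image of `s`, lies in it: by the
uniqueness of lifts, the inclusion of `K` agrees with `s ∘ p`. -/
theorem IsCoveringMap.subset_range_of_isEmbedding_comp {p : Y → X} (hp : IsCoveringMap p) {s : A → Y}
    (hs : Continuous s) (hθ : Topology.IsEmbedding (p ∘ s)) {K : Set Y} (hK : IsPreconnected K) {a : A}
    (ha : s a ∈ K) (hKθ : MapsTo p K (range (p ∘ s))) : K ⊆ range s := by
  classical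
  set g : Y → Y := fun y => if h : p y ∈ range (p ∘ s) then s (hθ.toHomeomorph.symm ⟨p y, h⟩) else y
  have hg : ∀ y (h : p y ∈ range (p ∘ s)), g y = s (hθ.toHomeomorph.symm ⟨p y, h⟩) :=
    fun y h => dif_pos h
  have hgp : ∀ y, p y ∈ range (p ∘ s) → p (g y) = p y := by
    intro y h
    rw [hg y h]
    exact congrArg Subtype.val (hθ.toHomeomorph.apply_symm_apply ⟨p y, h⟩)
  have hgc : ContinuousOn g K := by
    rw [continuousOn_iff_continuous_domRestrict]
    have : K.domRestrict g = fun y : K => s (hθ.toHomeomorph.symm ⟨p y, hKθ y.2⟩) :=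
      funext fun y => hg y (hKθ y.2)
    rw [this]
    have hpc := hp.continuous
    fun_prop
  have hga : g (s a) = s a := by
    rw [hg _ ⟨a, rfl⟩]
    congr 1
    rw [Homeomorph.symm_apply_eq]
    rfl
  have := hp.eqOn_of_comp_eqOn hK hgc continuousOn_id (fun y hy => hgp y (hKθ hy)) ha hga
  intro y hy
  have h1 := this hy
  rw [hg y (hKθ hy)] at h1
  exact ⟨_, h1⟩

/-- Components that a covering map sends into closed discs are mapped homeomorphically. -/
theorem IsCoveringMap.exists_section_of_disc {p : Y → X} (hp : IsCoveringMap p) (y : Y) {d : ℕ}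
    (h : connectedComponent (p y) ≃ₜ closedBall (0 : EuclideanSpace ℝ (Fin d)) 1) :
    ∃ s : connectedComponent (p y) → Y, Continuous s ∧ (∀ x, p (s x) = x) ∧
      range s = connectedComponent y := by
  have hconv : Convex ℝ (closedBall (0 : EuclideanSpace ℝ (Fin d)) 1) := convex_closedBall 0 1
  have := hconv.contractibleSpace ⟨0, by simp⟩
  have := hconv.locallyPathConnectedSpace
  set a₀ := h ⟨p y, mem_connectedComponent⟩ with ha₀
  obtain ⟨F, ⟨hF0, hF⟩, -⟩ := hp.existsUnique_continuousMap_lifts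
    ⟨fun a => (h.symm a : X), by fun_prop⟩ a₀ y (by simp [ha₀])
  have hFx : ∀ x : connectedComponent (p y), p (F (h x)) = x := fun x => by
    have := congrFun hF (h x)
    simpa using this
  have hsc : Continuous fun x : connectedComponent (p y) => F (h x) := by fun_prop
  refine ⟨fun x => F (h x), hsc, hFx, Subset.antisymm ?_ ?_⟩
  · have : ConnectedSpace (connectedComponent (p y)) :=
      isConnected_iff_connectedSpace.1 isConnected_connectedComponent
    exact (isPreconnected_range hsc).subset_connectedComponent ⟨⟨p y, mem_connectedComponent⟩, hF0⟩
  · have hps : (p ∘ fun x : connectedComponent (p y) => F (h x)) = Subtype.val := funext hFx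
    refine hp.subset_range_of_isEmbedding_comp hsc (by rw [hps]; exact Topology.IsEmbedding.subtypeVal)
      isPreconnected_connectedComponent (a := ⟨p y, mem_connectedComponent⟩) ?_ ?_
    · have h0 : F (h ⟨p y, mem_connectedComponent⟩) = y := hF0
      change F (h ⟨p y, mem_connectedComponent⟩) ∈ connectedComponent y
      rw [h0]
      exact mem_connectedComponent
    · rw [hps, Subtype.range_coe]
      exact hp.continuous.mapsTo_connectedComponent y

theorem IsCoveringMap.exists_mem_connectedComponent {p : Y → X} (hp : IsCoveringMap p)
    [PathConnectedSpace A] {θ : A → X} (hθ : Continuous θ) {e : Y} {a₀ : A} (he : p e = θ a₀)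
    (a : A) : ∃ e' ∈ connectedComponent e, p e' = θ a := by
  obtain ⟨Γ, hΓ, h0⟩ := hp.exists_path_lifts
    (⟨fun t => θ (PathConnectedSpace.somePath a₀ a t), by fun_prop⟩ : C(unitInterval, X)) e
    (by simp [he])
  refine ⟨Γ 1, ?_, ?_⟩
  · exact (isPreconnected_range Γ.continuous).subset_connectedComponent ⟨0, h0⟩ ⟨1, rfl⟩
  · have := congrFun hΓ 1
    simpa using this

/-- Spheres of dimension at least two lift to covering spaces. Two lifts on the complements of
antipodal points agree on the connected intersection of their domains. -/
theorem IsCoveringMap.exists_lift_sphere {p : Y → X} (hp : IsCoveringMap p) {E : Type*}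
    [NormedAddCommGroup E] [InnerProductSpace ℝ E] [FiniteDimensional ℝ E]
    (hE : 2 < Module.finrank ℝ E) {θ : sphere (0 : E) 1 → X} (hθ : Continuous θ)
    (x₀ : sphere (0 : E) 1) {e : Y} (he : p e = θ x₀) :
    ∃ s : sphere (0 : E) 1 → Y, Continuous s ∧ p ∘ s = θ ∧ s x₀ = e := by
  classical
  -- a unit vector orthogonal to `x₀`
  obtain ⟨N, hNx, hNx'⟩ : ∃ N : sphere (0 : E) 1, x₀ ≠ N ∧ x₀ ≠ -N := by
    have : Nontrivial (ℝ ∙ (x₀ : E))ᗮ := by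
      apply Module.nontrivial_of_finrank_pos (R := ℝ)
      have h1 := Submodule.finrank_add_finrank_orthogonal (ℝ ∙ (x₀ : E))
      have h2 := finrank_span_le_card (R := ℝ) ({(x₀ : E)} : Set E)
      rw [toFinset_singleton, Finset.card_singleton] at h2
      omega
    obtain ⟨w, hw⟩ := exists_norm_eq (ℝ ∙ (x₀ : E))ᗮ zero_le_one
    have horth : inner ℝ (x₀ : E) (w : E) = 0 :=
      Submodule.mem_orthogonal_singleton_iff_inner_right.1 w.2
    have hx1 : ‖(x₀ : E)‖ = 1 := by simp
    refine ⟨⟨w, by simpa using hw⟩, fun h => ?_, fun h => ?_⟩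
    · have : (x₀ : E) = w := congrArg Subtype.val h
      rw [← this, real_inner_self_eq_norm_sq, hx1] at horth
      norm_num at horth
    · have : (w : E) = -x₀ := neg_eq_iff_eq_neg.1 (congrArg Subtype.val h).symm
      rw [this, inner_neg_right, real_inner_self_eq_norm_sq, hx1] at horth
      norm_num at horth
  have hlift : ∀ M : sphere (0 : E) 1, x₀ ≠ M → ∃ s : sphere (0 : E) 1 → Y,
      ContinuousOn s {M}ᶜ ∧ (∀ x ≠ M, p (s x) = θ x) ∧ s x₀ = e := by
    intro M hM
    set σ := stereographic (norm_eq_of_mem_sphere M)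
    have hσs : σ.source = {M}ᶜ := stereographic_source _
    have hσt : σ.target = univ := stereographic_target _
    have hσc : Continuous σ.symm := by
      rw [← continuousOn_univ, ← hσt]; exact σ.continuousOn_symm
    obtain ⟨F, ⟨hF0, hF⟩, -⟩ := hp.existsUnique_continuousMap_lifts
      ⟨fun a => θ (σ.symm a), by fun_prop⟩ (σ x₀) e (by
        change p e = θ (σ.symm (σ x₀))
        rw [σ.left_inv (by rw [hσs]; exact hM), he])
    refine ⟨fun x => F (σ x), ?_, fun x hx => ?_, hF0⟩
    · rw [← hσs]; exact F.continuous.comp_continuousOn σ.continuousOn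
    · have := congrFun hF (σ x)
      simp only [Function.comp_apply, ContinuousMap.coe_mk] at this
      rw [this, σ.left_inv (by rw [hσs]; exact hx)]
  -- lifts on the complements of two antipodal points
  obtain ⟨s₁, hs₁c, hs₁, hs₁0⟩ := hlift N hNx
  obtain ⟨s₂, hs₂c, hs₂, hs₂0⟩ := hlift (-N) hNx'
  have hNN : N ≠ -N := by
    intro h
    have h1 : (N : E) = -N := congrArg Subtype.val h
    have h2 : (N : E) = 0 := by
      have : (2 : ℝ) • (N : E) = 0 := by rw [two_smul]; nth_rewrite 2 [h1]; exact add_neg_cancel _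
      simpa using this
    have h3 : ‖(N : E)‖ = 1 := by simp
    rw [h2, norm_zero] at h3
    norm_num at h3
  have hconn : IsPreconnected ({N}ᶜ ∩ {-N}ᶜ : Set (sphere (0 : E) 1)) := by
    set σ := stereographic (norm_eq_of_mem_sphere N)
    have hσs : σ.source = {N}ᶜ := stereographic_source _
    have hσt : σ.target = univ := stereographic_target _
    have hσc : Continuous σ.symm := by
      rw [← continuousOn_univ, ← hσt]; exact σ.continuousOn_symm
    have h0 : σ (-N) = 0 := stereographic_apply_neg N
    have himg : ({N}ᶜ ∩ {-N}ᶜ : Set (sphere (0 : E) 1)) = σ.symm '' {0}ᶜ := by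
      ext x
      constructor
      · rintro ⟨h1, h2⟩
        refine ⟨σ x, fun h3 => h2 ?_, σ.left_inv (by rw [hσs]; exact h1)⟩
        have h3' : σ x = 0 := h3
        exact σ.injOn (by rw [hσs]; exact h1) (by rw [hσs]; exact hNN.symm) (h3'.trans h0.symm)
      · rintro ⟨a, ha, rfl⟩
        have hat : a ∈ σ.target := by rw [hσt]; trivial
        refine ⟨?_, fun h => ha ?_⟩
        · rw [← hσs]; exact σ.map_target hat
        · have h' : σ.symm a = -N := h
          rw [mem_singleton_iff, ← h0, ← h', σ.right_inv hat]
    rw [himg]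
    refine (isConnected_compl_singleton_of_one_lt_rank ?_ 0).isPreconnected.image _ hσc.continuousOn
    rw [← Module.finrank_eq_rank]
    have h1 := Submodule.finrank_add_finrank_orthogonal (ℝ ∙ (N : E))
    have h2 := finrank_span_le_card (R := ℝ) ({(N : E)} : Set E)
    rw [toFinset_singleton, Finset.card_singleton] at h2
    exact_mod_cast (by omega : 1 < Module.finrank ℝ (ℝ ∙ (N : E))ᗮ)
  have hagree : EqOn s₁ s₂ ({N}ᶜ ∩ {-N}ᶜ) :=
    hp.eqOn_of_comp_eqOn hconn (hs₁c.mono inter_subset_left) (hs₂c.mono inter_subset_right)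
      (fun x hx => (hs₁ x hx.1).trans (hs₂ x hx.2).symm) ⟨hNx, hNx'⟩ (hs₁0.trans hs₂0.symm)
  set s : sphere (0 : E) 1 → Y := fun x => if x = N then s₂ x else s₁ x with hs
  have hse₁ : EqOn s s₁ {N}ᶜ := fun x hx => if_neg hx
  have hse₂ : EqOn s s₂ {-N}ᶜ := by
    intro x hx
    by_cases h : x = N
    · exact if_pos h
    · exact (if_neg h).trans (hagree ⟨h, hx⟩)
  refine ⟨s, continuous_iff_continuousAt.2 fun x => ?_, funext fun x => ?_, ?_⟩
  · by_cases h : x = N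
    · exact (hs₂c.congr hse₂).continuousAt (isOpen_compl_singleton.mem_nhds (h ▸ hNN))
    · exact (hs₁c.congr hse₁).continuousAt (isOpen_compl_singleton.mem_nhds h)
  · by_cases h : x = N
    · have h' : x ≠ -N := h ▸ hNN
      exact (congrArg p (hse₂ h')).trans (hs₂ x h')
    · exact (congrArg p (hse₁ h)).trans (hs₁ x h)
  · exact (hse₁ hNx).trans hs₁0

end Coverings

/-! ### Gluing a covering space from closed pieces -/

section Patching

/-- Data for gluing a covering space of `S` from pieces: `B` is the disjoint union of pieces, one
for each `t : T`, which map injectively to closed subsets of `S`; `rel` says which points of the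
pieces are glued together. -/
structure Patching (B S T : Type*) [TopologicalSpace S] where
  p : B → S
  τ : B → T
  rel : Setoid B
  p_eq : ∀ {e e'}, rel e e' → p e = p e'
  inj : ∀ {e e'}, p e = p e' → τ e = τ e' → e = e'
  isClosed_piece : ∀ t, IsClosed {x | ∃ e, τ e = t ∧ p e = x}
  isClosed_overlap : ∀ t t', IsClosed {x | ∃ e e', rel e e' ∧ τ e = t ∧ τ e' = t' ∧ p e = x}
  isClosed_nonoverlap : ∀ t t', IsClosed (({x | ∃ e, τ e = t ∧ p e = x} ∩
    {x | ∃ e, τ e = t' ∧ p e = x}) \ {x | ∃ e e', rel e e' ∧ τ e = t ∧ τ e' = t' ∧ p e = x})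
  /-- Near the image of a point of the glued space, `S` is covered by the pieces which contain that
  point. -/
  eventually_mem : ∀ e, ∀ᶠ y in 𝓝 (p e), ∃ e' e'', rel e e' ∧ τ e'' = τ e' ∧ p e'' = y

namespace Patching

variable {B S T : Type*} [TopologicalSpace S] (P : Patching B S T)

/-- The glued space. -/
def Total : Type _ := Quotient P.rel

/-- The point of the glued space given by a point of a piece. -/
def cls (e : B) : P.Total := Quotient.mk P.rel e

/-- The projection of the glued space to `S`. -/
def proj : P.Total → S := Quotient.lift P.p fun _ _ h => P.p_eq h

/-- The point `q` of the glued space lies in the piece `t`. -/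
def Mem (q : P.Total) (t : T) : Prop := ∃ e, P.cls e = q ∧ P.τ e = t

/-- The coarsest topology for which the projection is continuous and the pieces are closed. -/
instance : TopologicalSpace P.Total :=
  TopologicalSpace.induced (fun q => (P.proj q, fun t => ¬ P.Mem q t)) inferInstance

theorem continuous_iff {Z : Type*} [TopologicalSpace Z] {f : Z → P.Total} :
    Continuous f ↔ Continuous (P.proj ∘ f) ∧ ∀ t, IsClosed {z | P.Mem (f z) t} := by
  rw [continuous_induced_rng, continuous_prodMk]
  refine and_congr Iff.rfl ?_
  rw [continuous_pi_iff]
  refine forall_congr' fun t => ?_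
  rw [continuous_Prop, ← isOpen_compl_iff]
  rfl

theorem continuous_proj : Continuous P.proj := (P.continuous_iff.1 continuous_id).1

theorem isClosed_mem (t : T) : IsClosed {q | P.Mem q t} := (P.continuous_iff.1 continuous_id).2 t

theorem surjective_cls : Function.Surjective P.cls := Quotient.mk_surjective

theorem cls_eq_cls {e e' : B} : P.cls e = P.cls e' ↔ P.rel e e' := Quotient.eq

theorem exists_mem (q : P.Total) : ∃ t, P.Mem q t := by
  obtain ⟨e, rfl⟩ := P.surjective_cls q
  exact ⟨_, e, rfl, rfl⟩

theorem eq_of_mem {q q' : P.Total} {t : T} (h : P.Mem q t) (h' : P.Mem q' t)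
    (hp : P.proj q = P.proj q') : q = q' := by
  obtain ⟨e, rfl, he⟩ := h
  obtain ⟨e', rfl, he'⟩ := h'
  rw [P.inj hp (he.trans he'.symm)]

theorem piece_iff {t : T} {x : S} : (∃ e, P.τ e = t ∧ P.p e = x) ↔ ∃ q, P.Mem q t ∧ P.proj q = x :=
  ⟨fun ⟨e, h, h'⟩ => ⟨P.cls e, ⟨e, rfl, h⟩, h'⟩, fun ⟨_, ⟨e, h, h'⟩, hx⟩ => ⟨e, h', by rw [← hx, ← h]; rfl⟩⟩

theorem overlap_iff {t t' : T} {x : S} :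
    (∃ e e', P.rel e e' ∧ P.τ e = t ∧ P.τ e' = t' ∧ P.p e = x) ↔
      ∃ q, P.Mem q t ∧ P.Mem q t' ∧ P.proj q = x := by
  constructor
  · rintro ⟨e, e', hr, h, h', hx⟩
    exact ⟨P.cls e, ⟨e, rfl, h⟩, ⟨e', (P.cls_eq_cls.2 hr).symm, h'⟩, hx⟩
  · rintro ⟨_, ⟨e, rfl, h⟩, ⟨e', he', h'⟩, hx⟩
    exact ⟨e, e', P.cls_eq_cls.1 he'.symm, h, h', hx⟩

theorem mem_nhds [Finite T] (q : P.Total) : ∀ᶠ q' in 𝓝 q, ∀ t, P.Mem q' t → P.Mem q t := by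
  rw [Filter.eventually_all]
  intro t
  by_cases h : P.Mem q t
  · exact Filter.Eventually.of_forall fun _ _ => h
  · filter_upwards [(P.isClosed_mem t).isOpen_compl.mem_nhds h] with q' hq' h'
    exact absurd h' hq'

theorem finite_fiber [Finite T] (x : S) : Finite {q : Quotient P.rel // P.proj q = x} := by
  refine Finite.of_injective (fun q => (P.exists_mem q.1).choose) fun q q' h => ?_
  refine Subtype.ext (P.eq_of_mem (P.exists_mem q.1).choose_spec ?_ (q.2.trans q'.2.symm))
  have h' : (P.exists_mem q.1).choose = (P.exists_mem q'.1).choose := h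
  rw [h']
  exact (P.exists_mem q'.1).choose_spec

/-- The projection of the glued space is a covering map: near `x`, a sheet is the set of points that
lie in a common piece with a given point over `x`. -/
theorem isCoveringMap [Finite T] : IsCoveringMap P.proj := by
  intro x
  let I : Type _ := {q : Quotient P.rel // P.proj q = x}
  have hfin : Finite I := P.finite_fiber x
  let _ : TopologicalSpace I := ⊥
  have : DiscreteTopology I := ⟨rfl⟩
  -- a neighbourhood `U` on which only the pieces and overlaps through `x` are seen
  have hev : ∀ᶠ y in 𝓝 x, (∀ t t', (∃ q, P.Mem q t ∧ P.Mem q t' ∧ P.proj q = y) →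
        ∃ q, P.Mem q t ∧ P.Mem q t' ∧ P.proj q = x) ∧
      (∀ t t' q, P.Mem q t → P.Mem q t' → P.proj q = x → (∃ q, P.Mem q t ∧ P.proj q = y) →
        (∃ q, P.Mem q t' ∧ P.proj q = y) → ∃ q, P.Mem q t ∧ P.Mem q t' ∧ P.proj q = y) ∧
      ∀ q : I, ∃ t q', P.Mem q.1 t ∧ P.Mem q' t ∧ P.proj q' = y := by
    refine Filter.Eventually.and ?_ (Filter.Eventually.and ?_ ?_)
    · rw [Filter.eventually_all]; intro t
      rw [Filter.eventually_all]; intro t'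
      have hc := P.isClosed_overlap t t'
      simp only [P.overlap_iff] at hc
      by_cases h : ∃ q, P.Mem q t ∧ P.Mem q t' ∧ P.proj q = x
      · exact Filter.Eventually.of_forall fun _ _ => h
      · filter_upwards [hc.isOpen_compl.mem_nhds h] with y hy hy'
        exact absurd hy' hy
    · rw [Filter.eventually_all]; intro t
      rw [Filter.eventually_all]; intro t'
      have hc := P.isClosed_nonoverlap t t'
      simp only [P.overlap_iff, P.piece_iff] at hc
      by_cases h : ∃ q, P.Mem q t ∧ P.Mem q t' ∧ P.proj q = x
      · have hx : x ∉ ({x | ∃ q, P.Mem q t ∧ P.proj q = x} ∩ {x | ∃ q, P.Mem q t' ∧ P.proj q = x}) \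
            {x | ∃ q, P.Mem q t ∧ P.Mem q t' ∧ P.proj q = x} := fun h' => h'.2 h
        filter_upwards [hc.isOpen_compl.mem_nhds hx] with y hy q _ _ _ h1 h2
        by_contra h3
        exact hy ⟨⟨h1, h2⟩, h3⟩
      · exact Filter.Eventually.of_forall fun _ q h1 h2 h3 => absurd ⟨q, h1, h2, h3⟩ h
    · rw [Filter.eventually_all]
      rintro ⟨q, hq⟩
      obtain ⟨e, rfl⟩ := P.surjective_cls q
      have := P.eventually_mem e
      rw [show P.p e = x from hq] at this
      filter_upwards [this] with y ⟨e', e'', hr, hτ, hy⟩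
      exact ⟨P.τ e', P.cls e'', ⟨e', (P.cls_eq_cls.2 hr).symm, rfl⟩, ⟨e'', rfl, hτ⟩, hy⟩
  obtain ⟨U, hU, hUo, hxU⟩ := eventually_nhds_iff.1 hev
  have hle : ∀ (q : I) (q' : P.Total) (t : T), P.proj q' ∈ U → P.Mem q.1 t → P.Mem q' t →
      ∀ t', P.Mem q' t' → P.Mem q.1 t' := by
    intro q q' t hq' h1 h2 t' h3
    obtain ⟨q₁, h4, h5, h6⟩ := (hU _ hq').1 t t' ⟨q', h2, h3, rfl⟩
    rwa [P.eq_of_mem (q := q.1) h1 h4 (q.2.trans h6.symm)]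
  have hdown : ∀ q' : P.Total, P.proj q' ∈ U → ∃ q : I, ∃ t, P.Mem q.1 t ∧ P.Mem q' t := by
    intro q' hq'
    obtain ⟨t, ht⟩ := P.exists_mem q'
    obtain ⟨q, h1, -, h2⟩ := (hU _ hq').1 t t ⟨q', ht, ht, rfl⟩
    exact ⟨⟨q, h2⟩, t, h1, ht⟩
  have hdown_unique : ∀ q' : P.Total, P.proj q' ∈ U → ∀ q₁ q₂ : I, ∀ t₁ t₂, P.Mem q₁.1 t₁ →
      P.Mem q' t₁ → P.Mem q₂.1 t₂ → P.Mem q' t₂ → q₁ = q₂ := by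
    intro q' hq' q₁ q₂ t₁ t₂ h1 h2 h3 h4
    exact Subtype.ext (P.eq_of_mem (hle q₁ q' t₁ hq' h1 h2 t₂ h4) h3 (q₁.2.trans q₂.2.symm))
  have hup : ∀ (y : U) (q : I), ∃ q' : P.Total, P.proj q' = y ∧ ∃ t, P.Mem q.1 t ∧ P.Mem q' t := by
    intro y q
    obtain ⟨t, q', h1, h2, h3⟩ := (hU y y.2).2.2 q
    exact ⟨q', h3, t, h1, h2⟩
  have hup_unique : ∀ (y : U) (q : I) (q₁ q₂ : P.Total) (t₁ t₂ : T), P.proj q₁ = y → P.proj q₂ = y →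
      P.Mem q.1 t₁ → P.Mem q₁ t₁ → P.Mem q.1 t₂ → P.Mem q₂ t₂ → q₁ = q₂ := by
    intro y q q₁ q₂ t₁ t₂ hq₁ hq₂ h1 h2 h3 h4
    obtain ⟨q₃, h5, h6, h7⟩ := (hU y y.2).2.1 t₁ t₂ q.1 h1 h3 q.2 ⟨q₁, h2, hq₁⟩ ⟨q₂, h4, hq₂⟩
    rw [P.eq_of_mem h2 h5 (hq₁.trans h7.symm), P.eq_of_mem h4 h6 (hq₂.trans h7.symm)]
  choose dn dnt hdn1 hdn2 using hdown
  choose up hup1 upt hup2 hup3 using hup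
  have hmem : ∀ y q t, P.Mem (up y q) t ↔ P.Mem q.1 t ∧ ∃ q', P.Mem q' t ∧ P.proj q' = y := by
    intro y q t
    constructor
    · intro h
      exact ⟨hle q _ (upt y q) (by rw [hup1]; exact y.2) (hup2 y q) (hup3 y q) t h, _, h, hup1 y q⟩
    · rintro ⟨h1, q', h2, h3⟩
      rwa [hup_unique y q _ q' (upt y q) t (hup1 y q) h3 (hup2 y q) (hup3 y q) h1 h2]
  refine IsEvenlyCovered.to_isEvenlyCovered_preimage (I := I) ⟨‹_›, U, hxU, hUo,
    P.continuous_proj.isOpen_preimage U hUo, ?_⟩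
  refine ⟨⟨⟨fun q' => (⟨P.proj q'.1, q'.2⟩, dn q'.1 q'.2),
    fun yq => ⟨up yq.1 yq.2, by rw [mem_preimage, hup1]; exact yq.1.2⟩, ?_, ?_⟩, ?_, ?_⟩, ?_⟩
  · rintro ⟨q', hq'⟩
    refine Subtype.ext ?_
    exact hup_unique ⟨P.proj q', hq'⟩ (dn q' hq') _ q' _ _ (hup1 _ _) rfl (hup2 _ _) (hup3 _ _)
      (hdn1 q' hq') (hdn2 q' hq')
  · rintro ⟨y, q⟩
    have hy : P.proj (up y q) ∈ U := by rw [hup1]; exact y.2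
    refine Prod.ext (Subtype.ext (hup1 y q)) ?_
    exact hdown_unique (up y q) hy _ _ _ _ (hdn1 _ hy) (hdn2 _ hy) (hup2 y q) (hup3 y q)
  · refine Continuous.prodMk ((P.continuous_proj.comp continuous_subtype_val).subtype_mk _) ?_
    rw [continuous_iff_continuousAt]
    rintro ⟨q', hq'⟩
    refine (continuousAt_const (y := dn q' hq')).congr ?_
    have h1 := (continuous_subtype_val.continuousAt (x := (⟨q', hq'⟩ : P.proj ⁻¹' U))).eventually
      (P.mem_nhds q')
    filter_upwards [h1] with q'' hq''
    refine hdown_unique q''.1 q''.2 _ _ (dnt q''.1 q''.2) (dnt q''.1 q''.2) ?_ (hdn2 _ _)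
      (hdn1 _ _) (hdn2 _ _)
    exact hle (dn q' hq') q' _ hq' (hdn1 _ _) (hdn2 _ _) _ (hq'' _ (hdn2 q''.1 q''.2))
  · refine Continuous.subtype_mk ?_ _
    rw [P.continuous_iff]
    refine ⟨?_, fun t => ?_⟩
    · have : P.proj ∘ (fun yq : U × I => up yq.1 yq.2) = fun yq => (yq.1 : S) :=
        funext fun yq => hup1 _ _
      rw [this]; fun_prop
    · simp only [hmem]
      have hc := P.isClosed_piece t
      simp only [P.piece_iff] at hc
      have h1 : IsClosed {q : I | P.Mem q.1 t} := isClosed_discrete _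
      exact (h1.preimage continuous_snd).inter
        (hc.preimage (continuous_subtype_val.comp continuous_fst))
  · rintro ⟨q', hq'⟩; rfl

end Patching

end Patching

/-! ### Compact coverings of circles -/

section Circles
open Real

theorem IsCoveringMap.exists_circle {E S : Type*} [TopologicalSpace E] [TopologicalSpace S]
    [CompactSpace E] [T2Space S] {p : E → S} (hp : IsCoveringMap p) (e₀ : E) {θ : Circle → S}
    (hθ : Topology.IsOpenEmbedding θ) (h₀ : p e₀ ∈ range θ) :
    ∃ γ : Circle → E, Topology.IsOpenEmbedding γ ∧ e₀ ∈ range γ := by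
  classical
  obtain ⟨w₀, hw₀⟩ := h₀
  -- lift the universal covering of the circle
  obtain ⟨F, ⟨hF0, hF⟩, -⟩ := hp.existsUnique_continuousMap_lifts
    (⟨fun t => θ (w₀ * Circle.exp t), hθ.continuous.comp (by fun_prop)⟩ : C(ℝ, S)) 0 e₀
    (by simp [hw₀])
  have hpF : ∀ t, p (F t) = θ (w₀ * Circle.exp t) := fun t => congrFun hF t
  have hexp : ∀ s t, F s = F t → Circle.exp s = Circle.exp t := by
    intro s t h
    have := congrArg p h
    rw [hpF, hpF] at this
    exact mul_left_cancel (hθ.injective this)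
  have hper : ∀ s t, F s = F t → Function.Periodic F (t - s) := by
    intro s t h u
    have h1 : (fun u => F (s + u)) = fun u => F (t + u) := by
      refine hp.eq_of_comp_eq (by fun_prop) (by fun_prop) (funext fun u => ?_) 0 (by simpa using h)
      simp only [Function.comp_apply, hpF, Circle.exp_add, hexp s t h]
    have := congrFun h1 (u - s)
    simp only [add_sub_cancel] at this
    rw [this]
    congr 1; ring
  obtain ⟨N, hN0, hN⟩ : ∃ N : ℕ, 0 < N ∧ Function.Periodic F (N * (2 * π)) := by
    have hfin : Finite (p ⁻¹' {θ w₀}) := by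
      have hd : DiscreteTopology (p ⁻¹' {θ w₀}) := (hp (θ w₀)).discreteTopology_fiber
      have hc : CompactSpace (p ⁻¹' {θ w₀}) :=
        isCompact_iff_compactSpace.1 (isClosed_singleton.preimage hp.continuous).isCompact
      exact finite_of_compact_of_discrete
    obtain ⟨k, l, hkl, h⟩ := Finite.exists_ne_map_eq_of_infinite (fun k : ℕ =>
      (⟨F (k * (2 * π)), by
        rw [mem_preimage, hpF, mem_singleton_iff]
        have := Circle.exp_int_mul_two_pi k
        rw [Int.cast_natCast] at this
        rw [this, mul_one]⟩ : p ⁻¹' {θ w₀}))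
    have h' : F (k * (2 * π)) = F (l * (2 * π)) := congrArg Subtype.val h
    rcases lt_or_gt_of_ne hkl with h1 | h1
    · refine ⟨l - k, by omega, ?_⟩
      have := hper _ _ h'
      rwa [← sub_mul, ← Nat.cast_sub h1.le] at this
    · refine ⟨k - l, by omega, ?_⟩
      have := hper _ _ h'.symm
      rwa [← sub_mul, ← Nat.cast_sub h1.le] at this
  have hex : ∃ N : ℕ, 0 < N ∧ Function.Periodic F (N * (2 * π)) := ⟨N, hN0, hN⟩
  -- the least period
  set M := Nat.find hex
  obtain ⟨hM0, hM⟩ := Nat.find_spec hex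
  have hT : (M : ℝ) * (2 * π) ≠ 0 := by
    have : (0 : ℝ) < M := by exact_mod_cast hM0
    positivity
  let G : AddCircle ((M : ℝ) * (2 * π)) → E := hM.lift
  have hG : ∀ t : ℝ, G t = F t := fun t => hM.lift_coe t
  have hGi : Function.Injective G := by
    intro x y
    induction x using QuotientAddGroup.induction_on with | _ s =>
    induction y using QuotientAddGroup.induction_on with | _ t =>
    intro h
    have h1 : F s = F t := by rw [← hG, ← hG]; exact h
    obtain ⟨m, hm⟩ := Circle.exp_eq_exp.1 (hexp s t h1)
    have h2 : Function.Periodic F (m * (2 * π)) := by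
      have := hper t s h1.symm
      rwa [hm, add_sub_cancel_left] at this
    have h3 : Function.Periodic F ((m % M : ℤ) * (2 * π)) := by
      have h4 := h2.sub_period (hM.int_mul (m / M))
      have h5 : ((m % M : ℤ) : ℝ) = m - (m / M : ℤ) * M := by
        rw [Int.emod_def]; push_cast; ring
      rw [h5, sub_mul, mul_assoc]
      exact h4
    have hMne : (M : ℤ) ≠ 0 := by exact_mod_cast hM0.ne'
    have h6 : m % M = 0 := by
      have hnn := Int.emod_nonneg m hMne
      have hlt := Int.emod_lt_of_pos m (show (0 : ℤ) < M by exact_mod_cast hM0)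
      by_contra hne
      refine Nat.find_min hex (m := (m % M).toNat) (by change _ < M; omega) ⟨by omega, ?_⟩
      have h7 : (((m % M).toNat : ℕ) : ℝ) = ((m % M : ℤ) : ℝ) := by
        rw [← Int.cast_natCast, Int.toNat_of_nonneg hnn]
      rw [h7]; exact h3
    obtain ⟨j, hj⟩ := Int.dvd_of_emod_eq_zero h6
    change (s : AddCircle ((M : ℝ) * (2 * π))) = t
    rw [hm, hj, QuotientAddGroup.mk_add]
    have : (((((M : ℤ) * j : ℤ) : ℝ) * (2 * π) : ℝ) : AddCircle ((M : ℝ) * (2 * π))) = 0 := by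
      rw [AddCircle.coe_eq_zero_iff]
      refine ⟨j, ?_⟩
      push_cast; rw [zsmul_eq_mul]; ring
    exact (congrArg _ this).trans (add_zero _)
  have hGF : G ∘ (fun t : ℝ => (t : AddCircle ((M : ℝ) * (2 * π)))) = F := funext hG
  have hGc : Continuous G := by
    refine (isQuotientMap_quotient_mk' (X := ℝ)).continuous_iff.2 ?_
    exact hGF.symm ▸ F.continuous
  have hFo : IsOpenMap F := by
    have h1 : IsLocalHomeomorph (p ∘ F) := by
      have h2 : (p ∘ F) = θ ∘ (fun w => w₀ * w) ∘ AddCircle.homeomorphCircle' ∘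
          (fun t : ℝ => (t : AddCircle (2 * π))) := by
        funext t
        simp only [Function.comp_apply, hpF, AddCircle.homeomorphCircle'_apply_mk]
      rw [h2]
      have : Fact (0 < 2 * π) := ⟨by positivity⟩
      exact hθ.isLocalHomeomorph.comp ((Homeomorph.mulLeft w₀).isLocalHomeomorph.comp
        (AddCircle.homeomorphCircle'.isLocalHomeomorph.comp (AddCircle.isLocalHomeomorph_coe _)))
    exact (IsLocalHomeomorph.of_comp h1 hp.isLocalHomeomorph F.continuous).isOpenMap
  have hGo : IsOpenMap G := by
    intro V hV
    have h1 : G '' V = F '' ((fun t : ℝ => (t : AddCircle ((M : ℝ) * (2 * π)))) ⁻¹' V) := by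
      rw [← hGF, image_comp, image_preimage_eq _ QuotientAddGroup.mk_surjective]
    rw [h1]
    exact hFo _ (hV.preimage continuous_quotient_mk')
  have hGe : Topology.IsOpenEmbedding G := .of_continuous_injective_isOpenMap hGc hGi hGo
  refine ⟨G ∘ (AddCircle.homeomorphCircle hT).symm,
    hGe.comp (AddCircle.homeomorphCircle hT).symm.isOpenEmbedding, ?_⟩
  rw [EquivLike.range_comp]
  exact ⟨((0 : ℝ) : AddCircle _), (hG 0).trans hF0⟩

/-- A compact covering space of a disjoint union of circles is a finite disjoint union of
circles. -/
theorem IsCoveringMap.exists_homeomorph_circles {E S : Type*} [TopologicalSpace E]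
    [TopologicalSpace S] [CompactSpace E] [T2Space E] [T2Space S] {p : E → S} (hp : IsCoveringMap p)
    (hS : ∀ e, ∃ θ : Circle → S, Topology.IsOpenEmbedding θ ∧ p e ∈ range θ) :
    ∃ k : ℕ, Nonempty (E ≃ₜ Fin k × Circle) := by
  have h1 : ∀ e, ∃ γ : Circle → E, Topology.IsOpenEmbedding γ ∧ range γ = connectedComponent e := by
    intro e
    obtain ⟨θ, hθ, he⟩ := hS e
    obtain ⟨γ, hγ, heγ⟩ := hp.exists_circle e hθ he
    have hcirc : PreconnectedSpace Circle :=
      AddCircle.homeomorphCircle'.surjective.denseRange.preconnectedSpace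
        AddCircle.homeomorphCircle'.continuous
    have hcl : IsClopen (range γ) := ⟨(isCompact_range hγ.continuous).isClosed, hγ.isOpen_range⟩
    exact ⟨γ, hγ, Subset.antisymm
      ((isPreconnected_range hγ.continuous).subset_connectedComponent heγ)
      (hcl.connectedComponent_subset heγ)⟩
  choose γ hγ hγr using h1
  have hopen : ∀ e : E, IsOpen (connectedComponent e) := fun e => hγr e ▸ (hγ e).isOpen_range
  have hdisc : DiscreteTopology (ConnectedComponents E) := by
    refine discreteTopology_iff_isOpen_singleton.2 fun c => ?_
    obtain ⟨e, rfl⟩ := ConnectedComponents.surjective_coe c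
    refine ConnectedComponents.isQuotientMap_coe.isOpen_preimage.1 ?_
    rw [connectedComponents_preimage_singleton]
    exact hopen e
  have hfin : Finite (ConnectedComponents E) := finite_of_compact_of_discrete
  let out : ConnectedComponents E → E := Function.surjInv ConnectedComponents.surjective_coe
  have hout : ∀ c, (out c : ConnectedComponents E) = c :=
    Function.surjInv_eq ConnectedComponents.surjective_coe
  let Φ : ConnectedComponents E × Circle → E := fun q => γ (out q.1) q.2
  have hΦ : ∀ q, (Φ q : ConnectedComponents E) = q.1 := by
    intro q
    have h2 : Φ q ∈ connectedComponent (out q.1) := by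
      rw [← hγr]
      exact ⟨_, rfl⟩
    rw [ConnectedComponents.coe_eq_coe'.2 h2, hout]
  have hΦb : Function.Bijective Φ := by
    constructor
    · rintro ⟨c, z⟩ ⟨c', z'⟩ h
      have hc : c = c' := by
        have := congrArg (fun e : E => (e : ConnectedComponents E)) h
        simpa only [hΦ] using this
      subst hc
      exact Prod.ext rfl ((hγ _).injective h)
    · intro e
      have : e ∈ range (γ (out e)) := by
        rw [hγr, ← ConnectedComponents.coe_eq_coe', hout]
      obtain ⟨z, hz⟩ := this
      exact ⟨(e, z), hz⟩
  have hΦc : Continuous Φ :=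
    continuous_prod_of_discrete_left.2 fun c => (hγ (out c)).continuous
  let e₁ : ConnectedComponents E × Circle ≃ₜ E :=
    hΦc.homeoOfEquivCompactToT2 (f := Equiv.ofBijective Φ hΦb)
  let e₂ : ConnectedComponents E ≃ₜ Fin (Nat.card (ConnectedComponents E)) :=
    (Finite.equivFin _).toHomeomorphOfDiscrete
  exact ⟨_, ⟨e₁.symm.trans (e₂.prodCongr (Homeomorph.refl _))⟩⟩

end Circles

/-! ### Connected components, and covers of disjoint unions of discs -/

section Components

variable {X Y : Type*} [TopologicalSpace X] [TopologicalSpace Y]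

theorem Continuous.connectedComponent_eq {f : X → Y} (hf : Continuous f) {x x' : X}
    (h : connectedComponent x = connectedComponent x') :
    connectedComponent (f x) = connectedComponent (f x') := by
  refine _root_.connectedComponent_eq ?_
  exact hf.mapsTo_connectedComponent x (by rw [h]; exact mem_connectedComponent)

theorem IsPreconnected.connectedComponent_eq {s : Set X} (hs : IsPreconnected s) {x x' : X}
    (hx : x ∈ s) (hx' : x' ∈ s) : connectedComponent x = connectedComponent x' :=
  _root_.connectedComponent_eq (hs.subset_connectedComponent hx hx')

theorem isOpen_setOf_connectedComponent_eq [LocallyConnectedSpace X] (x : X) :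
    IsOpen {y : X | connectedComponent y = connectedComponent x} := by
  convert isOpen_connectedComponent (x := x) using 1
  ext y
  exact ⟨fun h => h ▸ mem_connectedComponent, fun h => (_root_.connectedComponent_eq h).symm⟩

/-- A union of connected components of a locally connected space is clopen. -/
theorem isClopen_of_connectedComponent_eq [LocallyConnectedSpace X] {A : Set X}
    (hA : ∀ x x', connectedComponent x = connectedComponent x' → x ∈ A → x' ∈ A) : IsClopen A := by
  have h : ∀ A : Set X, (∀ x x', connectedComponent x = connectedComponent x' → x ∈ A → x' ∈ A) →
      IsOpen A := fun A hA => isOpen_iff_mem_nhds.2 fun x hx =>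
    Filter.mem_of_superset ((isOpen_setOf_connectedComponent_eq x).mem_nhds rfl)
      fun y hy => hA x y (Eq.symm hy) hx
  exact ⟨isOpen_compl_iff.1 (h _ fun x x' hxx hx hx' => hx (hA x' x hxx.symm hx')), h A hA⟩

/-- The edge points of a component which is a disc form a sphere. -/
theorem exists_isEmbedding_sphere [T2Space X] [RegularSpace X] [LocallyConnectedSpace X] {d : ℕ}
    (x : X) (h : connectedComponent x ≃ₜ Metric.closedBall (0 : EuclideanSpace ℝ (Fin d)) 1) :
    ∃ θ : Metric.sphere (0 : EuclideanSpace ℝ (Fin d)) 1 → X, Topology.IsEmbedding θ ∧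
      range θ = connectedComponent x ∩ {y | IsEdgePoint y} := by
  let ι : Metric.closedBall (0 : EuclideanSpace ℝ (Fin d)) 1 → X := fun q => (h.symm q : X)
  have hι : Topology.IsOpenEmbedding ι :=
    (isOpen_connectedComponent.isOpenEmbedding_subtypeVal).comp h.symm.isOpenEmbedding
  have hιr : range ι = connectedComponent x := by
    change range (Subtype.val ∘ h.symm) = _
    rw [EquivLike.range_comp, Subtype.range_coe]
  have hedge : ∀ q, IsEdgePoint (ι q) ↔ ‖(q : EuclideanSpace ℝ (Fin d))‖ = 1 := fun q => by
    rw [hι.isLocalHomeomorph.isEdgePoint_iff, isEdgePoint_closedBall_iff]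
  refine ⟨fun q => ι ⟨q, Metric.sphere_subset_closedBall q.2⟩, hι.isEmbedding.comp
    (Topology.IsEmbedding.inclusion Metric.sphere_subset_closedBall), ?_⟩
  ext y
  constructor
  · rintro ⟨q, rfl⟩
    exact ⟨hιr ▸ mem_range_self _, (hedge _).2 (by simp)⟩
  · rintro ⟨h1, h2⟩
    rw [← hιr] at h1
    obtain ⟨q, rfl⟩ := h1
    exact ⟨⟨q, by simp [(hedge q).1 h2]⟩, rfl⟩

/-- The map `p` sends each component of `Y` homeomorphically onto a component of `X`: it has a
continuous inverse there. -/
def HasComponentSections (p : Y → X) : Prop :=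
  ∀ y, ∃ s : connectedComponent (p y) → Y, Continuous s ∧ (∀ x, p (s x) = x) ∧
    range s = connectedComponent y

/-- A compact space that is locally homeomorphic to a disjoint union of discs is a finite covering
space of it; coverings of discs are trivial. -/
theorem IsLocalHomeomorph.hasComponentSections_of_disc [CompactSpace Y] [T2Space Y] [T2Space X]
    {p : Y → X} (hp : IsLocalHomeomorph p) {d : ℕ} (h : ∀ x : X, Nonempty (connectedComponent x ≃ₜ
      Metric.closedBall (0 : EuclideanSpace ℝ (Fin d)) 1)) : HasComponentSections p :=
  fun y => (isLocalHomeomorph_iff_isCoveringMap.1 hp).exists_section_of_disc y (h _).some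

namespace HasComponentSections

variable {p : Y → X}

theorem injective (hp : HasComponentSections p) {y y' : Y}
    (h : connectedComponent y = connectedComponent y')
    (h' : p y = p y') : y = y' := by
  obtain ⟨s, -, hs, hr⟩ := hp y
  obtain ⟨x, hx⟩ : y ∈ range s := hr ▸ mem_connectedComponent
  obtain ⟨x', hx'⟩ : y' ∈ range s := by rw [hr, h]; exact mem_connectedComponent
  have hxx : x = x' := Subtype.ext (by rw [← hs x, ← hs x', hx, hx', h'])
  rw [← hx, ← hx', hxx]

theorem exists_eq (hp : HasComponentSections p) {y : Y} {x : X}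
    (h : connectedComponent x = connectedComponent (p y)) :
    ∃ y', connectedComponent y' = connectedComponent y ∧ p y' = x := by
  obtain ⟨s, -, hs, hr⟩ := hp y
  refine ⟨s ⟨x, h ▸ mem_connectedComponent⟩, ?_, hs _⟩
  exact (_root_.connectedComponent_eq (hr ▸ mem_range_self _)).symm

end HasComponentSections

/-- A covering of a connected space which is trivial has only one sheet if the total space is
connected. -/
theorem FlowCat.IsTrivialCovering.injective {E B : Type v} [TopologicalSpace E] [TopologicalSpace B]
    [PreconnectedSpace E] {p : E → B} (h : IsTrivialCovering p) : Function.Injective p := by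
  obtain ⟨F, _, hF, e, he⟩ := h
  have hc : ∀ x y : E, (e x).2 = (e y).2 := fun x y =>
    PreconnectedSpace.constant ‹_› (f := fun x => (e x).2) (continuous_snd.comp e.continuous)
  intro x y hxy
  refine e.injective (Prod.ext ?_ (hc x y))
  rw [he, he, hxy]

end Components

/-! ### Gradings and faces of categories -/

namespace FlowCat

section FaceCategories

variable {C : Type u} [Category.{v} C]

/-- The combinatorial part of the axioms of a flow category: a grading and subsets `∂ᵢ` of the
morphism sets that are compatible with compositions. -/
structure IsFaceCategory (gr : C → ℤ) (face : ∀ x y : C, ℕ → Set (x ⟶ y)) : Prop where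
  eq_id : ∀ (x : C) (f : x ⟶ x), f = 𝟙 x
  gr_lt : ∀ {x y : C}, (x ⟶ y) → x ≠ y → gr y < gr x
  comp_mem : ∀ {x z y : C} (u : x ⟶ z) (v : z ⟶ y) (m : ℕ), 1 ≤ m → gr z = gr y + m →
    gr z < gr x → u ≫ v ∈ face x y m
  comp_lt : ∀ {x z y : C} (u : x ⟶ z) (v : z ⟶ y) (m : ℕ), 1 ≤ m → gr z = gr y + m →
    gr z < gr x → ∀ i < m, (u ≫ v ∈ face x y i ↔ v ∈ face z y i)
  comp_gt : ∀ {x z y : C} (u : x ⟶ z) (v : z ⟶ y) (m : ℕ), 1 ≤ m → gr z = gr y + m →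
    gr z < gr x → ∀ i > m, (u ≫ v ∈ face x y i ↔ u ∈ face x z (i - m))

/-- The morphisms from `x` to `y` in `∂ᵢ` factor uniquely through an object of grading
`|y| + i`. -/
def UniqueFactorization (gr : C → ℤ) (face : ∀ x y : C, ℕ → Set (x ⟶ y)) (x y : C) : Prop :=
  ∀ (f : x ⟶ y) (i : ℕ), 1 ≤ i → gr y + i < gr x → f ∈ face x y i →
    ∃! t : Σ z : C, (x ⟶ z) × (z ⟶ y), gr t.1 = gr y + i ∧ t.2.1 ≫ t.2.2 = f

variable {gr : C → ℤ} {face : ∀ x y : C, ℕ → Set (x ⟶ y)}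

theorem UniqueFactorization.exists_comp {x y : C} (h : UniqueFactorization gr face x y) {f : x ⟶ y}
    {i : ℕ} (hi : 1 ≤ i) (hi' : gr y + i < gr x) (hf : f ∈ face x y i) :
    ∃ (z : C) (u : x ⟶ z) (v : z ⟶ y), gr z = gr y + i ∧ u ≫ v = f :=
  let ⟨⟨z, u, v⟩, ⟨h1, h2⟩, _⟩ := h f i hi hi' hf
  ⟨z, u, v, h1, h2⟩

namespace IsFaceCategory

theorem gr_le (h : IsFaceCategory gr face) {x y : C} (f : x ⟶ y) : gr y ≤ gr x := by
  by_cases hxy : x = y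
  · rw [hxy]
  · exact (h.gr_lt f hxy).le

theorem eq_of_gr_le (h : IsFaceCategory gr face) {x y : C} (f : x ⟶ y) (hxy : gr x ≤ gr y) :
    x = y := by
  by_contra hne
  exact absurd (h.gr_lt f hne) (not_lt.2 hxy)

theorem sigma_eq (h : IsFaceCategory gr face) {x y : C} (hUF : UniqueFactorization gr face x y)
    {z z' : C} {u : x ⟶ z} {v : z ⟶ y} {u' : x ⟶ z'} {v' : z' ⟶ y} (hc : u ≫ v = u' ≫ v')
    (hz : gr z = gr z') (hy : gr y < gr z) (hx : gr z < gr x) :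
    (⟨z, u, v⟩ : Σ z : C, (x ⟶ z) × (z ⟶ y)) = ⟨z', u', v'⟩ := by
  obtain ⟨m, hm⟩ := Int.le.dest hy.le
  refine (hUF (u ≫ v) m (by omega) (by omega) (h.comp_mem u v m (by omega) hm.symm hx)).unique
    ⟨hm.symm, rfl⟩ ⟨hz ▸ hm.symm, hc.symm⟩

/-- Two factorizations of a morphism have a common refinement. -/
theorem exists_lift (h : IsFaceCategory gr face) {x y z z' : C}
    (hUF : UniqueFactorization gr face x y) (hUF' : UniqueFactorization gr face x z')
    {u : x ⟶ z} {v : z ⟶ y} {u' : x ⟶ z'} {v' : z' ⟶ y} (hc : u ≫ v = u' ≫ v')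
    (hz : gr z' ≤ gr z) : ∃ l : z ⟶ z', u ≫ l = u' ∧ l ≫ v' = v := by
  by_cases hxz : x = z
  · subst hxz
    refine ⟨u', ?_, ?_⟩
    · rw [h.eq_id x u, Category.id_comp]
    · rw [← hc, h.eq_id x u, Category.id_comp]
  by_cases hzy : z' = y
  · subst hzy
    refine ⟨v, ?_, ?_⟩
    · rw [hc, h.eq_id _ v', Category.comp_id]
    · rw [h.eq_id _ v', Category.comp_id]
  have h1 := h.gr_lt u hxz
  have h2 := h.gr_lt v' hzy
  rcases hz.eq_or_lt with h3 | h3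
  · have := h.sigma_eq hUF hc h3.symm (by omega) h1
    obtain ⟨rfl, h4⟩ := Sigma.mk.inj this
    obtain ⟨rfl, rfl⟩ := Prod.mk.inj (eq_of_heq h4)
    exact ⟨𝟙 _, by simp, by simp⟩
  · obtain ⟨m, hm⟩ := Int.le.dest h2.le
    obtain ⟨k, hk⟩ := Int.le.dest h3.le
    have h4 : u' ≫ v' ∈ face x y (m + k) :=
      hc ▸ h.comp_mem u v (m + k) (by omega) (by omega) h1
    rw [h.comp_gt u' v' m (by omega) hm.symm (by omega) _ (by omega), Nat.add_sub_cancel_left] at h4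
    obtain ⟨w, a, b, hw, hab⟩ := hUF'.exists_comp (by omega) (by omega) h4
    have h5 : u ≫ v = a ≫ b ≫ v' := by rw [hc, ← hab, Category.assoc]
    have := h.sigma_eq hUF h5 (by omega) (by omega) h1
    obtain ⟨rfl, h6⟩ := Sigma.mk.inj this
    obtain ⟨rfl, rfl⟩ := Prod.mk.inj (eq_of_heq h6)
    exact ⟨b, hab, rfl⟩

/-- The faces of a category can be pulled back along a grading-preserving functor. -/
theorem comap (h : IsFaceCategory gr face) {A : Type u₂} [Category.{v₂} A] {grA : A → ℤ} (H : A ⥤ C)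
    (hgr : ∀ x, gr (H.obj x) = grA x) (h1 : ∀ (x : A) (f : x ⟶ x), f = 𝟙 x)
    (h2 : ∀ {x y : A}, (x ⟶ y) → x ≠ y → grA y < grA x) :
    IsFaceCategory grA fun x y i => {f | H.map f ∈ face (H.obj x) (H.obj y) i} where
  eq_id := h1
  gr_lt := h2
  comp_mem u v m hm hz hx := by
    rw [mem_ofPred_eq, H.map_comp]
    exact h.comp_mem _ _ m hm (by rwa [hgr, hgr]) (by rwa [hgr, hgr])
  comp_lt u v m hm hz hx i hi := by
    rw [mem_ofPred_eq, H.map_comp]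
    exact h.comp_lt _ _ m hm (by rwa [hgr, hgr]) (by rwa [hgr, hgr]) i hi
  comp_gt u v m hm hz hx i hi := by
    rw [mem_ofPred_eq, H.map_comp]
    exact h.comp_gt _ _ m hm (by rwa [hgr, hgr]) (by rwa [hgr, hgr]) i hi

end IsFaceCategory

end FaceCategories

/-! ### Moduli spaces of flow categories -/

section FlowCategories

variable {C : Type u} [Category.{v} C] {gr : C → ℤ}

instance (F : FlowStructure C gr) (x y : C) : T2Space (F.Mod x y) := F.t2 x y

instance (F : FlowStructure C gr) (x y : C) : CompactSpace (F.Mod x y) := F.compact x y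

instance (F : ModuliData C gr) (x y : C) : LocallyConnectedSpace (F.Mod x y) :=
  have := ChartedSpace.locallyPathConnectedSpace (EuclideanQuadrant (mdim gr x y)) (F.Mod x y)
  inferInstance

/-- The connected component of a morphism in its moduli space. -/
def ModuliData.component (F : ModuliData C gr) {x y : C} (f : x ⟶ y) : Set (x ⟶ y) :=
  connectedComponent (α := F.Mod x y) f

theorem ModuliData.mem_component (F : ModuliData C gr) {x y : C} (f : x ⟶ y) : f ∈ F.component f :=
  mem_connectedComponent (α := F.Mod x y)

theorem ModuliData.component_eq_iff (F : ModuliData C gr) {x y : C} {f g : x ⟶ y} :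
    F.component g = F.component f ↔ g ∈ F.component f :=
  connectedComponent_eq_iff_mem (α := F.Mod x y)

/-- A morphism is an edge if it is an edge point of its moduli space, i.e. it lies on the
boundary. -/
def ModuliData.IsEdge (F : ModuliData C gr) {x y : C} (f : x ⟶ y) : Prop :=
  IsEdgePoint (X := F.Mod x y) f

namespace FlowStructure

variable (F : FlowStructure C gr)

theorem face_eq_empty {x y : C} {i : ℕ} (h : ¬ (1 ≤ i ∧ gr y + i < gr x)) : F.face x y i = ∅ :=
  (F.faceStructure x y).outside i (by unfold mdim; omega)

theorem mem_face_iff {x y : C} {i : ℕ} (h1 : 1 ≤ i) (h2 : gr y + i < gr x) (f : x ⟶ y) :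
    f ∈ F.face x y i ↔ ∃ (z : C) (u : x ⟶ z) (v : z ⟶ y), gr z = gr y + i ∧ u ≫ v = f := by
  have h := Set.ext_iff.1 (F.face_eq x y i (by rintro rfl; omega) h1 (by unfold mdim; omega)) f
  refine h.trans ⟨fun hf => ?_, fun ⟨z, u, v, hz, h⟩ => mem_iUnion₂.2 ⟨z, hz, (v, u), h⟩⟩
  obtain ⟨z, hz, ⟨v, u⟩, h⟩ := mem_iUnion₂.1 hf
  exact ⟨z, u, v, hz, h⟩

theorem isFaceCategory : IsFaceCategory gr F.face where
  eq_id := F.hom_self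
  gr_lt {x y} f hxy := by
    by_contra h
    exact (F.hom_empty x y hxy (not_lt.1 h)).false f
  comp_mem {x z y} u v m h1 h2 h3 := F.comp_mem x z y m h1 h2 h3 ⟨(v, u), rfl⟩
  comp_lt {x z y} u v m h1 h2 h3 i hi :=
    Set.ext_iff.1 (F.comp_face_lt x z y m h1 h2 h3 i hi) (v, u)
  comp_gt {x z y} u v m h1 h2 h3 i hi :=
    Set.ext_iff.1 (F.comp_face_gt x z y m h1 h2 h3 i hi) (v, u)

theorem injective_comp {x z y : C} (h1 : gr y < gr z) (h2 : gr z < gr x) :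
    Function.Injective (F.comp x z y) := (F.comp_embedding x z y h1 h2).isEmbedding.injective

theorem uniqueFactorization (x y : C) : UniqueFactorization gr F.face x y := by
  intro f i h1 h2 hf
  obtain ⟨z, u, v, hz, hc⟩ := (F.mem_face_iff h1 h2 f).1 hf
  refine ⟨⟨z, u, v⟩, ⟨hz, hc⟩, ?_⟩
  rintro ⟨z', u', v'⟩ ⟨hz', hc'⟩
  dsimp only at hz' hc'
  obtain rfl : z' = z := by
    by_contra hne
    exact disjoint_left.1 (F.face_disjoint x y i (by rintro rfl; omega) h1
      (by unfold mdim; omega) hz' hz hne) ⟨(v', u'), hc'⟩ ⟨(v, u), hc⟩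
  have := F.injective_comp (x := x) (z := z') (y := y) (by omega) (by omega)
    (a₁ := (v', u')) (a₂ := (v, u)) (hc'.trans hc.symm)
  obtain ⟨rfl, rfl⟩ := Prod.mk.inj this
  rfl

theorem mem_bdry_iff {x y : C} (f : F.Mod x y) :
    f ∈ bdry (mdim gr x y) (F.Mod x y) ↔ F.IsEdge (x := x) (y := y) f :=
  Set.ext_iff.1 (bdry_eq_isEdgePoint (F.withFaces x y)) f

theorem isEdge_iff {x y : C} (f : x ⟶ y) :
    F.IsEdge f ↔ ∃ i : ℕ, 1 ≤ i ∧ gr y + i < gr x ∧ f ∈ F.face x y i := by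
  have h1 := bdry_eq_isEdgePoint (F.withFaces x y)
  rw [← (F.faceStructure x y).union] at h1
  have h2 := Set.ext_iff.1 h1 f
  refine Iff.trans h2.symm ⟨fun hf => ?_, ?_⟩
  · obtain ⟨i, ⟨hi, hi'⟩, h⟩ := mem_iUnion₂.1 hf
    unfold mdim at hi'
    exact ⟨i, hi, by omega, h⟩
  · rintro ⟨i, h3, h4, h⟩
    exact mem_iUnion₂.2 ⟨i, ⟨h3, by unfold mdim; omega⟩, h⟩

theorem isEdge_comp {x z y : C} (u : x ⟶ z) (v : z ⟶ y) (h1 : gr y < gr z) (h2 : gr z < gr x) :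
    F.IsEdge (u ≫ v) := by
  obtain ⟨m, hm⟩ := Int.le.dest h1.le
  exact (F.isEdge_iff _).2 ⟨m, by omega, by omega,
    F.isFaceCategory.comp_mem u v m (by omega) hm.symm h2⟩

theorem continuous_comp (x z y : C) : Continuous (F.comp x z y) := by
  by_cases hxz : x = z
  · subst hxz
    have : F.comp x x y = Prod.fst := by
      funext ⟨p, q⟩
      exact (congrArg (fun q : x ⟶ x => CategoryStruct.comp (obj := C) q p) (F.hom_self x q)).trans
        (Category.id_comp (obj := C) p)
    rw [this]; exact continuous_fst
  by_cases hzy : z = y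
  · subst hzy
    have : F.comp x z z = Prod.snd := by
      funext ⟨p, q⟩
      exact (congrArg (fun p : z ⟶ z => CategoryStruct.comp (obj := C) q p) (F.hom_self z p)).trans
        (Category.comp_id (obj := C) q)
    rw [this]; exact continuous_snd
  by_cases h : Nonempty (F.Mod z y × F.Mod x z)
  · obtain ⟨p, q⟩ := h
    exact (F.comp_embedding x z y (F.isFaceCategory.gr_lt p hzy)
      (F.isFaceCategory.gr_lt q hxz)).isEmbedding.continuous
  · rw [not_nonempty_iff] at h
    exact continuous_iff_continuousAt.2 fun p => h.elim p

theorem component_comp {x z y : C} {u u' : x ⟶ z} {v v' : z ⟶ y}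
    (hu : F.component u = F.component u') (hv : F.component v = F.component v') :
    F.component (u ≫ v) = F.component (u' ≫ v') := by
  have h1 : Continuous fun p : F.Mod z y => F.comp x z y (p, u) :=
    (F.continuous_comp x z y).comp (by fun_prop)
  have h2 : Continuous fun q : F.Mod x z => F.comp x z y (v', q) :=
    (F.continuous_comp x z y).comp (by fun_prop)
  exact (h1.connectedComponent_eq hv).trans (h2.connectedComponent_eq hu)

theorem isClosed_face [Finite C] (x y : C) (i : ℕ) :
    IsClosed (X := F.Mod x y) (F.face x y i) := by
  by_cases h : 1 ≤ i ∧ gr y + i < gr x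
  · rw [F.face_eq x y i (by rintro rfl; omega) h.1 (by unfold mdim; omega)]
    exact (toFinite _).isClosed_biUnion fun z _ => (isCompact_range (F.continuous_comp x z y)).isClosed
  · rw [F.face_eq_empty h]; exact isClosed_empty

/-- Near a boundary point of a moduli space, any boundary point factors in the same way as the given
one, up to moving the factors inside their components. -/
theorem eventually_exists_comp [Finite C] {x y : C} (f : F.Mod x y) : ∀ᶠ g : F.Mod x y in 𝓝 f,
    ∀ i : ℕ, 1 ≤ i → gr y + i < gr x → g ∈ F.face x y i → f ∈ F.face x y i ∧
      ∃ (z : C) (u u' : x ⟶ z) (v v' : z ⟶ y), gr z = gr y + i ∧ u ≫ v = f ∧ u' ≫ v' = g ∧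
        F.component u' = F.component u ∧ F.component v' = F.component v := by
  have hfin : ∀ᶠ g : F.Mod x y in 𝓝 f, ∀ i ∈ {i : ℕ | gr y + i < gr x}, 1 ≤ i →
      g ∈ F.face x y i → f ∈ F.face x y i ∧
      ∃ (z : C) (u u' : x ⟶ z) (v v' : z ⟶ y), gr z = gr y + i ∧ u ≫ v = f ∧ u' ≫ v' = g ∧
        F.component u' = F.component u ∧ F.component v' = F.component v := by
    rw [Filter.eventually_all_finite]
    swap
    · exact (finite_lt_nat (gr x - gr y).toNat).subset fun i hi => by
        simp only [mem_ofPred_eq] at hi ⊢; omega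
    intro i hi
    simp only [mem_ofPred_eq] at hi
    by_cases h1 : 1 ≤ i
    swap
    · exact Filter.Eventually.of_forall fun _ h => absurd h h1
    by_cases hf : f ∈ F.face x y i
    swap
    · filter_upwards [(F.isClosed_face x y i).isOpen_compl.mem_nhds hf] with g hg _ hg'
      exact absurd hg' hg
    obtain ⟨z, u, v, hz, hc⟩ := (F.mem_face_iff h1 hi f).1 hf
    -- the part of the face that is far from `f`
    let A : Set (F.Mod z y × F.Mod x z) :=
      {q | F.component q.1 = F.component v ∧ F.component q.2 = F.component u}
    have hA : IsOpen A := ((isOpen_setOf_connectedComponent_eq (X := F.Mod z y) v).preimage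
      continuous_fst).inter ((isOpen_setOf_connectedComponent_eq (X := F.Mod x z) u).preimage
      continuous_snd)
    have hcl : IsClosed (F.comp x z y '' Aᶜ ∪ ⋃ w ∈ {w | gr w = gr y + i ∧ w ≠ z},
        range (F.comp x w y)) := by
      refine IsClosed.union ?_ ?_
      · exact (hA.isClosed_compl.isCompact.image (F.continuous_comp x z y)).isClosed
      · exact (toFinite _).isClosed_biUnion fun w _ =>
          (isCompact_range (F.continuous_comp x w y)).isClosed
    have hUF := F.uniqueFactorization x y f i h1 hi hf
    have hnot : f ∉ (F.comp x z y '' Aᶜ ∪ ⋃ w ∈ {w | gr w = gr y + i ∧ w ≠ z},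
        range (F.comp x w y)) := by
      rintro (⟨⟨p, q⟩, hq, h⟩ | h)
      · have := hUF.unique (y₁ := ⟨z, u, v⟩) (y₂ := ⟨z, q, p⟩) ⟨hz, hc⟩ ⟨hz, h⟩
        obtain ⟨rfl, rfl⟩ := Prod.mk.inj (eq_of_heq (Sigma.mk.inj this).2)
        exact hq ⟨rfl, rfl⟩
      · simp only [mem_iUnion] at h
        obtain ⟨w, ⟨hw, hne⟩, ⟨p, q⟩, h⟩ := h
        exact hne (Sigma.mk.inj (hUF.unique (y₁ := ⟨w, q, p⟩) (y₂ := ⟨z, u, v⟩) ⟨hw, h⟩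
          ⟨hz, hc⟩)).1
    filter_upwards [hcl.isOpen_compl.mem_nhds hnot] with g hg _ hg'
    refine ⟨hf, ?_⟩
    obtain ⟨w, u', v', hw, hc'⟩ := (F.mem_face_iff h1 hi g).1 hg'
    obtain rfl : w = z := by
      by_contra hne
      refine hg (Or.inr ?_)
      simp only [mem_iUnion]
      exact ⟨w, ⟨hw, hne⟩, (v', u'), hc'⟩
    have hmem : ((v', u') : F.Mod w y × F.Mod x w) ∈ A := by
      by_contra h
      exact hg (Or.inl ⟨_, h, hc'⟩)
    exact ⟨w, u, u', v, v', hz, hc, hc', hmem.2, hmem.1⟩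
  filter_upwards [hfin] with g hg i h1 h2 h3
  exact hg i h2 h1 h3

end FlowStructure

variable {C₂ : Type u₂} [Category.{v₂} C₂] {gr₂ : C₂ → ℤ} {F : FlowStructure C gr}
  {F₂ : FlowStructure C₂ gr₂} {H : C ⥤ C₂}

namespace IsFlowMorphism

theorem isLocalHomeomorph (h : IsFlowMorphism F F₂ H) (x y : C) :
    IsLocalHomeomorph (modMap F F₂ H x y) := (h.localDiffeo x y).isLocalHomeomorph

theorem component_map (h : IsFlowMorphism F F₂ H) {x y : C} {f g : x ⟶ y}
    (hfg : F.component f = F.component g) :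
    F₂.component (H.map f) = F₂.component (H.map g) :=
  (h.isLocalHomeomorph x y).continuous.connectedComponent_eq hfg

theorem isEdge_map_iff (h : IsFlowMorphism F F₂ H) {x y : C} (f : x ⟶ y) :
    F₂.IsEdge (H.map f) ↔ F.IsEdge f := (h.isLocalHomeomorph x y).isEdgePoint_iff f

/-- A morphism of flow categories preserves and reflects the faces. -/
theorem map_mem_face_iff (h : IsFlowMorphism F F₂ H) {x y : C} (f : x ⟶ y) (i : ℕ) :
    H.map f ∈ F₂.face (H.obj x) (H.obj y) i ↔ f ∈ F.face x y i := by
  have key : ∀ N : ℕ, ∀ x y : C, gr x - gr y < N → ∀ (f : x ⟶ y) (i : ℕ),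
      H.map f ∈ F₂.face (H.obj x) (H.obj y) i ↔ f ∈ F.face x y i := by
    intro N
    induction N with
    | zero =>
      intro x y hxy f
      have := F.isFaceCategory.gr_le f
      push_cast at hxy
      omega
    | succ N ih =>
      intro x y hxy f i
      have hx := h.gr_obj x
      have hy := h.gr_obj y
      by_cases hi : 1 ≤ i ∧ gr y + i < gr x
      swap
      · rw [F.face_eq_empty hi, F₂.face_eq_empty (by omega)]
        rfl
      obtain ⟨h1, h2⟩ := hi
      constructor
      · intro hf
        have h3 : F.IsEdge f := (h.isEdge_map_iff f).1
          ((F₂.isEdge_iff _).2 ⟨i, h1, by omega, hf⟩)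
        obtain ⟨j, h4, h5, hj⟩ := (F.isEdge_iff f).1 h3
        obtain ⟨z, p, q, hz, rfl⟩ := (F.mem_face_iff h4 h5 f).1 hj
        have hz' := h.gr_obj z
        rw [H.map_comp] at hf
        rcases lt_trichotomy i j with hij | rfl | hij
        · rw [F₂.isFaceCategory.comp_lt _ _ j h4 (by omega) (by omega) i hij,
            ih z y (by push_cast at hxy; omega)] at hf
          rwa [F.isFaceCategory.comp_lt _ _ j h4 hz (by omega) i hij]
        · exact hj
        · rw [F₂.isFaceCategory.comp_gt _ _ j h4 (by omega) (by omega) i hij,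
            ih x z (by push_cast at hxy; omega)] at hf
          rwa [F.isFaceCategory.comp_gt _ _ j h4 hz (by omega) i hij]
      · intro hf
        obtain ⟨z, p, q, hz, rfl⟩ := (F.mem_face_iff h1 h2 f).1 hf
        have hz' := h.gr_obj z
        rw [H.map_comp]
        exact F₂.isFaceCategory.comp_mem _ _ i h1 (by omega) (by omega)
  exact key ((gr x - gr y).toNat + 1) x y (by push_cast; omega) f i

theorem hasComponentSections (h : IsFlowMorphism F F₂ H) (hF₂ : F₂.IsDisc) (x y : C) :
    HasComponentSections (modMap F F₂ H x y) :=
  (h.isLocalHomeomorph x y).hasComponentSections_of_disc (hF₂ _ _)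

end IsFlowMorphism

end FlowCategories

end FlowCat

/-! ### Morphisms of the glued category -/

/-- Two ways to split a path: one of them refines the other. -/
theorem Quiver.Path.comp_eq_comp {V : Type*} [Quiver V] {b z z' a : V} {p₁ : Quiver.Path b z}
    {p₂ : Quiver.Path z a} {q₁ : Quiver.Path b z'} {q₂ : Quiver.Path z' a}
    (h : p₁.comp p₂ = q₁.comp q₂) :
    (∃ r : Quiver.Path z z', q₁ = p₁.comp r ∧ p₂ = r.comp q₂) ∨
      ∃ r : Quiver.Path z' z, p₁ = q₁.comp r ∧ q₂ = r.comp p₂ := by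
  induction p₂ with
  | nil => exact Or.inr ⟨q₂, h, rfl⟩
  | cons p₂ e ih =>
    cases q₂ with
    | nil => exact Or.inl ⟨p₂.cons e, h.symm, rfl⟩
    | cons q₂ e' =>
      change (p₁.comp p₂).cons e = (q₁.comp q₂).cons e' at h
      obtain rfl := Quiver.Path.obj_eq_of_cons_eq_cons h
      obtain rfl := eq_of_heq (Quiver.Path.hom_heq_of_cons_eq_cons h)
      rcases ih (eq_of_heq (Quiver.Path.heq_of_cons_eq_cons h)) with ⟨r, h1, rfl⟩ | ⟨r, h1, rfl⟩
      · exact Or.inl ⟨r, h1, rfl⟩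
      · exact Or.inr ⟨r, h1, rfl⟩

/-- A function on morphisms which is invariant under the generating relations descends to the
quotient category. -/
theorem CategoryTheory.Quotient.apply_eq_of_map_eq {C : Type*} [Category C] {r : HomRel C} {b a : C}
    {A : Type*} (φ : (b ⟶ a) → A) (hφ : ∀ {x y : C} (u : b ⟶ x) (m m' : x ⟶ y) (v : y ⟶ a),
      r m m' → φ (u ≫ m ≫ v) = φ (u ≫ m' ≫ v)) {f f' : b ⟶ a}
    (h : (Quotient.functor r).map f = (Quotient.functor r).map f') : φ f = φ f' := by
  have h' : Quot.mk (@HomRel.CompClosure C _ r b a) f = Quot.mk (@HomRel.CompClosure C _ r b a) f' :=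
    h
  refine congrArg (Quot.lift φ ?_) h'
  rintro _ _ ⟨x, y, u, m, m', v, h⟩
  exact hφ u m m' v h

namespace FlowCat

section Glued

variable {C : Type u} [Category.{v} C] {gr : C → ℤ}

/-- A morphism of `C`, as a morphism of a window. -/
def windowHom {i : ℤ} {x y : C} (hx : InWindow gr i x) (hy : InWindow gr i y) (f : x ⟶ y) :
    (⟨x, hx⟩ : Window gr i) ⟶ ⟨y, hy⟩ := ObjectProperty.homMk f

theorem hom_eq_id (W : WindowFlows gr) {x : C} (f : x ⟶ x) : f = 𝟙 x := by
  have hx : InWindow gr (gr x) x := ⟨le_rfl, by omega⟩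
  exact congrArg InducedCategory.Hom.hom ((W (gr x)).hom_self ⟨x, hx⟩ (windowHom hx hx f))

/-- The composition of a path of morphisms of windows. -/
def ev {x y : WindowQuiver gr} (p : Quiver.Path x y) : (show C from x) ⟶ (show C from y) :=
  (evalPath gr).map (X := x) (Y := y) p

theorem ev_comp {x y z : WindowQuiver gr} (p : Quiver.Path x y) (q : Quiver.Path y z) :
    ev (p.comp q) = ev p ≫ ev q := (evalPath gr).map_comp (X := x) (Y := y) (Z := z) p q

theorem eq_or_gr_lt_of_window (W : WindowFlows gr) {x y : C} (f : x ⟶ y)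
    (h : ∃ i, InWindow gr i x ∧ InWindow gr i y) : x = y ∨ gr y < gr x := by
  obtain ⟨i, hx, hy⟩ := h
  by_cases hxy : x = y
  · exact Or.inl hxy
  · refine Or.inr ((W i).isFaceCategory.gr_lt (windowHom hx hy f) fun h => hxy ?_)
    exact congrArg ObjectProperty.FullSubcategory.obj h

theorem eq_or_gr_lt_of_path (W : WindowFlows gr) {x y : WindowQuiver gr} (p : Quiver.Path x y) :
    x = y ∨ gr y < gr x := by
  induction p with
  | nil => exact Or.inl rfl
  | cons p e ih =>
    rcases eq_or_gr_lt_of_window W e.1 e.2 with h | h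
    · subst h; exact ih
    · rcases ih with rfl | h'
      · exact Or.inr h
      · exact Or.inr (h.trans h')

theorem exists_path (hC : IsGluedFromWindows gr) {x y : C} (f : x ⟶ y) :
    ∃ p : Quiver.Path (V := WindowQuiver gr) x y, ev p = f := hC.full x y f

theorem gr_lt_of_hom (W : WindowFlows gr) (hC : IsGluedFromWindows gr) {x y : C} (f : x ⟶ y)
    (hxy : x ≠ y) : gr y < gr x :=
  let ⟨p, _⟩ := exists_path hC f
  (eq_or_gr_lt_of_path W p).resolve_left hxy

theorem gr_le_of_hom (W : WindowFlows gr) (hC : IsGluedFromWindows gr) {x y : C} (f : x ⟶ y) :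
    gr y ≤ gr x := by
  by_cases hxy : x = y
  · rw [hxy]
  · exact (gr_lt_of_hom W hC f hxy).le

theorem exists_path_split (W : WindowFlows gr) {b a : WindowQuiver gr} (p : Quiver.Path b a)
    (h : gr a + 3 ≤ gr b) : ∃ (z : WindowQuiver gr) (p₁ : Quiver.Path b z) (p₂ : Quiver.Path z a),
      p = p₁.comp p₂ ∧ gr a < gr z ∧ gr z < gr b := by
  induction p with
  | nil => omega
  | @cons z a p e ih =>
    rcases eq_or_gr_lt_of_window W e.1 e.2 with hz | hz
    · subst hz
      obtain ⟨w, p₁, p₂, rfl, h1⟩ := ih h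
      exact ⟨w, p₁, p₂.cons e, rfl, h1⟩
    · rcases eq_or_gr_lt_of_path W p with hb | hb
      · subst hb
        obtain ⟨i, h1, h2⟩ := e.2
        have h3 := h1.2
        have h4 := h2.1
        omega
      · exact ⟨z, p, e.toPath, rfl, hz, hb⟩

theorem exists_comp_of_three_le (W : WindowFlows gr) (hC : IsGluedFromWindows gr) {b a : C}
    (f : b ⟶ a) (h : gr a + 3 ≤ gr b) : ∃ (z : C) (u : b ⟶ z) (v : z ⟶ a),
      gr a < gr z ∧ gr z < gr b ∧ u ≫ v = f := by
  obtain ⟨p, rfl⟩ := exists_path hC f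
  obtain ⟨z, p₁, p₂, rfl, h1, h2⟩ := exists_path_split W p h
  exact ⟨z, ev p₁, ev p₂, h1, h2, (ev_comp p₁ p₂).symm⟩

/-- Any two factorizations of a morphism of `C` that lies in no window are related by a sequence of
moves `(u, h ≫ v) ↔ (u ≫ h, v)`. -/
theorem apply_eq_of_comp_eq (W : WindowFlows gr) (hC : IsGluedFromWindows gr) {b a : C}
    (h : gr a + 3 ≤ gr b) {A : Type*} (φ : ∀ z : C, gr a < gr z → gr z < gr b → (b ⟶ z) →
      (z ⟶ a) → A)
    (hφ : ∀ (z z' : C) (h1 : gr a < gr z) (h2 : gr z < gr b) (h1' : gr a < gr z')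
      (h2' : gr z' < gr b) (u : b ⟶ z) (k : z ⟶ z') (v : z' ⟶ a),
      φ z h1 h2 u (k ≫ v) = φ z' h1' h2' (u ≫ k) v)
    {z z' : C} (h1 : gr a < gr z) (h2 : gr z < gr b) (h1' : gr a < gr z') (h2' : gr z' < gr b)
    {u : b ⟶ z} {v : z ⟶ a} {u' : b ⟶ z'} {v' : z' ⟶ a} (hc : u ≫ v = u' ≫ v') :
    φ z h1 h2 u v = φ z' h1' h2' u' v' := by
  -- the values of `φ` on the splittings of a path
  let Val (p : Quiver.Path (V := WindowQuiver gr) b a) : Set A :=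
    {s | ∃ (z : WindowQuiver gr) (h1 : gr a < gr z) (h2 : gr z < gr b) (p₁ : Quiver.Path _ z)
      (p₂ : Quiver.Path z _), p = p₁.comp p₂ ∧ φ z h1 h2 (ev p₁) (ev p₂) = s}
  have hne : ∀ p, (Val p).Nonempty := fun p =>
    let ⟨z, p₁, p₂, hp, h1, h2⟩ := exists_path_split W p h
    ⟨_, z, h1, h2, p₁, p₂, hp, rfl⟩
  have huniq : ∀ p s s', s ∈ Val p → s' ∈ Val p → s = s' := by
    rintro p _ _ ⟨z, h1, h2, p₁, p₂, rfl, rfl⟩ ⟨z', h1', h2', q₁, q₂, hq, rfl⟩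
    rcases Quiver.Path.comp_eq_comp hq with ⟨r, rfl, rfl⟩ | ⟨r, rfl, rfl⟩
    · exact (congrArg (φ z h1 h2 (ev p₁)) (ev_comp r q₂)).trans ((hφ z z' h1 h2 h1' h2' _ _ _).trans
        (congrArg (fun w => φ z' h1' h2' w (ev q₂)) (ev_comp p₁ r).symm))
    · exact (congrArg (fun w => φ z h1 h2 w (ev p₂)) (ev_comp q₁ r)).trans
        ((hφ z' z h1' h2' h1 h2 _ _ _).symm.trans
        (congrArg (φ z' h1' h2' (ev q₁)) (ev_comp r p₂).symm))
  have heq : ∀ p q, (∃ s, s ∈ Val p ∧ s ∈ Val q) → Val p = Val q := by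
    rintro p q ⟨s, h1, h2⟩
    ext t
    exact ⟨fun h => huniq p s t h1 h ▸ h2, fun h => huniq q s t h2 h ▸ h1⟩
  have hval : ∀ p q : Quiver.Path (V := WindowQuiver gr) b a, ev p = ev q → Val p = Val q := by
    intro p q hpq
    refine CategoryTheory.Quotient.apply_eq_of_map_eq (C := Paths (WindowQuiver gr)) Val ?_
      (hC.faithful b a p q hpq)
    intro x y u m m' v hm
    have hev : ev (gr := gr) m = ev m' := by
      cases hm with
      | id x h => exact Category.id_comp _
      | comp f g i hx hz hy =>
        exact (congrArg (· ≫ g) (Category.id_comp (obj := C) f)).trans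
          (Category.id_comp (obj := C) (f ≫ g)).symm
    have hev' : ev (gr := gr) (m ≫ v) = ev (m' ≫ v) := by
      refine (ev_comp m v).trans (Eq.trans ?_ (ev_comp m' v).symm)
      rw [hev]
    refine heq _ _ ?_
    rcases eq_or_gr_lt_of_path W u with hbx | hbx
    · rcases eq_or_gr_lt_of_path W v with hya | hya
      · exfalso
        have hwin : ∃ i, InWindow gr i x ∧ InWindow gr i y := by
          cases hm with
          | id x h => exact h
          | comp f g i hx hz hy => exact ⟨i, hx, hy⟩
        obtain ⟨i, h1, h2⟩ := hwin
        have h3 := h1.2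
        have h4 := h2.1
        subst hbx hya
        omega
      · by_cases hyb : gr y < gr b
        · refine ⟨φ y hya hyb (ev (gr := gr) (u ≫ m)) (ev (gr := gr) v),
            ⟨y, hya, hyb, u ≫ m, v, ?_, rfl⟩, ⟨y, hya, hyb, u ≫ m', v, ?_, ?_⟩⟩
          · exact (Category.assoc u m v).symm
          · exact (Category.assoc u m' v).symm
          · congr 1
            refine (ev_comp u m').trans (Eq.trans ?_ (ev_comp u m).symm)
            rw [hev]
        · have hby : b = y := by
            rcases eq_or_gr_lt_of_path W (Quiver.Path.comp u m) with h' | h'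
            · exact h'
            · exact absurd h' hyb
          subst hby
          obtain ⟨z, p₁, p₂, rfl, h1, h2⟩ := exists_path_split W v h
          refine ⟨φ z h1 h2 (ev (gr := gr) (u ≫ m ≫ p₁)) (ev (gr := gr) p₂),
            ⟨z, h1, h2, u ≫ m ≫ p₁, p₂, ?_, rfl⟩, ⟨z, h1, h2, u ≫ m' ≫ p₁, p₂, ?_, ?_⟩⟩
          · exact (Category.assoc u m _).symm.trans ((Category.assoc (u ≫ m) p₁ p₂).symm.trans
              (congrArg (· ≫ p₂) (Category.assoc u m p₁)))
          · exact (Category.assoc u m' _).symm.trans ((Category.assoc (u ≫ m') p₁ p₂).symm.trans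
              (congrArg (· ≫ p₂) (Category.assoc u m' p₁)))
          · congr 1
            refine (ev_comp u (m' ≫ p₁)).trans (Eq.trans ?_ (ev_comp u (m ≫ p₁)).symm)
            congr 1
            refine (ev_comp m' p₁).trans (Eq.trans ?_ (ev_comp m p₁).symm)
            rw [hev]
    · by_cases hxa : gr a < gr x
      · refine ⟨φ x hxa hbx (ev (gr := gr) u) (ev (gr := gr) (m ≫ v)),
          ⟨x, hxa, hbx, u, m ≫ v, rfl, rfl⟩, ⟨x, hxa, hbx, u, m' ≫ v, rfl, ?_⟩⟩
        rw [hev']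
      · have hxa' : x = a := by
          rcases eq_or_gr_lt_of_path W (Quiver.Path.comp m v) with h' | h'
          · exact h'
          · exact absurd h' hxa
        subst hxa'
        obtain ⟨z, p₁, p₂, rfl, h1, h2⟩ := exists_path_split W u h
        refine ⟨φ z h1 h2 (ev (gr := gr) p₁) (ev (gr := gr) (p₂ ≫ m ≫ v)),
          ⟨z, h1, h2, p₁, p₂ ≫ m ≫ v, Category.assoc p₁ p₂ (m ≫ v), rfl⟩,
          ⟨z, h1, h2, p₁, p₂ ≫ m' ≫ v, Category.assoc p₁ p₂ (m' ≫ v), ?_⟩⟩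
        congr 1
        refine (ev_comp p₂ (m' ≫ v)).trans (Eq.trans ?_ (ev_comp p₂ (m ≫ v)).symm)
        rw [hev']
  obtain ⟨p₁, rfl⟩ := exists_path hC u
  obtain ⟨p₂, rfl⟩ := exists_path hC v
  obtain ⟨q₁, rfl⟩ := exists_path hC u'
  obtain ⟨q₂, rfl⟩ := exists_path hC v'
  have hc' : ev (p₁.comp p₂) = ev (q₁.comp q₂) := (ev_comp p₁ p₂).trans (hc.trans (ev_comp q₁ q₂).symm)
  refine huniq _ _ _ ⟨z, h1, h2, p₁, p₂, rfl, rfl⟩ ?_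
  rw [hval _ _ hc']
  exact ⟨z', h1', h2', q₁, q₂, rfl, rfl⟩

end Glued

end FlowCat

/-! ### The category `C₁` -/

namespace FlowCat

section Canonical

variable {C : Type u} [Category.{v} C] {gr : C → ℤ} (W : WindowFlows gr)

/-- Two morphisms of `C` are related if they lie in the same component of a moduli space of a
window. -/
def winRel : HomRel C := fun x y f g =>
  ∃ (i : ℤ) (hx : InWindow gr i x) (hy : InWindow gr i y),
    (W i).component (windowHom hx hy f) = (W i).component (windowHom hx hy g)

/-- The morphisms from `b` to `a` in the category whose morphism sets are generated by the
components of the moduli spaces of the windows. It will turn out to be the set of components of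
the moduli space from `b` to `a`. -/
def Pi0 (b a : C) : Type v :=
  (Quotient.functor (winRel W)).obj b ⟶ (Quotient.functor (winRel W)).obj a

/-- The class of a morphism of `C`. -/
def pi0 {b a : C} (f : b ⟶ a) : Pi0 W b a := (Quotient.functor (winRel W)).map f

/-- The composition of classes. -/
def Pi0.comp {b z a : C} (κ : Pi0 W b z) (μ : Pi0 W z a) : Pi0 W b a :=
  CategoryStruct.comp (obj := Quotient (winRel W)) κ μ

theorem pi0_comp {b z a : C} (f : b ⟶ z) (g : z ⟶ a) :
    pi0 W (f ≫ g) = (pi0 W f).comp W (pi0 W g) := (Quotient.functor (winRel W)).map_comp f g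

theorem pi0_surjective (b a : C) : Function.Surjective (pi0 W : (b ⟶ a) → Pi0 W b a) :=
  fun κ => (Quotient.functor (winRel W)).map_surjective (X := b) (Y := a) κ

theorem component_eq_of_window {i j : ℤ} {x y : C} (hx : InWindow gr i x) (hy : InWindow gr i y)
    (hx' : InWindow gr j x) (hy' : InWindow gr j y) {f g : x ⟶ y}
    (h : (W i).component (windowHom hx hy f) = (W i).component (windowHom hx hy g)) :
    (W j).component (windowHom hx' hy' f) = (W j).component (windowHom hx' hy' g) := by
  by_cases hij : i = j
  · subst hij; exact h
  · -- a morphism in two windows lies in a discrete moduli space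
    have hdim : mdim (windowGr gr i) ⟨x, hx⟩ ⟨y, hy⟩ = 0 := by
      have h1 := hx.2
      have h2 := hy.1
      have h3 := hx'.2
      have h4 := hy'.1
      unfold mdim windowGr
      dsimp only
      omega
    have hsub : Subsingleton (EuclideanQuadrant (mdim (windowGr gr i) ⟨x, hx⟩ ⟨y, hy⟩)) := by
      rw [hdim]
      exact ⟨fun p q => Subtype.ext (Subsingleton.elim _ _)⟩
    have hdisc : DiscreteTopology ((W i).Mod ⟨x, hx⟩ ⟨y, hy⟩) :=
      ChartedSpace.discreteTopology (EuclideanQuadrant (mdim (windowGr gr i) ⟨x, hx⟩ ⟨y, hy⟩)) _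
    have h5 := (W i).component_eq_iff.1 h
    have h6 : windowHom hx hy f = windowHom hx hy g := isPreconnected_connectedComponent.subsingleton
      (α := (W i).Mod ⟨x, hx⟩ ⟨y, hy⟩) h5 ((W i).mem_component _)
    have h7 : f = g := congrArg InducedCategory.Hom.hom h6
    rw [h7]

variable {W}

/-- A functor which is continuous on the windows sends morphisms of the same class to the same
component. -/
theorem component_map_eq_of_pi0_eq {A : Type u₂} [Category.{v₂} A] {grA : A → ℤ}
    {F : FlowStructure A grA} {H : C ⥤ A}
    (hH : ∀ i : ℤ, IsFlowMorphism (W i) F ((InWindow gr i).ι ⋙ H)) {b a : C} {f g : b ⟶ a}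
    (h : pi0 W f = pi0 W g) : F.component (H.map f) = F.component (H.map g) := by
  refine CategoryTheory.Quotient.apply_eq_of_map_eq (fun f => F.component (H.map f)) ?_ h
  rintro x y u m m' v ⟨i, hx, hy, hm⟩
  simp only [H.map_comp]
  exact F.component_comp rfl (F.component_comp ((hH i).component_map hm) rfl)

theorem component_windowHom_eq_of_pi0_eq (hC : IsGluedFromWindows gr) {i : ℤ} {b a : C}
    (hb : InWindow gr i b) (ha : InWindow gr i a) {f g : b ⟶ a} (h : pi0 W f = pi0 W g) :
    (W i).component (windowHom hb ha f) = (W i).component (windowHom hb ha g) := by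
  refine CategoryTheory.Quotient.apply_eq_of_map_eq
    (fun f => (W i).component (windowHom hb ha f)) ?_ h
  rintro x y u m m' v ⟨j, hx, hy, hm⟩
  have hx' : InWindow gr i x := ⟨(ha.1.trans (gr_le_of_hom W hC v)).trans (gr_le_of_hom W hC m),
    (gr_le_of_hom W hC u).trans hb.2⟩
  have hy' : InWindow gr i y := ⟨ha.1.trans (gr_le_of_hom W hC v),
    ((gr_le_of_hom W hC m).trans (gr_le_of_hom W hC u)).trans hb.2⟩
  exact (W i).component_comp (u := windowHom hb hx' u) (u' := windowHom hb hx' u) rfl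
    ((W i).component_comp (v := windowHom hy' ha v) (v' := windowHom hy' ha v)
      (component_eq_of_window W hx hy hx' hy' hm) rfl)

theorem pi0_eq_of_component_windowHom_eq {i : ℤ} {b a : C}
    (hb : InWindow gr i b) (ha : InWindow gr i a) {f g : b ⟶ a}
    (h : (W i).component (windowHom hb ha f) = (W i).component (windowHom hb ha g)) :
    pi0 W f = pi0 W g := CategoryTheory.Quotient.sound _ ⟨i, hb, ha, h⟩

theorem finite_pi0 [Finite C] (hC : IsGluedFromWindows gr) (b a : C) : Finite (Pi0 W b a) := by
  have key : ∀ N : ℕ, ∀ b a : C, gr b - gr a < N → Finite (Pi0 W b a) := by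
    intro N
    induction N with
    | zero =>
      intro b a h
      have : IsEmpty (Pi0 W b a) := ⟨fun κ => by
        obtain ⟨f, -⟩ := pi0_surjective W b a κ
        have := gr_le_of_hom W hC f
        push_cast at h
        omega⟩
      infer_instance
    | succ N ih =>
      intro b a h
      push_cast at h
      by_cases h3 : gr a + 3 ≤ gr b
      · let Z := {z : C // gr a < gr z ∧ gr z < gr b}
        have h1 : ∀ z : Z, Finite (Pi0 W b z.1 × Pi0 W z.1 a) := fun z => by
          have := z.2
          have := ih b z.1 (by omega)
          have := ih z.1 a (by omega)
          infer_instance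
        -- a class of degree at least three is a composition of classes of smaller degree
        refine Finite.of_surjective
          (fun t : Σ z : Z, Pi0 W b z.1 × Pi0 W z.1 a => t.2.1.comp W t.2.2) fun κ => ?_
        obtain ⟨f, rfl⟩ := pi0_surjective W b a κ
        obtain ⟨z, u, v, hz, hz', rfl⟩ := exists_comp_of_three_le W hC f h3
        exact ⟨⟨⟨z, hz, hz'⟩, pi0 W u, pi0 W v⟩, (pi0_comp W u v).symm⟩
      · by_cases hE : Nonempty (b ⟶ a)
        · obtain ⟨f₀⟩ := hE
          have hba := gr_le_of_hom W hC f₀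
          have hb : InWindow gr (gr a) b := ⟨hba, by omega⟩
          have ha : InWindow gr (gr a) a := ⟨le_rfl, by omega⟩
          -- in a window, the classes are components of a compact manifold
          have hfin : Finite (_root_.ConnectedComponents ((W (gr a)).Mod ⟨b, hb⟩ ⟨a, ha⟩)) :=
            inferInstance
          choose rep hrep using pi0_surjective W b a
          let φ : Pi0 W b a → _root_.ConnectedComponents ((W (gr a)).Mod ⟨b, hb⟩ ⟨a, ha⟩) := fun κ =>
            ConnectedComponents.mk (α := (W (gr a)).Mod ⟨b, hb⟩ ⟨a, ha⟩) (windowHom hb ha (rep κ))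
          refine Finite.of_injective φ fun κ κ' hκ => ?_
          rw [← hrep κ, ← hrep κ']
          exact pi0_eq_of_component_windowHom_eq hb ha (ConnectedComponents.coe_eq_coe.1 hκ)
        · have : IsEmpty (Pi0 W b a) := ⟨fun κ => hE ⟨(pi0_surjective W b a κ).choose⟩⟩
          infer_instance
  exact key ((gr b - gr a).toNat + 1) b a (by push_cast; omega)

variable {C₂ : Type u₂} [Category.{v} C₂] {gr₂ : C₂ → ℤ}

/-- The hypotheses on the windows, the glued category and the functor to `C₂`. -/
structure GluingData (W : WindowFlows gr) (F₂ : FlowStructure C₂ gr₂) (Ψ : C ⥤ C₂) : Prop where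
  glued : IsGluedFromWindows gr
  isDisc : F₂.IsDisc
  gr_obj : ∀ x, gr₂ (Ψ.obj x) = gr x
  flowMorphism : ∀ i : ℤ, IsFlowMorphism (W i) F₂ ((InWindow gr i).ι ⋙ Ψ)

variable (W) (F₂ : FlowStructure C₂ gr₂) (Ψ : C ⥤ C₂)

/-- The objects of the flow category `C₁` to be constructed: those of `C`. -/
def Can (_W : WindowFlows gr) (_F₂ : FlowStructure C₂ gr₂) (_Ψ : C ⥤ C₂) : Type u := C

/-- The morphisms of the flow category `C₁`: for each class of morphisms of `C`, the component of
the moduli space of `C₂` to which `Ψ` sends this class. -/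
@[ext]
structure CanHom (b a : C) : Type v where
  cls : Pi0 W b a
  pt : Ψ.obj b ⟶ Ψ.obj a
  exists_rep : ∃ f : b ⟶ a, pi0 W f = cls ∧ F₂.component (Ψ.map f) = F₂.component pt

variable {W F₂ Ψ} in
/-- The composition of morphisms of `C₁`. -/
def CanHom.comp {b z a : C} (f : CanHom W F₂ Ψ b z) (g : CanHom W F₂ Ψ z a) :
    CanHom W F₂ Ψ b a where
  cls := f.cls.comp W g.cls
  pt := f.pt ≫ g.pt
  exists_rep := by
    obtain ⟨f₀, h1, h2⟩ := f.exists_rep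
    obtain ⟨g₀, h3, h4⟩ := g.exists_rep
    refine ⟨f₀ ≫ g₀, by rw [← h1, ← h3, pi0_comp], ?_⟩
    rw [Ψ.map_comp]
    exact F₂.component_comp h2 h4

variable {W F₂ Ψ} in
/-- A morphism of `C`, as a morphism of `C₁`. -/
def CanHom.of {b a : C} (f : b ⟶ a) : CanHom W F₂ Ψ b a := ⟨pi0 W f, Ψ.map f, f, rfl, rfl⟩

theorem CanHom.of_comp {b z a : C} (f : b ⟶ z) (g : z ⟶ a) :
    (CanHom.of (f ≫ g) : CanHom W F₂ Ψ b a) = (CanHom.of f).comp (CanHom.of g) :=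
  CanHom.ext (pi0_comp W f g) (Ψ.map_comp f g)

theorem CanHom.of_id_comp {b a : C} (f : CanHom W F₂ Ψ b a) : (CanHom.of (𝟙 b)).comp f = f := by
  refine CanHom.ext (Category.id_comp (obj := Quotient (winRel W)) f.cls) ?_
  change Ψ.map (𝟙 b) ≫ f.pt = f.pt
  rw [Ψ.map_id, Category.id_comp]

theorem CanHom.comp_of_id {b a : C} (f : CanHom W F₂ Ψ b a) : f.comp (CanHom.of (𝟙 a)) = f := by
  refine CanHom.ext (Category.comp_id (obj := Quotient (winRel W)) f.cls) ?_
  change f.pt ≫ Ψ.map (𝟙 a) = f.pt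
  rw [Ψ.map_id, Category.comp_id]

instance : Category.{v} (Can W F₂ Ψ) where
  Hom b a := CanHom W F₂ Ψ b a
  id b := CanHom.of (𝟙 (show C from b))
  comp f g := CanHom.comp f g
  id_comp f := CanHom.of_id_comp W F₂ Ψ f
  comp_id f := CanHom.comp_of_id W F₂ Ψ f
  assoc f g h := CanHom.ext (Category.assoc (obj := Quotient (winRel W)) f.cls g.cls h.cls)
    (Category.assoc f.pt g.pt h.pt)

/-- The functor from `C` to `C₁`. -/
def canIncl : C ⥤ Can W F₂ Ψ where
  obj x := x
  map f := CanHom.of f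
  map_id _ := rfl
  map_comp f g := CanHom.of_comp W F₂ Ψ f g

/-- The functor from `C₁` to `C₂`. -/
@[reducible] def canCover : Can W F₂ Ψ ⥤ C₂ where
  obj x := Ψ.obj x
  map f := CanHom.pt f
  map_id x := Ψ.map_id (show C from x)
  map_comp _ _ := rfl

/-- The face `∂ᵢ` of the moduli spaces of `C₁`. -/
def canFace (x y : Can W F₂ Ψ) (i : ℕ) : Set (x ⟶ y) :=
  {f | (canCover W F₂ Ψ).map f ∈ F₂.face ((canCover W F₂ Ψ).obj x) ((canCover W F₂ Ψ).obj y) i}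

/-- The grading of `C₁`. -/
abbrev canGr (_W : WindowFlows gr) (_F₂ : FlowStructure C₂ gr₂) (_Ψ : C ⥤ C₂) :
    Can _W _F₂ _Ψ → ℤ := fun x => gr x

variable {W F₂ Ψ}

namespace GluingData

variable (D : GluingData W F₂ Ψ)

theorem component_eq_of_pi0_eq (D : GluingData W F₂ Ψ) {b a : C} {f g : b ⟶ a}
    (h : pi0 W f = pi0 W g) : F₂.component (Ψ.map f) = F₂.component (Ψ.map g) :=
  component_map_eq_of_pi0_eq D.flowMorphism h

theorem component_pt_eq (D : GluingData W F₂ Ψ) {b a : C} {f g : CanHom W F₂ Ψ b a}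
    (h : f.cls = g.cls) : F₂.component f.pt = F₂.component g.pt := by
  obtain ⟨f₀, h1, h2⟩ := f.exists_rep
  obtain ⟨g₀, h3, h4⟩ := g.exists_rep
  rw [← h2, ← h4]
  exact D.component_eq_of_pi0_eq (by rw [h1, h3, h])

theorem isFaceCategory (D : GluingData W F₂ Ψ) :
    IsFaceCategory (canGr W F₂ Ψ) (canFace W F₂ Ψ) := by
  refine F₂.isFaceCategory.comap (canCover W F₂ Ψ) D.gr_obj ?_ ?_
  · intro x f
    obtain ⟨f₀, h1, -⟩ := CanHom.exists_rep f
    refine CanHom.ext ?_ ((F₂.hom_self _ _).trans (F₂.hom_self _ _).symm)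
    rw [← h1]
    exact congrArg _ (hom_eq_id W f₀)
  · intro x y f hxy
    obtain ⟨f₀, -⟩ := CanHom.exists_rep f
    exact gr_lt_of_hom W D.glued f₀ hxy

/-- In the windows, the morphisms of `C₁` are those of `C`. -/
theorem of_bijective (D : GluingData W F₂ Ψ) {b a : C} (h : gr b ≤ gr a + 2) :
    Function.Bijective (CanHom.of : (b ⟶ a) → CanHom W F₂ Ψ b a) := by
  constructor
  · intro f g hfg
    have hb : InWindow gr (gr a) b := ⟨gr_le_of_hom W D.glued f, h⟩
    have ha : InWindow gr (gr a) a := ⟨le_rfl, by omega⟩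
    have h1 := component_windowHom_eq_of_pi0_eq D.glued hb ha (congrArg CanHom.cls hfg)
    have h2 := ((D.flowMorphism (gr a)).hasComponentSections D.isDisc ⟨b, hb⟩ ⟨a, ha⟩).injective h1
      (congrArg CanHom.pt hfg)
    exact congrArg InducedCategory.Hom.hom h2
  · intro f
    obtain ⟨f₀, h1, h2⟩ := f.exists_rep
    have hb : InWindow gr (gr a) b := ⟨gr_le_of_hom W D.glued f₀, h⟩
    have ha : InWindow gr (gr a) a := ⟨le_rfl, by omega⟩
    obtain ⟨g, hg, hg'⟩ := ((D.flowMorphism (gr a)).hasComponentSections D.isDisc ⟨b, hb⟩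
      ⟨a, ha⟩).exists_eq (y := windowHom hb ha f₀) (x := f.pt) h2.symm
    refine ⟨InducedCategory.Hom.hom g, CanHom.ext ?_ hg'⟩
    rw [← h1]
    exact pi0_eq_of_component_windowHom_eq hb ha hg

/-- In the windows, the factorizations in `C₁` are those of the given flow categories. -/
theorem uniqueFactorization_of_le_two (D : GluingData W F₂ Ψ) {b a : C} (h : gr b ≤ gr a + 2) :
    UniqueFactorization (canGr W F₂ Ψ) (canFace W F₂ Ψ) b a := by
  intro f i h1 h2 hf
  change gr a + i < gr b at h2
  have hb : InWindow gr (gr a) b := ⟨by omega, h⟩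
  have ha : InWindow gr (gr a) a := ⟨le_rfl, by omega⟩
  obtain ⟨f₀, rfl⟩ := (D.of_bijective h).2 f
  have h3 := ((D.flowMorphism (gr a)).map_mem_face_iff (windowHom hb ha f₀) i).1 hf
  obtain ⟨⟨z, hz⟩, u, v, hz', hc⟩ := ((W (gr a)).mem_face_iff h1 h2 _).1 h3
  have hc' : u.hom ≫ v.hom = f₀ := congrArg InducedCategory.Hom.hom hc
  refine ⟨⟨z, CanHom.of u.hom, CanHom.of v.hom⟩, ⟨hz', ?_⟩, ?_⟩
  · exact (CanHom.of_comp _ _ _ u.hom v.hom).symm.trans (congrArg CanHom.of hc')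
  · rintro ⟨w, u', v'⟩ ⟨hw, hc''⟩
    change gr w = gr a + i at hw
    change CanHom.comp u' v' = _ at hc''
    obtain ⟨u', rfl⟩ := (D.of_bijective (show gr b ≤ gr w + 2 by omega)).2 u'
    obtain ⟨v', rfl⟩ := (D.of_bijective (show gr w ≤ gr a + 2 by omega)).2 v'
    have h4 : u' ≫ v' = f₀ := (D.of_bijective h).1 ((CanHom.of_comp _ _ _ u' v').trans hc'')
    have hw' : InWindow gr (gr a) w := by constructor <;> omega
    have h5 := (W (gr a)).isFaceCategory.sigma_eq ((W (gr a)).uniqueFactorization _ _)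
      (u := windowHom hb hw' u') (v := windowHom hw' ha v') (u' := u) (v' := v)
      (by rw [hc, ← h4]; rfl) (hw.trans hz'.symm) (by dsimp only [windowGr]; omega)
      (by dsimp only [windowGr]; omega)
    obtain ⟨h6, h7⟩ := Sigma.mk.inj h5
    obtain rfl : w = z := congrArg ObjectProperty.FullSubcategory.obj h6
    obtain ⟨rfl, rfl⟩ := Prod.mk.inj (eq_of_heq h7)
    rfl

end GluingData

end Canonical

end FlowCat

/-! ### Factorizations and the glued boundary -/

namespace FlowCat

theorem FlowStructure.isClosed_comp {C : Type u} [Category.{v} C] {gr : C → ℤ}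
    (F : FlowStructure C gr) {x z y : C} {A : Set (F.Mod x z)} {B : Set (F.Mod z y)}
    (hA : IsClosed A) (hB : IsClosed B) :
    IsClosed {f : F.Mod x y | ∃ (u : x ⟶ z) (v : z ⟶ y), u ∈ A ∧ v ∈ B ∧ u ≫ v = f} := by
  convert ((hB.isCompact.prod hA.isCompact).image (F.continuous_comp x z y)).isClosed using 1
  ext f
  constructor
  · rintro ⟨u, v, hu, hv, h⟩
    exact ⟨(v, u), ⟨hv, hu⟩, h⟩
  · rintro ⟨⟨v, u⟩, ⟨hv, hu⟩, h⟩
    exact ⟨u, v, hu, hv, h⟩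

section Factorizations

variable {C : Type u} [Category.{v} C] {gr : C → ℤ} {W : WindowFlows gr}
  {C₂ : Type u₂} [Category.{v} C₂] {gr₂ : C₂ → ℤ} {F₂ : FlowStructure C₂ gr₂} {Ψ : C ⥤ C₂}

variable (F₂ Ψ) in
/-- The component of the moduli space of `C₂` that belongs to a class of morphisms of `C`. -/
def carrier {b a : C} (κ : Pi0 W b a) : Set (Ψ.obj b ⟶ Ψ.obj a) :=
  {x | ∃ f : b ⟶ a, pi0 W f = κ ∧ F₂.component (Ψ.map f) = F₂.component x}

theorem CanHom.pt_mem {b a : C} (f : CanHom W F₂ Ψ b a) : f.pt ∈ carrier F₂ Ψ f.cls := f.exists_rep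

variable (W F₂ Ψ) in
/-- Unique factorization of the morphisms of `C₁` from `b` to `a`. -/
abbrev CanUnique (b a : C) : Prop :=
  UniqueFactorization (canGr W F₂ Ψ) (canFace W F₂ Ψ) b a

theorem CanHom.comp_assoc {b z w a : C} (f : CanHom W F₂ Ψ b z) (g : CanHom W F₂ Ψ z w)
    (h : CanHom W F₂ Ψ w a) : (f.comp g).comp h = f.comp (g.comp h) :=
  Category.assoc (obj := Can W F₂ Ψ) f g h

theorem isClopen_carrier {b a : C} (κ : Pi0 W b a) :
    IsClopen (X := F₂.Mod (Ψ.obj b) (Ψ.obj a)) (carrier F₂ Ψ κ) :=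
  isClopen_of_connectedComponent_eq (X := F₂.Mod (Ψ.obj b) (Ψ.obj a)) fun _ _ h ⟨f, h1, h2⟩ =>
    ⟨f, h1, h2.trans h⟩

namespace GluingData

variable (D : GluingData W F₂ Ψ)

theorem component_eq_of_mem_carrier (D : GluingData W F₂ Ψ) {b a : C} {κ : Pi0 W b a}
    {x y : Ψ.obj b ⟶ Ψ.obj a} (hx : x ∈ carrier F₂ Ψ κ) (hy : y ∈ carrier F₂ Ψ κ) :
    F₂.component x = F₂.component y :=
  D.component_pt_eq (f := ⟨κ, x, hx⟩) (g := ⟨κ, y, hy⟩) rfl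

theorem gr_le (D : GluingData W F₂ Ψ) {b a : C} (f : CanHom W F₂ Ψ b a) : gr a ≤ gr b :=
  let ⟨f₀, _⟩ := f.exists_rep
  gr_le_of_hom W D.glued f₀

theorem exists_lift (D : GluingData W F₂ Ψ) {x z z' y : C} (hUF : CanUnique W F₂ Ψ x y)
    (hUF' : CanUnique W F₂ Ψ x z') {u : CanHom W F₂ Ψ x z} {v : CanHom W F₂ Ψ z y}
    {u' : CanHom W F₂ Ψ x z'} {v' : CanHom W F₂ Ψ z' y} (hc : u.comp v = u'.comp v')
    (hz : gr z' ≤ gr z) : ∃ l : CanHom W F₂ Ψ z z', u.comp l = u' ∧ l.comp v' = v :=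
  D.isFaceCategory.exists_lift hUF hUF' hc hz

end GluingData

variable (W F₂ Ψ) in
/-- The factorizations of morphisms from `b` to `a` in `C₁` through objects of intermediate
grading. -/
def Factorization (b a : C) : Type _ :=
  Σ z : {z : C // gr a < gr z ∧ gr z < gr b}, CanHom W F₂ Ψ b z.1 × CanHom W F₂ Ψ z.1 a

variable (W) in
/-- The types of factorizations: an intermediate object and the classes of the factors. -/
def FactorizationType (b a : C) : Type _ :=
  Σ z : {z : C // gr a < gr z ∧ gr z < gr b}, Pi0 W b z.1 × Pi0 W z.1 a

namespace Factorization

variable {b a : C}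

/-- The composition of the factors. -/
def total (e : Factorization W F₂ Ψ b a) : CanHom W F₂ Ψ b a := e.2.1.comp e.2.2

/-- The type of a factorization. -/
def type (e : Factorization W F₂ Ψ b a) : FactorizationType W b a :=
  ⟨e.1, e.2.1.cls, e.2.2.cls⟩

/-- The factorization `(f' ≫ h, g)` and the factorization `(f', h ≫ g)`. -/
def Refines (e e' : Factorization W F₂ Ψ b a) : Prop :=
  ∃ h : CanHom W F₂ Ψ e'.1.1 e.1.1, e'.2.1.comp h = e.2.1 ∧ h.comp e.2.2 = e'.2.2

/-- Two factorizations are equivalent if they differ by moving a morphism from one factor to the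
other. -/
def Rel (e e' : Factorization W F₂ Ψ b a) : Prop := Refines e e' ∨ Refines e' e

theorem Refines.refl (e : Factorization W F₂ Ψ b a) : Refines e e :=
  ⟨CanHom.of (𝟙 _), CanHom.comp_of_id _ _ _ _, CanHom.of_id_comp _ _ _ _⟩

theorem Rel.symm {e e' : Factorization W F₂ Ψ b a} (h : Rel e e') : Rel e' e := Or.symm h

theorem Refines.total_eq {e e' : Factorization W F₂ Ψ b a} (h : Refines e e') :
    e.total = e'.total := by
  obtain ⟨h, h1, h2⟩ := h
  rw [total, total, ← h1, ← h2, CanHom.comp_assoc]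

theorem Rel.total_eq {e e' : Factorization W F₂ Ψ b a} (h : Rel e e') : e.total = e'.total :=
  h.elim Refines.total_eq fun h => h.total_eq.symm

theorem Refines.gr_le (D : GluingData W F₂ Ψ) {e e' : Factorization W F₂ Ψ b a}
    (h : Refines e e') : gr e.1.1 ≤ gr e'.1.1 :=
  let ⟨h, _⟩ := h
  D.gr_le h

theorem Refines.eq_of_gr_eq (D : GluingData W F₂ Ψ) {e e' : Factorization W F₂ Ψ b a}
    (h : Refines e e') (hz : gr e.1.1 = gr e'.1.1) : e = e' := by
  obtain ⟨⟨z, hz1⟩, f, g⟩ := e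
  obtain ⟨⟨z', hz1'⟩, f', g'⟩ := e'
  obtain ⟨h, h1, h2⟩ := h
  dsimp only at h h1 h2 hz
  obtain rfl : z' = z := D.isFaceCategory.eq_of_gr_le (x := z') (y := z) h hz.ge
  obtain rfl : h = CanHom.of (𝟙 _) := D.isFaceCategory.eq_id _ h
  rw [CanHom.comp_of_id] at h1
  rw [CanHom.of_id_comp] at h2
  rw [h1, h2]

theorem Rel.eq_of_gr_eq (D : GluingData W F₂ Ψ) {e e' : Factorization W F₂ Ψ b a}
    (h : Rel e e') (hz : gr e.1.1 = gr e'.1.1) : e = e' :=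
  h.elim (fun h => h.eq_of_gr_eq D hz) fun h => (h.eq_of_gr_eq D hz.symm).symm

/-- Unique factorization of the morphisms between all pairs of objects that are closer to each
other than `b` and `a`. -/
abbrev LowerUnique (W : WindowFlows gr) (F₂ : FlowStructure C₂ gr₂) (Ψ : C ⥤ C₂) (b a : C) : Prop :=
  ∀ b' a' : C, gr b' - gr a' < gr b - gr a → CanUnique W F₂ Ψ b' a'

theorem Rel.trans (D : GluingData W F₂ Ψ) (hUF : LowerUnique W F₂ Ψ b a)
    {e₁ e₂ e₃ : Factorization W F₂ Ψ b a} (h₁ : Rel e₁ e₂) (h₂ : Rel e₂ e₃) : Rel e₁ e₃ := by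
  -- two factorizations with a common refinement, or a common coarsening, are comparable, because
  -- the factors have smaller degree and factor uniquely themselves
  have key1 : ∀ {e₁ e₂ e₃ : Factorization W F₂ Ψ b a}, Refines e₁ e₂ → Refines e₃ e₂ →
      gr e₃.1.1 ≤ gr e₁.1.1 → Refines e₃ e₁ := by
    rintro e₁ e₂ e₃ ⟨h, h1, h2⟩ ⟨k, h3, h4⟩ hz
    have hz1 := e₁.1.2
    have hz2 := e₂.1.2
    have hz3 := e₃.1.2
    obtain ⟨l, h5, h6⟩ := D.exists_lift (hUF _ _ (by omega)) (hUF _ _ (by omega))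
      (h2.trans h4.symm) hz
    exact ⟨l, by rw [← h1, CanHom.comp_assoc, h5, h3], h6⟩
  have key2 : ∀ {e₁ e₂ e₃ : Factorization W F₂ Ψ b a}, Refines e₂ e₁ → Refines e₂ e₃ →
      gr e₃.1.1 ≤ gr e₁.1.1 → Refines e₃ e₁ := by
    rintro e₁ e₂ e₃ ⟨h, h1, h2⟩ ⟨k, h3, h4⟩ hz
    have hz1 := e₁.1.2
    have hz2 := e₂.1.2
    have hz3 := e₃.1.2
    obtain ⟨l, h5, h6⟩ := D.exists_lift (hUF _ _ (by omega)) (hUF _ _ (by omega))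
      (h1.trans h3.symm) hz
    exact ⟨l, h5, by rw [← h4, ← CanHom.comp_assoc, h6, h2]⟩
  have key3 : ∀ {e₁ e₂ e₃ : Factorization W F₂ Ψ b a}, Refines e₁ e₂ → Refines e₂ e₃ →
      Refines e₁ e₃ := by
    rintro e₁ e₂ e₃ ⟨h, h1, h2⟩ ⟨k, h3, h4⟩
    exact ⟨k.comp h, by rw [← CanHom.comp_assoc, h3, h1], by rw [CanHom.comp_assoc, h2, h4]⟩
  rcases h₁ with h₁ | h₁ <;> rcases h₂ with h₂ | h₂
  · exact Or.inl (key3 h₁ h₂)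
  · exact (le_total (gr e₃.1.1) (gr e₁.1.1)).elim (fun h => Or.inr (key1 h₁ h₂ h))
      fun h => Or.inl (key1 h₂ h₁ h)
  · exact (le_total (gr e₃.1.1) (gr e₁.1.1)).elim (fun h => Or.inr (key2 h₁ h₂ h))
      fun h => Or.inl (key2 h₂ h₁ h)
  · exact Or.inr (key3 h₂ h₁)

/-- A factorization of a morphism in `∂ᵢ` is equivalent to one through an object of grading
`|a| + i`. -/
theorem exists_rel_of_mem_face (D : GluingData W F₂ Ψ) (hUF : LowerUnique W F₂ Ψ b a)
    (e : Factorization W F₂ Ψ b a) {i : ℕ} (h1 : 1 ≤ i) (h2 : gr a + i < gr b)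
    (he : e.total ∈ canFace W F₂ Ψ b a i) :
    ∃ e' : Factorization W F₂ Ψ b a, Rel e e' ∧ gr e'.1.1 = gr a + i := by
  obtain ⟨⟨z, hz⟩, f, g⟩ := e
  obtain ⟨m, hm⟩ := Int.le.dest hz.1.le
  have he' : CategoryStruct.comp (obj := Can W F₂ Ψ) f g ∈ canFace W F₂ Ψ b a i := he
  rcases lt_trichotomy i m with hi | rfl | hi
  · rw [D.isFaceCategory.comp_lt f g m (by omega) hm.symm hz.2 i hi] at he'
    obtain ⟨w, g₁, g₂, hw, hg⟩ := (hUF z a (by omega)).exists_comp h1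
      (show gr a + i < gr z by omega) he'
    change gr w = gr a + i at hw
    exact ⟨⟨⟨w, by omega⟩, CanHom.comp f g₁, g₂⟩, Or.inr ⟨g₁, rfl, hg⟩, hw⟩
  · exact ⟨⟨⟨z, hz⟩, f, g⟩, Or.inl (Refines.refl _), hm.symm⟩
  · rw [D.isFaceCategory.comp_gt f g m (by omega) hm.symm hz.2 i hi] at he'
    obtain ⟨w, f₁, f₂, hw, hf⟩ := (hUF b z (by omega)).exists_comp (i := i - m) (by omega)
      (show gr z + (i - m : ℕ) < gr b by omega) he'
    change gr w = gr z + (i - m : ℕ) at hw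
    exact ⟨⟨⟨w, by omega⟩, f₁, CanHom.comp f₂ g⟩, Or.inl ⟨f₂, hf, rfl⟩,
      show gr w = gr a + i by omega⟩

theorem isEdge_total (D : GluingData W F₂ Ψ) (e : Factorization W F₂ Ψ b a) :
    F₂.IsEdge e.total.pt := by
  have hz := e.1.2
  have h1 := D.gr_obj e.1.1
  have h2 := D.gr_obj a
  have h3 := D.gr_obj b
  exact F₂.isEdge_comp e.2.1.pt e.2.2.pt (by omega) (by omega)

theorem total_mem_bdry (D : GluingData W F₂ Ψ) (e : Factorization W F₂ Ψ b a) :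
    e.total.pt ∈ bdry (mdim gr₂ (Ψ.obj b) (Ψ.obj a)) (F₂.Mod (Ψ.obj b) (Ψ.obj a)) :=
  (F₂.mem_bdry_iff _).2 (e.isEdge_total D)

/-- A factorization is determined by its type and by the image of its composition in `C₂`. -/
theorem eq_of_pt_eq (D : GluingData W F₂ Ψ) {e e' : Factorization W F₂ Ψ b a}
    (h : e.total.pt = e'.total.pt) (ht : e.type = e'.type) : e = e' := by
  obtain ⟨⟨z, hz⟩, f, g⟩ := e
  obtain ⟨⟨z', hz'⟩, f', g'⟩ := e'
  obtain ⟨h1, h2⟩ := Sigma.mk.inj ht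
  obtain rfl : z = z' := congrArg Subtype.val h1
  obtain ⟨h3, h4⟩ := Prod.mk.inj (eq_of_heq h2)
  have hz₂ := D.gr_obj z
  have ha₂ := D.gr_obj a
  have hb₂ := D.gr_obj b
  have h5 := F₂.injective_comp (x := Ψ.obj b) (z := Ψ.obj z) (y := Ψ.obj a) (by omega) (by omega)
    (a₁ := (g.pt, f.pt)) (a₂ := (g'.pt, f'.pt)) h
  obtain ⟨h6, h7⟩ := Prod.mk.inj h5
  obtain rfl : f = f' := CanHom.ext h3 h7
  obtain rfl : g = g' := CanHom.ext h4 h6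
  rfl

/-- The points which lie in the piece `t`. -/
def piece (F₂ : FlowStructure C₂ gr₂) (Ψ : C ⥤ C₂) (t : FactorizationType W b a) :
    Set (Ψ.obj b ⟶ Ψ.obj a) :=
  {x | ∃ e : Factorization W F₂ Ψ b a, e.type = t ∧ e.total.pt = x}

/-- The points along which the pieces `t` and `t'` are glued. -/
def overlap (F₂ : FlowStructure C₂ gr₂) (Ψ : C ⥤ C₂) (t t' : FactorizationType W b a) :
    Set (Ψ.obj b ⟶ Ψ.obj a) :=
  {x | ∃ e e' : Factorization W F₂ Ψ b a, Rel e e' ∧ e.type = t ∧ e'.type = t' ∧ e.total.pt = x}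

theorem piece_eq (t : FactorizationType W b a) : piece F₂ Ψ t = {x | ∃ u v,
    u ∈ carrier F₂ Ψ t.2.1 ∧ v ∈ carrier F₂ Ψ t.2.2 ∧ u ≫ v = x} := by
  ext x
  constructor
  · rintro ⟨e, rfl, rfl⟩
    exact ⟨e.2.1.pt, e.2.2.pt, e.2.1.pt_mem, e.2.2.pt_mem, rfl⟩
  · rintro ⟨u, v, hu, hv, rfl⟩
    exact ⟨⟨t.1, ⟨t.2.1, u, hu⟩, ⟨t.2.2, v, hv⟩⟩, rfl, rfl⟩

theorem isClosed_piece (t : FactorizationType W b a) :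
    IsClosed (X := F₂.Mod (Ψ.obj b) (Ψ.obj a)) (piece F₂ Ψ t) := by
  rw [piece_eq]
  exact F₂.isClosed_comp (isClopen_carrier t.2.1).1 (isClopen_carrier t.2.2).1

/-- The classes of morphisms along which the pieces `t` and `t'` are glued, for
`|z| ≤ |z'|`. -/
def gluing (F₂ : FlowStructure C₂ gr₂) (Ψ : C ⥤ C₂) (t t' : FactorizationType W b a) :
    Set (Ψ.obj t'.1.1 ⟶ Ψ.obj t.1.1) :=
  {w | ∃ l : Pi0 W t'.1.1 t.1.1, w ∈ carrier F₂ Ψ l ∧ t'.2.1.comp W l = t.2.1 ∧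
    l.comp W t.2.2 = t'.2.2}

theorem refines_iff (t t' : FactorizationType W b a) (x : Ψ.obj b ⟶ Ψ.obj a) :
    (∃ e e' : Factorization W F₂ Ψ b a, Refines e e' ∧ e.type = t ∧ e'.type = t' ∧ e.total.pt = x) ↔
      ∃ u y, u ∈ carrier F₂ Ψ t'.2.1 ∧ (∃ w v, w ∈ gluing F₂ Ψ t t' ∧ v ∈ carrier F₂ Ψ t.2.2 ∧
        w ≫ v = y) ∧ u ≫ y = x := by
  constructor
  · rintro ⟨e, e', h, rfl, rfl, rfl⟩
    rw [h.total_eq]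
    obtain ⟨h, h1, h2⟩ := h
    refine ⟨e'.2.1.pt, e'.2.2.pt, e'.2.1.pt_mem, ⟨h.pt, e.2.2.pt, ⟨h.cls, h.pt_mem, ?_, ?_⟩,
      e.2.2.pt_mem, congrArg CanHom.pt h2⟩, rfl⟩
    · exact congrArg CanHom.cls h1
    · exact congrArg CanHom.cls h2
  · obtain ⟨z, κ, μ⟩ := t
    obtain ⟨z', κ', μ'⟩ := t'
    rintro ⟨u, _, hu, ⟨w, v, ⟨l, hw, h1, h2⟩, hv, rfl⟩, rfl⟩
    dsimp only at l hw h1 h2 hu hv w v u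
    subst h1 h2
    let f' : CanHom W F₂ Ψ b z'.1 := ⟨κ', u, hu⟩
    let h : CanHom W F₂ Ψ z'.1 z.1 := ⟨l, w, hw⟩
    let g : CanHom W F₂ Ψ z.1 a := ⟨μ, v, hv⟩
    exact ⟨⟨z, f'.comp h, g⟩, ⟨z', f', h.comp g⟩, ⟨h, rfl, rfl⟩, rfl, rfl, Category.assoc u w v⟩

theorem isClopen_gluing (t t' : FactorizationType W b a) :
    IsClopen (X := F₂.Mod (Ψ.obj t'.1.1) (Ψ.obj t.1.1)) (gluing F₂ Ψ t t') :=
  isClopen_of_connectedComponent_eq (X := F₂.Mod (Ψ.obj t'.1.1) (Ψ.obj t.1.1))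
    fun _ _ h ⟨l, ⟨f, h1, h2⟩, h3⟩ => ⟨l, ⟨f, h1, h2.trans h⟩, h3⟩

theorem isClosed_overlap (t t' : FactorizationType W b a) :
    IsClosed (X := F₂.Mod (Ψ.obj b) (Ψ.obj a)) (overlap F₂ Ψ t t') := by
  have h1 : ∀ t t' : FactorizationType W b a, IsClosed (X := F₂.Mod (Ψ.obj b) (Ψ.obj a))
      {x | ∃ e e' : Factorization W F₂ Ψ b a, Refines e e' ∧ e.type = t ∧ e'.type = t' ∧
        e.total.pt = x} := by
    intro t t'
    refine (congrArg (IsClosed (X := F₂.Mod (Ψ.obj b) (Ψ.obj a)))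
      (Set.ext fun x => refines_iff t t' x)).mpr ?_
    exact F₂.isClosed_comp (isClopen_carrier t'.2.1).1
      (F₂.isClosed_comp (isClopen_gluing t t').1 (isClopen_carrier t.2.2).1)
  refine (congrArg (IsClosed (X := F₂.Mod (Ψ.obj b) (Ψ.obj a))) (Set.ext fun x => ?_)).mpr
    ((h1 t t').union (h1 t' t))
  constructor
  · rintro ⟨e, e', h | h, h2, h3, h4⟩
    · exact Or.inl ⟨e, e', h, h2, h3, h4⟩
    · exact Or.inr ⟨e', e, h, h3, h2, by rw [h.total_eq, h4]⟩
  · rintro (⟨e, e', h, h2, h3, h4⟩ | ⟨e, e', h, h2, h3, h4⟩)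
    · exact ⟨e, e', Or.inl h, h2, h3, h4⟩
    · exact ⟨e', e, Or.inr h, h3, h2, by rw [← h.total_eq, h4]⟩

theorem overlap_comm (t t' : FactorizationType W b a) : overlap F₂ Ψ t t' = overlap F₂ Ψ t' t := by
  have : ∀ t t' : FactorizationType W b a, overlap F₂ Ψ t t' ⊆ overlap F₂ Ψ t' t := by
    rintro t t' x ⟨e, e', h, h1, h2, h3⟩
    exact ⟨e', e, h.symm, h2, h1, by rw [← h.total_eq, h3]⟩
  exact Subset.antisymm (this t t') (this t' t)

theorem isClosed_nonoverlap (D : GluingData W F₂ Ψ) (t t' : FactorizationType W b a) :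
    IsClosed (X := F₂.Mod (Ψ.obj b) (Ψ.obj a))
      ((piece F₂ Ψ t ∩ piece F₂ Ψ t') \ overlap F₂ Ψ t t') := by
  have hlt : ∀ t t' : FactorizationType W b a, gr t.1.1 < gr t'.1.1 →
      IsClosed (X := F₂.Mod (Ψ.obj b) (Ψ.obj a))
        ((piece F₂ Ψ t ∩ piece F₂ Ψ t') \ overlap F₂ Ψ t t') := by
    intro t t' hlt
    have hz := t.1.2
    have hz' := t'.1.2
    have e1 := D.gr_obj t.1.1
    have e2 := D.gr_obj t'.1.1
    have e3 := D.gr_obj a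
    have e4 := D.gr_obj b
    -- a common point of the pieces factors through `z'` and `z`, and the component of the middle
    -- factor decides if the pieces are glued there
    let A : Set (Ψ.obj t'.1.1 ⟶ Ψ.obj t.1.1) := {w | (∃ u v, u ∈ carrier F₂ Ψ t'.2.1 ∧
      v ∈ carrier F₂ Ψ t.2.2 ∧ u ≫ w ∈ carrier F₂ Ψ t.2.1 ∧ w ≫ v ∈ carrier F₂ Ψ t'.2.2) ∧
      w ∉ gluing F₂ Ψ t t'}
    have hA : IsClopen (X := F₂.Mod (Ψ.obj t'.1.1) (Ψ.obj t.1.1)) A := by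
      refine isClopen_of_connectedComponent_eq (X := F₂.Mod (Ψ.obj t'.1.1) (Ψ.obj t.1.1)) ?_
      rintro w w' h ⟨⟨u, v, hu, hv, ⟨f, h1, h2⟩, ⟨g, h3, h4⟩⟩, h5⟩
      refine ⟨⟨u, v, hu, hv, ⟨f, h1, h2.trans (F₂.component_comp rfl h)⟩,
        ⟨g, h3, h4.trans (F₂.component_comp h rfl)⟩⟩, fun ⟨l, ⟨k, h6, h7⟩, h8⟩ => h5 ?_⟩
      exact ⟨l, ⟨k, h6, h7.trans h.symm⟩, h8⟩
    convert F₂.isClosed_comp (isClopen_carrier t'.2.1).1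
      (F₂.isClosed_comp hA.1 (isClopen_carrier t.2.2).1) using 1
    ext x
    constructor
    · rintro ⟨⟨h1, h2⟩, h3⟩
      rw [piece_eq] at h1 h2
      obtain ⟨u, v, hu, hv, rfl⟩ := h1
      obtain ⟨u', v', hu', hv', hc⟩ := h2
      obtain ⟨w, h4, h5⟩ := F₂.isFaceCategory.exists_lift (F₂.uniqueFactorization _ _)
        (F₂.uniqueFactorization _ _) hc (by omega)
      refine ⟨u', v', hu', ⟨w, v, ⟨⟨u', v, hu', hv, by rwa [h4], by rwa [h5]⟩, fun hw => h3 ?_⟩,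
        hv, h5⟩, hc⟩
      obtain ⟨e, e', h6, h7⟩ := (refines_iff t t' (u ≫ v)).2 ⟨u', v', hu', ⟨w, v, hw, hv, h5⟩, hc⟩
      exact ⟨e, e', Or.inl h6, h7⟩
    · rintro ⟨u', _, hu', ⟨w, v, ⟨⟨u₁, v₁, hu₁, hv₁, h1, h2⟩, h3⟩, hv, rfl⟩, rfl⟩
      have h4 : u' ≫ w ∈ carrier F₂ Ψ t.2.1 := by
        obtain ⟨f, h5, h6⟩ := h1
        exact ⟨f, h5, h6.trans (F₂.component_comp (D.component_eq_of_mem_carrier hu₁ hu') rfl)⟩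
      have h5 : w ≫ v ∈ carrier F₂ Ψ t'.2.2 := by
        obtain ⟨f, h5, h6⟩ := h2
        exact ⟨f, h5, h6.trans (F₂.component_comp rfl (D.component_eq_of_mem_carrier hv₁ hv))⟩
      refine ⟨⟨?_, ?_⟩, ?_⟩
      · rw [piece_eq]; exact ⟨u' ≫ w, v, h4, hv, Category.assoc _ _ _⟩
      · rw [piece_eq]; exact ⟨u', w ≫ v, hu', h5, rfl⟩
      · rintro ⟨e, e', h6 | h6, h7, h8, h9⟩
        · obtain ⟨u₂, _, hu₂, ⟨w₂, v₂, hw₂, hv₂, rfl⟩, hc⟩ :=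
            (refines_iff t t' _).1 ⟨e, e', h6, h7, h8, h9⟩
          have h10 := F₂.injective_comp (by omega) (by omega)
            (a₁ := (w₂ ≫ v₂, u₂)) (a₂ := (w ≫ v, u')) hc
          have h11 := F₂.injective_comp (by omega) (by omega)
            (a₁ := (v₂, w₂)) (a₂ := (v, w)) (Prod.mk.inj h10).1
          exact h3 ((Prod.mk.inj h11).2 ▸ hw₂)
        · have := h6.gr_le D
          subst h7 h8
          exact absurd this (not_le.2 hlt)
  rcases lt_trichotomy (gr t.1.1) (gr t'.1.1) with h | h | h
  · exact hlt t t' h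
  · by_cases htt : t = t'
    · subst htt
      refine (congrArg (IsClosed (X := F₂.Mod (Ψ.obj b) (Ψ.obj a)))
        (eq_empty_of_forall_notMem ?_)).mpr isClosed_empty
      rintro x ⟨⟨⟨e, h1, h2⟩, -⟩, h3⟩
      exact h3 ⟨e, e, Or.inl (Refines.refl e), h1, h1, h2⟩
    · have hdisj : ∀ x, x ∉ overlap F₂ Ψ t t' := by
        rintro x ⟨e, e', h1, rfl, rfl, -⟩
        exact htt (by rw [h1.eq_of_gr_eq D h])
      refine (congrArg (IsClosed (X := F₂.Mod (Ψ.obj b) (Ψ.obj a)))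
        (Set.ext fun x => (⟨fun hx => hx.1, fun hx => ⟨hx, hdisj x⟩⟩ : _ ↔ x ∈ _ ∩ _))).mpr
        ((isClosed_piece (F₂ := F₂) (Ψ := Ψ) t).inter (isClosed_piece t'))
  · refine (congrArg (IsClosed (X := F₂.Mod (Ψ.obj b) (Ψ.obj a))) ?_).mpr (hlt t' t h)
    exact congrArg₂ (· \ ·) (inter_comm _ _) (overlap_comm t t')

/-- Near a factorized morphism, the boundary points of the moduli space of `C₂` are covered by the
pieces of the equivalent factorizations. -/
theorem eventually_exists (D : GluingData W F₂ Ψ) (hUF : LowerUnique W F₂ Ψ b a)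
    (e : Factorization W F₂ Ψ b a) : ∀ᶠ x : F₂.Mod (Ψ.obj b) (Ψ.obj a) in 𝓝 e.total.pt, F₂.IsEdge x →
      ∃ e' e'' : Factorization W F₂ Ψ b a, Rel e e' ∧ e''.type = e'.type ∧ e''.total.pt = x := by
  have := F₂.finite
  filter_upwards [F₂.eventually_exists_comp e.total.pt] with x hx hedge
  have e1 := D.gr_obj b
  have e2 := D.gr_obj a
  obtain ⟨i, h1, h2, hi⟩ := (F₂.isEdge_iff x).1 hedge
  obtain ⟨h3, ζ, u, u', v, v', hζ, huv, huv', hu, hv⟩ := hx i h1 h2 hi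
  obtain ⟨e', he', hgr⟩ := e.exists_rel_of_mem_face D hUF h1 (by omega) h3
  have hz := D.gr_obj e'.1.1
  have h4 : e'.2.1.pt ≫ e'.2.2.pt = u ≫ v := by
    rw [huv, he'.total_eq]
    rfl
  have h5 := F₂.isFaceCategory.sigma_eq (F₂.uniqueFactorization _ _) h4 (by omega) (by omega)
    (by omega)
  obtain ⟨rfl, h6⟩ := Sigma.mk.inj h5
  obtain ⟨rfl, rfl⟩ := Prod.mk.inj (eq_of_heq h6)
  obtain ⟨f₀, h7, h8⟩ := e'.2.1.exists_rep
  obtain ⟨g₀, h9, h10⟩ := e'.2.2.exists_rep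
  exact ⟨e', ⟨e'.1, ⟨e'.2.1.cls, u', f₀, h7, h8.trans hu.symm⟩,
    ⟨e'.2.2.cls, v', g₀, h9, h10.trans hv.symm⟩⟩, he', rfl, huv'⟩

/-- The boundary of the moduli space of `C₁` from `b` to `a` that the factorizations determine, with
its projection to the boundary of the moduli space of `C₂`. -/
def patching (D : GluingData W F₂ Ψ) (hUF : LowerUnique W F₂ Ψ b a) :
    Patching (Factorization W F₂ Ψ b a)
      (bdry (mdim gr₂ (Ψ.obj b) (Ψ.obj a)) (F₂.Mod (Ψ.obj b) (Ψ.obj a)))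
      (FactorizationType W b a) where
  p e := ⟨e.total.pt, e.total_mem_bdry D⟩
  τ := type
  rel := ⟨Rel, fun e => Or.inl (Refines.refl e), Rel.symm, Rel.trans D hUF⟩
  p_eq h := Subtype.ext (congrArg CanHom.pt h.total_eq)
  inj h ht := eq_of_pt_eq D (congrArg Subtype.val h) ht
  isClosed_piece t := by
    convert (isClosed_piece (F₂ := F₂) (Ψ := Ψ) t).preimage continuous_subtype_val using 1
    ext x
    exact exists_congr fun e => and_congr_right fun _ => Subtype.ext_iff
  isClosed_overlap t t' := by
    convert (isClosed_overlap (F₂ := F₂) (Ψ := Ψ) t t').preimage continuous_subtype_val using 1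
    ext x
    exact exists_congr fun e => exists_congr fun e' => and_congr_right fun _ =>
      and_congr_right fun _ => and_congr_right fun _ => Subtype.ext_iff
  isClosed_nonoverlap t t' := by
    convert (isClosed_nonoverlap D t t').preimage continuous_subtype_val using 1
    ext x
    refine and_congr (and_congr ?_ ?_) (not_congr ?_)
    · exact exists_congr fun e => and_congr_right fun _ => Subtype.ext_iff
    · exact exists_congr fun e => and_congr_right fun _ => Subtype.ext_iff
    · exact exists_congr fun e => exists_congr fun e' => and_congr_right fun _ =>
        and_congr_right fun _ => and_congr_right fun _ => Subtype.ext_iff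
  eventually_mem e := by
    have h := eventually_exists D hUF e
    have h' : ContinuousAt Subtype.val (⟨e.total.pt, e.total_mem_bdry D⟩ :
        bdry (mdim gr₂ (Ψ.obj b) (Ψ.obj a)) (F₂.Mod (Ψ.obj b) (Ψ.obj a))) :=
      continuous_subtype_val.continuousAt
    filter_upwards [h'.eventually h] with x hx
    have hedge : F₂.IsEdge x.1 := (F₂.mem_bdry_iff x.1).1 x.2
    obtain ⟨e', e'', h1, h2, h3⟩ := hx hedge
    exact ⟨e', e'', h1, h2, Subtype.ext h3⟩

theorem finite_type [Finite C] (D : GluingData W F₂ Ψ) : Finite (FactorizationType W b a) := by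
  have h1 : ∀ z w : C, Finite (Pi0 W z w) := fun z w => finite_pi0 D.glued z w
  unfold FactorizationType
  infer_instance

end Factorization

end Factorizations

end FlowCat

/-! ### Broken morphisms as glued boundary -/

/-- A map to the glued space that lifts to the pieces is continuous if the lift stays locally in one
piece and its projection is continuous. -/
theorem Patching.continuous_cls_comp {B S T Z : Type*} [TopologicalSpace S] [TopologicalSpace Z]
    (P : Patching B S T) {g : Z → B} (hp : Continuous fun z => P.p (g z))
    (hτ : ∀ z, ∀ᶠ z' in 𝓝 z, P.τ (g z') = P.τ (g z)) : Continuous fun z => P.cls (g z) := by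
  refine P.continuous_iff.2 ⟨hp, fun t => ?_⟩
  -- in the piece `t₀`, belonging to the piece `t` means lying over the overlap of `t₀` and `t`
  refine isOpen_compl_iff.1 (isOpen_iff_mem_nhds.2 fun z hz => ?_)
  have hiff : ∀ z', P.τ (g z') = P.τ (g z) → (P.Mem (P.cls (g z')) t ↔
      P.p (g z') ∈ {x | ∃ e e', P.rel e e' ∧ P.τ e = P.τ (g z) ∧ P.τ e' = t ∧ P.p e = x}) := by
    intro z' hz'
    constructor
    · rintro ⟨e, he, h⟩
      exact ⟨g z', e, P.cls_eq_cls.1 he.symm, hz', h, rfl⟩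
    · rintro ⟨e, e', h1, h2, h3, h4⟩
      obtain rfl := P.inj h4 (h2.trans hz'.symm)
      exact ⟨e', (P.cls_eq_cls.2 h1).symm, h3⟩
  have hz2 : P.p (g z) ∉ {x | ∃ e e', P.rel e e' ∧ P.τ e = P.τ (g z) ∧ P.τ e' = t ∧ P.p e = x} :=
    fun h => hz ((hiff z rfl).2 h)
  filter_upwards [hτ z, hp.continuousAt.preimage_mem_nhds
    ((P.isClosed_overlap _ _).isOpen_compl.mem_nhds hz2)] with z' h1 h2 h3
  exact h2 ((hiff z' h1).1 h3)

/-- A covering space of a Hausdorff space is Hausdorff. -/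
theorem IsCoveringMap.t2Space {E S : Type*} [TopologicalSpace E] [TopologicalSpace S] [T2Space S]
    {p : E → S} (hp : IsCoveringMap p) : T2Space E where
  t2 x y hxy := by
    by_cases h : p x = p y
    · exact hp.isSeparatedMap x y h hxy
    · obtain ⟨U, V, hU, hV, hx, hy, hUV⟩ := t2_separation h
      exact ⟨p ⁻¹' U, p ⁻¹' V, hU.preimage hp.continuous, hV.preimage hp.continuous, hx, hy,
        hUV.preimage p⟩

namespace FlowCat

section Broken

variable {C : Type u} [Category.{v} C] {gr : C → ℤ} {W : WindowFlows gr}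
  {C₂ : Type u₂} [Category.{v} C₂] {gr₂ : C₂ → ℤ} {F₂ : FlowStructure C₂ gr₂} {Ψ : C ⥤ C₂}

namespace Factorization

variable {b a : C}

/-- A factorization in `C`, as a factorization in `C₁`. -/
def of {z : C} (h1 : gr a < gr z) (h2 : gr z < gr b) (u : b ⟶ z) (v : z ⟶ a) :
    Factorization W F₂ Ψ b a := ⟨⟨z, h1, h2⟩, CanHom.of u, CanHom.of v⟩

/-- All factorizations of a morphism of `C` give the same point of the glued boundary. -/
theorem exists_map_total (D : GluingData W F₂ Ψ) (hUF : LowerUnique W F₂ Ψ b a)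
    (h3 : gr a + 3 ≤ gr b) : ∃ φ : (b ⟶ a) → (patching D hUF).Total,
      ∀ (z : C) (h1 : gr a < gr z) (h2 : gr z < gr b) (u : b ⟶ z) (v : z ⟶ a),
        φ (u ≫ v) = (patching D hUF).cls (of h1 h2 u v) := by
  choose z u v h1 h2 hc using fun f : b ⟶ a => exists_comp_of_three_le W D.glued f h3
  refine ⟨fun f => (patching D hUF).cls (of (h1 f) (h2 f) (u f) (v f)), fun z' h1' h2' u' v' => ?_⟩
  refine apply_eq_of_comp_eq W D.glued h3
    (fun z h1 h2 u v => (patching D hUF).cls (of h1 h2 u v)) ?_ _ _ _ _ (hc _)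
  intro z z' h1 h2 h1' h2' u k v
  refine ((patching D hUF).cls_eq_cls).2 (Or.inr ⟨CanHom.of k, ?_, ?_⟩)
  · exact (CanHom.of_comp W F₂ Ψ u k).symm
  · exact (CanHom.of_comp W F₂ Ψ k v).symm

theorem lowerUnique_of_three (D : GluingData W F₂ Ψ) (h : gr b ≤ gr a + 3) :
    LowerUnique W F₂ Ψ b a :=
  fun _ _ h' => D.uniqueFactorization_of_le_two (by omega)

/-- In degree three, factorizations that are equivalent in `C₁` have the same composition already in
`C`: the refining morphism has degree at most two, so it belongs to a window. -/
theorem rel_of_of_three (D : GluingData W F₂ Ψ) (h3 : gr b = gr a + 3) {z z' : C}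
    {h1 : gr a < gr z} {h2 : gr z < gr b} {h1' : gr a < gr z'} {h2' : gr z' < gr b}
    {u : b ⟶ z} {v : z ⟶ a} {u' : b ⟶ z'} {v' : z' ⟶ a}
    (h : Rel (of h1 h2 u v : Factorization W F₂ Ψ b a) (of h1' h2' u' v')) :
    u ≫ v = u' ≫ v' := by
  have key : ∀ {z z' : C} {h1 : gr a < gr z} {h2 : gr z < gr b} {h1' : gr a < gr z'}
      {h2' : gr z' < gr b} {u : b ⟶ z} {v : z ⟶ a} {u' : b ⟶ z'} {v' : z' ⟶ a},
      Refines (of h1 h2 u v : Factorization W F₂ Ψ b a) (of h1' h2' u' v') →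
      u ≫ v = u' ≫ v' := by
    rintro z z' h1 h2 h1' h2' u v u' v' ⟨k, h4, h5⟩
    obtain ⟨k, rfl⟩ := (D.of_bijective (show gr z' ≤ gr z + 2 by omega)).2 k
    have h6 : u' ≫ k = u := (D.of_bijective (show gr b ≤ gr z + 2 by omega)).1
      ((CanHom.of_comp W F₂ Ψ u' k).trans h4)
    have h7 : k ≫ v = v' := (D.of_bijective (show gr z' ≤ gr a + 2 by omega)).1
      ((CanHom.of_comp W F₂ Ψ k v).trans h5)
    rw [← h6, ← h7, Category.assoc]
  exact h.elim key fun h => (key h).symm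

end Factorization

open Factorization

theorem continuous_glueMap (W : WindowFlows gr) (b a : C) (h : gr b = gr a + 3)
    (c : {c : C // gr a < gr c ∧ gr c < gr b}) : Continuous (glueMap W b a h c) :=
  continuous_iff_coinduced_le.2 (le_iSup (fun c => TopologicalSpace.coinduced (glueMap W b a h c)
    inferInstance) c)

theorem exists_mem_range_glueMap (hC : IsGluedFromWindows gr) {b a : C} (h : gr b = gr a + 3)
    (f : BrokenHom W b a h) : ∃ c, f ∈ range (glueMap W b a h c) := by
  obtain ⟨z, u, v, h1, h2, rfl⟩ := exists_comp_of_three_le W hC (b := b) (a := a) f h.ge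
  exact ⟨⟨z, h1, h2⟩, (ObjectProperty.homMk v, ObjectProperty.homMk u), rfl⟩

theorem compactSpace_brokenHom [Finite C] (hC : IsGluedFromWindows gr) {b a : C} (h : gr b = gr a + 3) :
    CompactSpace (BrokenHom W b a h) := by
  have h1 : (univ : Set (BrokenHom W b a h)) = ⋃ c, range (glueMap W b a h c) := by
    refine (eq_univ_of_forall fun f => ?_).symm
    exact mem_iUnion.2 (exists_mem_range_glueMap hC h f)
  exact ⟨h1 ▸ isCompact_iUnion fun c => isCompact_range (continuous_glueMap W b a h c)⟩

/-- In the smallest case, the glued boundary is the space of broken morphisms. -/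
theorem GluingData.exists_homeomorph_total [Finite C] (D : GluingData W F₂ Ψ) {b a : C}
    (h : gr b = gr a + 3) : ∃ φ : BrokenHom W b a h ≃ₜ
    (patching D (lowerUnique_of_three D h.le)).Total,
      ∀ (z : C) (h1 : gr a < gr z) (h2 : gr z < gr b) (u : b ⟶ z) (v : z ⟶ a),
        φ (u ≫ v) = (patching D (lowerUnique_of_three D h.le)).cls (of h1 h2 u v) := by
  let P := patching D (lowerUnique_of_three D h.le)
  obtain ⟨φ, hφ⟩ : ∃ φ : (b ⟶ a) → P.Total, ∀ (z : C) (h1 : gr a < gr z) (h2 : gr z < gr b)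
      (u : b ⟶ z) (v : z ⟶ a), φ (u ≫ v) = P.cls (of h1 h2 u v) :=
    exists_map_total D (lowerUnique_of_three D h.le) h.ge
  have hb : Function.Bijective φ := by
    constructor
    · intro f f' hff
      obtain ⟨z, u, v, h1, h2, rfl⟩ := exists_comp_of_three_le W D.glued f h.ge
      obtain ⟨z', u', v', h1', h2', rfl⟩ := exists_comp_of_three_le W D.glued f' h.ge
      rw [hφ z h1 h2, hφ z' h1' h2'] at hff
      exact rel_of_of_three D h (P.cls_eq_cls.1 hff)
    · intro q
      obtain ⟨⟨⟨z, h1, h2⟩, f, g⟩, rfl⟩ := P.surjective_cls q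
      obtain ⟨u, rfl⟩ := (D.of_bijective (show gr b ≤ gr z + 2 by omega)).2 f
      obtain ⟨v, rfl⟩ := (D.of_bijective (show gr z ≤ gr a + 2 by omega)).2 g
      exact ⟨u ≫ v, hφ z h1 h2 u v⟩
  let φ' : BrokenHom W b a h → P.Total := φ
  have hc : Continuous φ' := by
    refine continuous_iSup_dom.2 fun c => continuous_coinduced_dom.2 ?_
    obtain ⟨c, h1, h2⟩ := c
    have hcb : InWindow gr (gr a + 1) b := by constructor <;> omega
    have hcc : InWindow gr (gr a + 1) c := by constructor <;> omega
    have hcc' : InWindow gr (gr a) c := by constructor <;> omega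
    have hca : InWindow gr (gr a) a := by constructor <;> omega
    have heq : φ' ∘ glueMap W b a h ⟨c, h1, h2⟩ = fun pq : (W (gr a)).Mod ⟨c, hcc'⟩ ⟨a, hca⟩ ×
        (W (gr a + 1)).Mod ⟨b, hcb⟩ ⟨c, hcc⟩ =>
          P.cls (of h1 h2 (InducedCategory.Hom.hom pq.2) (InducedCategory.Hom.hom pq.1)) :=
      funext fun pq => hφ c h1 h2 _ _
    rw [heq]
    refine P.continuous_cls_comp ?_ ?_
    · refine Continuous.subtype_mk ?_ _
      exact (F₂.continuous_comp (Ψ.obj b) (Ψ.obj c) (Ψ.obj a)).comp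
        ((((D.flowMorphism (gr a)).isLocalHomeomorph ⟨c, hcc'⟩ ⟨a, hca⟩).continuous.comp
          continuous_fst).prodMk (((D.flowMorphism (gr a + 1)).isLocalHomeomorph ⟨b, hcb⟩
          ⟨c, hcc⟩).continuous.comp continuous_snd))
    · rintro ⟨p, q⟩
      have hp := (isOpen_setOf_connectedComponent_eq p).preimage
        (continuous_fst (X := (W (gr a)).Mod ⟨c, hcc'⟩ ⟨a, hca⟩)
          (Y := (W (gr a + 1)).Mod ⟨b, hcb⟩ ⟨c, hcc⟩))
      have hq := (isOpen_setOf_connectedComponent_eq q).preimage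
        (continuous_snd (X := (W (gr a)).Mod ⟨c, hcc'⟩ ⟨a, hca⟩)
          (Y := (W (gr a + 1)).Mod ⟨b, hcb⟩ ⟨c, hcc⟩))
      filter_upwards [hp.mem_nhds (mem_preimage.2 rfl), hq.mem_nhds (mem_preimage.2 rfl)] with pq h4 h5
      have h6 : pi0 W (InducedCategory.Hom.hom pq.1) = pi0 W (InducedCategory.Hom.hom p) :=
        pi0_eq_of_component_windowHom_eq hcc' hca h4
      have h7 : pi0 W (InducedCategory.Hom.hom pq.2) = pi0 W (InducedCategory.Hom.hom q) :=
        pi0_eq_of_component_windowHom_eq hcb hcc h5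
      exact congrArg₂ (fun κ μ => (⟨⟨c, h1, h2⟩, κ, μ⟩ : FactorizationType W b a)) h7 h6
  have := finite_type (b := b) (a := a) D
  have := compactSpace_brokenHom (W := W) D.glued h
  have hT2 : T2Space P.Total := P.isCoveringMap.t2Space
  exact ⟨hc.homeoOfEquivCompactToT2 (f := Equiv.ofBijective φ' hb), hφ⟩

end Broken

end FlowCat

/-! ### Unique factorization in `C₁` -/

namespace FlowCat

/-- The boundary of a disc in a moduli space is a sphere, and open in the boundary of the moduli
space. -/
theorem FlowStructure.exists_isOpenEmbedding_sphere {C : Type u} [Category.{v} C] {gr : C → ℤ}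
    (F : FlowStructure C gr) (hF : F.IsDisc) {x y : C} (f : x ⟶ y) :
    ∃ θ : Metric.sphere (0 : EuclideanSpace ℝ (Fin (mdim gr x y))) 1 →
      bdry (mdim gr x y) (F.Mod x y), Topology.IsOpenEmbedding θ ∧
      range θ = {s | F.component s.1 = F.component f} := by
  obtain ⟨θ, hθ, hr⟩ := exists_isEmbedding_sphere (X := F.Mod x y) f (hF x y f).some
  have hmem : ∀ q, θ q ∈ bdry (mdim gr x y) (F.Mod x y) := fun q => by
    have h1 : θ q ∈ connectedComponent (α := F.Mod x y) f ∩ {y | IsEdgePoint y} :=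
      hr ▸ mem_range_self q
    exact (F.mem_bdry_iff _).2 h1.2
  have hrange : range (Set.codRestrict θ _ hmem) = {s | F.component s.1 = F.component f} := by
    ext s
    have h1 := Set.ext_iff.1 hr s.1
    constructor
    · rintro ⟨q, rfl⟩
      exact F.component_eq_iff.2 (h1.1 ⟨q, rfl⟩).1
    · intro hs
      obtain ⟨q, hq⟩ := h1.2 ⟨F.component_eq_iff.1 hs, (F.mem_bdry_iff _).1 s.2⟩
      exact ⟨q, Subtype.ext hq⟩
  refine ⟨_, ⟨hθ.codRestrict _ hmem, ?_⟩, hrange⟩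
  rw [hrange]
  exact (isOpen_setOf_connectedComponent_eq (X := F.Mod x y) f).preimage continuous_subtype_val

theorem nonempty_circle_homeomorph_sphere {n : ℕ} (hn : n = 2) :
    Nonempty (Circle ≃ₜ Metric.sphere (0 : EuclideanSpace ℝ (Fin n)) 1) := by
  subst hn
  let L : ℂ ≃ₗᵢ[ℝ] EuclideanSpace ℝ (Fin 2) := Complex.orthonormalBasisOneI.repr
  let φ : Circle ≃ Metric.sphere (0 : EuclideanSpace ℝ (Fin 2)) 1 :=
    { toFun := fun z => ⟨L z, by simp [Circle.norm_coe z]⟩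
      invFun := fun q => ⟨L.symm q, by simp [Submonoid.unitSphere]⟩
      left_inv := fun z => by ext; simp
      right_inv := fun q => by ext; simp }
  have hφ : Continuous φ := Continuous.subtype_mk (L.continuous.comp (by fun_prop)) _
  exact ⟨hφ.homeoOfEquivCompactToT2⟩

section Broken

variable {C : Type u} [Category.{v} C] {gr : C → ℤ} {W : WindowFlows gr}
  {C₂ : Type u₂} [Category.{v} C₂] {gr₂ : C₂ → ℤ} {F₂ : FlowStructure C₂ gr₂} {Ψ : C ⥤ C₂}

open Factorization

/-- The space of broken morphisms is a finite disjoint union of circles, and covers the boundary of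
the moduli space of `C₂`. -/
theorem GluingData.broken [Finite C] (D : GluingData W F₂ Ψ) {b a : C} (h : gr b = gr a + 3) :
    ((∀ f : BrokenHom W b a h, ∃ c, f ∈ range (glueMap W b a h c)) ∧
      (∀ c, Function.Injective (glueMap W b a h c)) ∧
      ∃ k : ℕ, Nonempty (BrokenHom W b a h ≃ₜ Fin k × Circle)) ∧
    ∃ hb : ∀ f, brokenMap W F₂ Ψ b a h f ∈
        bdry (mdim gr₂ (Ψ.obj b) (Ψ.obj a)) (F₂.Mod (Ψ.obj b) (Ψ.obj a)),
      IsCoveringMap (Set.codRestrict (brokenMap W F₂ Ψ b a h) _ hb) := by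
  obtain ⟨φ, hφ⟩ := D.exists_homeomorph_total h
  have hproj : ∀ f, brokenMap W F₂ Ψ b a h f =
      ((patching D (lowerUnique_of_three D h.le)).proj (φ f)).1 := by
    intro f
    obtain ⟨z, u, v, h1, h2, rfl⟩ := exists_comp_of_three_le W D.glued (b := b) (a := a) f h.ge
    exact (Ψ.map_comp u v).trans
      (congrArg (fun q => ((patching D (lowerUnique_of_three D h.le)).proj q).1)
        (hφ z h1 h2 u v)).symm
  have hb : ∀ f, brokenMap W F₂ Ψ b a h f ∈
      bdry (mdim gr₂ (Ψ.obj b) (Ψ.obj a)) (F₂.Mod (Ψ.obj b) (Ψ.obj a)) := fun f =>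
    hproj f ▸ Subtype.property _
  have := finite_type (b := b) (a := a) D
  have hcov : IsCoveringMap (Set.codRestrict (brokenMap W F₂ Ψ b a h) _ hb) := by
    have h1 : Set.codRestrict (brokenMap W F₂ Ψ b a h) _ hb =
        (patching D (lowerUnique_of_three D h.le)).proj ∘ φ := funext fun f => Subtype.ext (hproj f)
    rw [h1]
    exact (Patching.isCoveringMap _).comp_homeomorph φ
  refine ⟨⟨exists_mem_range_glueMap D.glued h, ?_, ?_⟩, hb, hcov⟩
  · rintro ⟨c, h1, h2⟩ ⟨p, q⟩ ⟨p', q'⟩ heq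
    have h3 := (hφ c h1 h2 (InducedCategory.Hom.hom q) (InducedCategory.Hom.hom p)).symm.trans
      ((congrArg φ heq).trans (hφ c h1 h2 (InducedCategory.Hom.hom q') (InducedCategory.Hom.hom p')))
    have h4 := Rel.eq_of_gr_eq D ((Patching.cls_eq_cls _).1 h3) rfl
    obtain ⟨h5, h6⟩ := Prod.mk.inj (eq_of_heq (Sigma.mk.inj h4).2)
    have h7 := (D.of_bijective (show gr b ≤ gr c + 2 by omega)).1 h5
    have h8 := (D.of_bijective (show gr c ≤ gr a + 2 by omega)).1 h6
    exact Prod.ext (InducedCategory.Hom.ext h8) (InducedCategory.Hom.ext h7)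
  · have := compactSpace_brokenHom (W := W) D.glued h
    have := hcov.t2Space
    refine hcov.exists_homeomorph_circles fun f => ?_
    obtain ⟨θ, hθ, hr⟩ := F₂.exists_isOpenEmbedding_sphere D.isDisc (brokenMap W F₂ Ψ b a h f)
    have hdim : mdim gr₂ (Ψ.obj b) (Ψ.obj a) = 2 := by
      have h1 := D.gr_obj b
      have h2 := D.gr_obj a
      unfold mdim
      omega
    obtain ⟨κ⟩ := nonempty_circle_homeomorph_sphere hdim
    refine ⟨θ ∘ κ, hθ.comp κ.isOpenEmbedding, ?_⟩
    rw [EquivLike.range_comp, hr]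
    rfl

/-- The hypothesis that the components of the spaces of broken morphisms are trivial coverings of
their images. -/
def TrivialCoverings (W : WindowFlows gr) (F₂ : FlowStructure C₂ gr₂) (Ψ : C ⥤ C₂) : Prop :=
  ∀ (b a : C) (h : gr b = gr a + 3) (f : BrokenHom W b a h),
    IsTrivialCovering (Set.imageFactorization (brokenMap W F₂ Ψ b a h) (connectedComponent f))

namespace Factorization

variable {b a : C}

/-- The morphism with a given class of factorizations. -/
def totalClass (D : GluingData W F₂ Ψ) (hUF : LowerUnique W F₂ Ψ b a) :
    (patching D hUF).Total → CanHom W F₂ Ψ b a :=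
  Quotient.lift total fun _ _ h => Rel.total_eq h

/-- The class of the composition is constant on the components of the glued boundary. -/
theorem cls_eq_of_connectedComponent_eq [Finite C] (D : GluingData W F₂ Ψ)
    (hUF : LowerUnique W F₂ Ψ b a) {q q' : (patching D hUF).Total}
    (h : connectedComponent q = connectedComponent q') :
    (totalClass D hUF q).cls = (totalClass D hUF q').cls := by
  have hlc : IsLocallyConstant fun q => (totalClass D hUF q).cls := by
    refine (IsLocallyConstant.iff_eventually_eq _).2 fun q => ?_
    have := finite_type (b := b) (a := a) D
    filter_upwards [(patching D hUF).mem_nhds q] with q' hq'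
    obtain ⟨t, ht⟩ := (patching D hUF).exists_mem q'
    obtain ⟨e, rfl, he⟩ := hq' t ht
    obtain ⟨e', rfl, he'⟩ := ht
    have h1 : e.type = e'.type := he.trans he'.symm
    exact (congrArg (fun t : FactorizationType W b a => t.2.1.comp W t.2.2) h1).symm
  exact hlc.apply_eq_of_isPreconnected isPreconnected_connectedComponent
    (s := connectedComponent q') (h ▸ mem_connectedComponent) mem_connectedComponent

/-- The pieces of the glued boundary are connected. -/
theorem connectedComponent_eq_of_type_eq (D : GluingData W F₂ Ψ) (hUF : LowerUnique W F₂ Ψ b a)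
    {e e' : Factorization W F₂ Ψ b a} (h : e.type = e'.type) :
    connectedComponent ((patching D hUF).cls e) = connectedComponent ((patching D hUF).cls e') := by
  have hcar : ∀ {z w : C} (κ : Pi0 W z w), _root_.IsPreconnected (α := F₂.Mod (Ψ.obj z) (Ψ.obj w))
      (carrier F₂ Ψ κ) := by
    intro z w κ
    obtain ⟨f, rfl⟩ := pi0_surjective W z w κ
    have h1 : (carrier F₂ Ψ (pi0 W f) : Set (F₂.Mod (Ψ.obj z) (Ψ.obj w))) =
        connectedComponent (α := F₂.Mod (Ψ.obj z) (Ψ.obj w)) (Ψ.map f) := by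
      refine Set.ext fun x => ⟨fun hx => ?_, fun hx => ⟨f, rfl, ?_⟩⟩
      · exact F₂.component_eq_iff.1
          (D.component_eq_of_mem_carrier hx ⟨f, rfl, rfl⟩)
      · exact (F₂.component_eq_iff.2 hx).symm
    rw [h1]
    exact isPreconnected_connectedComponent
  obtain ⟨⟨z, hz⟩, f, g⟩ := e
  obtain ⟨⟨z', hz'⟩, f', g'⟩ := e'
  obtain ⟨h1, h2⟩ := Sigma.mk.inj h
  obtain rfl : z = z' := congrArg Subtype.val h1
  obtain ⟨h3, h4⟩ := Prod.mk.inj (eq_of_heq h2)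
  let A : Set (F₂.Mod (Ψ.obj b) (Ψ.obj z)) := carrier F₂ Ψ f.cls
  let B : Set (F₂.Mod (Ψ.obj z) (Ψ.obj a)) := carrier F₂ Ψ g.cls
  have hA : PreconnectedSpace A := isPreconnected_iff_preconnectedSpace.1 (hcar f.cls)
  have hB : PreconnectedSpace B := isPreconnected_iff_preconnectedSpace.1 (hcar g.cls)
  let γ : A × B → Factorization W F₂ Ψ b a := fun xy =>
    ⟨⟨z, hz⟩, ⟨f.cls, xy.1.1, xy.1.2⟩, ⟨g.cls, xy.2.1, xy.2.2⟩⟩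
  have hγ : Continuous fun xy => (patching D hUF).cls (γ xy) := by
    refine (patching D hUF).continuous_cls_comp ?_ fun _ => Filter.Eventually.of_forall fun _ => rfl
    refine Continuous.subtype_mk ?_ _
    exact (F₂.continuous_comp (Ψ.obj b) (Ψ.obj z) (Ψ.obj a)).comp
      ((continuous_subtype_val.comp continuous_snd).prodMk
        (continuous_subtype_val.comp continuous_fst))
  refine (isPreconnected_range hγ).connectedComponent_eq ⟨(⟨f.pt, f.pt_mem⟩, ⟨g.pt, g.pt_mem⟩), rfl⟩
    ⟨(⟨f'.pt, ?_⟩, ⟨g'.pt, ?_⟩), ?_⟩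
  · change f'.pt ∈ carrier F₂ Ψ f.cls
    rw [show f.cls = f'.cls from h3]
    exact f'.pt_mem
  · change g'.pt ∈ carrier F₂ Ψ g.cls
    rw [show g.cls = g'.cls from h4]
    exact g'.pt_mem
  · obtain ⟨κ, x, hx⟩ := f'
    obtain ⟨μ, y, hy⟩ := g'
    dsimp only at h3 h4
    subst h3 h4
    rfl

/-- The component of a morphism of `C` in the glued boundary depends only on its class. -/
theorem connectedComponent_eq_of_pi0_eq (D : GluingData W F₂ Ψ) (hUF : LowerUnique W F₂ Ψ b a)
    (h3 : gr a + 3 ≤ gr b) {φ : (b ⟶ a) → (patching D hUF).Total}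
    (hφ : ∀ (z : C) (h1 : gr a < gr z) (h2 : gr z < gr b) (u : b ⟶ z) (v : z ⟶ a),
        φ (u ≫ v) = (patching D hUF).cls (of h1 h2 u v)) {f f' : b ⟶ a} (h : pi0 W f = pi0 W f') :
    connectedComponent (φ f) = connectedComponent (φ f') := by
  refine CategoryTheory.Quotient.apply_eq_of_map_eq (fun f => connectedComponent (φ f)) ?_ h
  rintro x y u m m' v hm
  have hmm : pi0 W m = pi0 W m' := CategoryTheory.Quotient.sound _ hm
  by_cases hxy : x = y
  · subst hxy
    rw [hom_eq_id W m, hom_eq_id W m']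
  have hxy' := gr_lt_of_hom W D.glued m hxy
  have hv := gr_le_of_hom W D.glued v
  have hu := gr_le_of_hom W D.glued u
  -- replacing `m` by `m'` in `u ≫ m ≫ v` happens within one factor, as `m` lies in a window
  -- and so cannot have full degree
  by_cases hxb : gr x < gr b
  · rw [hφ x (by omega) hxb u (m ≫ v), hφ x (by omega) hxb u (m' ≫ v)]
    refine connectedComponent_eq_of_type_eq D hUF ?_
    have : pi0 W (m ≫ v) = pi0 W (m' ≫ v) := by rw [pi0_comp, pi0_comp, hmm]
    exact congrArg (fun κ => (⟨⟨x, _⟩, pi0 W u, κ⟩ : FactorizationType W b a)) this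
  by_cases hya : gr a < gr y
  · rw [← Category.assoc, ← Category.assoc, hφ y hya (by omega) (u ≫ m) v,
      hφ y hya (by omega) (u ≫ m') v]
    refine connectedComponent_eq_of_type_eq D hUF ?_
    have : pi0 W (u ≫ m) = pi0 W (u ≫ m') := by rw [pi0_comp, pi0_comp, hmm]
    exact congrArg (fun κ => (⟨⟨y, _⟩, κ, pi0 W v⟩ : FactorizationType W b a)) this
  · obtain ⟨i, h1, h2, -⟩ := hm
    have h4 := h1.2
    have h5 := h2.1
    omega

/-- Each component of the glued boundary maps onto the boundary of a disc. -/
theorem exists_connectedComponent_eq [Finite C] (D : GluingData W F₂ Ψ)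
    (hUF : LowerUnique W F₂ Ψ b a) (h3 : gr a + 3 ≤ gr b) (q : (patching D hUF).Total)
    (x : bdry (mdim gr₂ (Ψ.obj b) (Ψ.obj a)) (F₂.Mod (Ψ.obj b) (Ψ.obj a)))
    (hx : F₂.component x.1 = F₂.component ((patching D hUF).proj q).1) :
    ∃ q', connectedComponent q' = connectedComponent q ∧ (patching D hUF).proj q' = x := by
  have := finite_type (b := b) (a := a) D
  obtain ⟨θ, hθ, hr⟩ := F₂.exists_isOpenEmbedding_sphere D.isDisc ((patching D hUF).proj q).1
  obtain ⟨q₀, hq₀⟩ : (patching D hUF).proj q ∈ range θ := by rw [hr]; rfl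
  obtain ⟨x₀, rfl⟩ : x ∈ range θ := by rw [hr]; exact hx
  have hdim : 1 < mdim gr₂ (Ψ.obj b) (Ψ.obj a) := by
    have h1 := D.gr_obj b
    have h2 := D.gr_obj a
    unfold mdim
    omega
  have hpc : PathConnectedSpace
      (Metric.sphere (0 : EuclideanSpace ℝ (Fin (mdim gr₂ (Ψ.obj b) (Ψ.obj a)))) 1) := by
    refine isPathConnected_iff_pathConnectedSpace.1 (isPathConnected_sphere ?_ _ zero_le_one)
    rw [← Module.finrank_eq_rank, finrank_euclideanSpace_fin]
    exact_mod_cast hdim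
  obtain ⟨q', h1, h2⟩ := (patching D hUF).isCoveringMap.exists_mem_connectedComponent hθ.continuous
    hq₀.symm x₀
  exact ⟨q', (_root_.connectedComponent_eq h1).symm, h2⟩

/-- Each component of the glued boundary maps injectively: if it covers a circle, this is the
hypothesis on trivial coverings, and spheres of larger dimension are simply connected. -/
theorem eq_of_connectedComponent_eq [Finite C] (D : GluingData W F₂ Ψ)
    (htriv : TrivialCoverings W F₂ Ψ) (hUF : LowerUnique W F₂ Ψ b a) (h3 : gr a + 3 ≤ gr b)
    {q q' : (patching D hUF).Total} (hc : connectedComponent q = connectedComponent q')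
    (hq : (patching D hUF).proj q = (patching D hUF).proj q') : q = q' := by
  have := finite_type (b := b) (a := a) D
  -- degree three, by the hypothesis on the spaces of broken morphisms
  rcases h3.eq_or_lt with h | h
  · obtain ⟨φ, hφ⟩ := D.exists_homeomorph_total h.symm
    obtain ⟨f, rfl⟩ := φ.surjective q
    obtain ⟨f', rfl⟩ := φ.surjective q'
    have hproj : ∀ f, brokenMap W F₂ Ψ b a h.symm f = ((patching D hUF).proj (φ f)).1 := by
      intro f
      obtain ⟨z, u, v, h1, h2, rfl⟩ := exists_comp_of_three_le W D.glued (b := b) (a := a) f h3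
      exact (Ψ.map_comp u v).trans
        (congrArg (fun q => ((patching D hUF).proj q).1) (hφ z h1 h2 u v)).symm
    have hcf : connectedComponent f = connectedComponent f' := by
      have h1 := φ.symm.continuous.connectedComponent_eq hc
      rwa [φ.symm_apply_apply, φ.symm_apply_apply] at h1
    have hpre : PreconnectedSpace (connectedComponent f) :=
      isPreconnected_iff_preconnectedSpace.1 isPreconnected_connectedComponent
    have hinj := (htriv b a h.symm f).injective
    have h2 := hinj (a₁ := ⟨f, mem_connectedComponent⟩)
      (a₂ := ⟨f', by rw [hcf]; exact mem_connectedComponent⟩) (Subtype.ext (by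
        change brokenMap W F₂ Ψ b a h.symm f = brokenMap W F₂ Ψ b a h.symm f'
        rw [hproj, hproj]
        exact congrArg Subtype.val hq))
    exact congrArg φ (congrArg Subtype.val h2)
  · obtain ⟨θ, hθ, hr⟩ := F₂.exists_isOpenEmbedding_sphere D.isDisc ((patching D hUF).proj q).1
    obtain ⟨x₀, hx₀⟩ : (patching D hUF).proj q ∈ range θ := by rw [hr]; rfl
    -- higher degrees: the sphere lifts, and the lift fills the component
    obtain ⟨s, hs, hps, hs₀⟩ := (patching D hUF).isCoveringMap.exists_lift_sphere (by
      have h1 := D.gr_obj b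
      have h2 := D.gr_obj a
      rw [finrank_euclideanSpace_fin]
      unfold mdim
      omega) hθ.continuous x₀ hx₀.symm
    have hsub := (patching D hUF).isCoveringMap.subset_range_of_isEmbedding_comp hs
      (by rw [hps]; exact hθ.isEmbedding) (K := connectedComponent q)
      isPreconnected_connectedComponent (a := x₀) (by rw [hs₀]; exact mem_connectedComponent)
      (by
        rw [hps, hr]
        intro q₁ hq₁
        exact (continuous_subtype_val.comp (patching D hUF).continuous_proj).connectedComponent_eq
          (_root_.connectedComponent_eq hq₁).symm)
    obtain ⟨y, hy⟩ := hsub mem_connectedComponent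
    obtain ⟨y', hy'⟩ := hsub (hc ▸ mem_connectedComponent : q' ∈ connectedComponent q)
    rw [← hy, ← hy'] at hq ⊢
    have h1 := congrFun hps y
    have h2 := congrFun hps y'
    simp only [Function.comp_apply] at h1 h2
    rw [hθ.injective (h1.symm.trans (hq.trans h2))]

/-- If the morphisms of smaller degree factor uniquely, then each component of the glued boundary is
mapped bijectively onto the boundary sphere of a disc. So the equivalence class of a factorization is
determined by its composition, and a morphism has a unique factorization of each kind. -/
theorem uniqueFactorization_step [Finite C] (D : GluingData W F₂ Ψ)
    (htriv : TrivialCoverings W F₂ Ψ) (hUF : LowerUnique W F₂ Ψ b a) (h3 : gr a + 3 ≤ gr b) :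
    CanUnique W F₂ Ψ b a := by
  obtain ⟨φ, hφ⟩ := exists_map_total D hUF h3
  intro f i h1 h2 hf
  change gr a + i < gr b at h2
  refine existsUnique_of_exists_of_unique ?_ ?_
  · obtain ⟨f₀, h4, h5⟩ := CanHom.exists_rep f
    obtain ⟨z, u, v, h6, h7, rfl⟩ := exists_comp_of_three_le W D.glued f₀ h3
    have hedge : F₂.IsEdge (CanHom.pt f) := by
      have e1 := D.gr_obj b
      have e2 := D.gr_obj a
      exact (F₂.isEdge_iff _).2 ⟨i, h1, by omega, hf⟩
    -- start from a factorized morphism of `C` in the class of `f`, and move in its component of the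
    -- glued boundary to the point over `f`
    obtain ⟨q, h8, h9⟩ := exists_connectedComponent_eq D hUF h3 ((patching D hUF).cls (of h6 h7 u v))
      ⟨CanHom.pt f, (F₂.mem_bdry_iff _).2 hedge⟩ (by
        rw [Ψ.map_comp] at h5
        exact h5.symm)
    have h10 := cls_eq_of_connectedComponent_eq D hUF h8
    obtain ⟨e, rfl⟩ := (patching D hUF).surjective_cls q
    have htot : e.total = f := by
      refine CanHom.ext ?_ (congrArg Subtype.val h9)
      rw [← h4, pi0_comp]
      exact h10
    obtain ⟨e', h11, h12⟩ := e.exists_rel_of_mem_face D hUF h1 h2 (by rw [htot]; exact hf)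
    exact ⟨⟨e'.1.1, e'.2.1, e'.2.2⟩, h12, h11.total_eq.symm.trans htot⟩
  · -- factorizations of one morphism lie in one component, hence are equal there
    have hcomp : ∀ e : Factorization W F₂ Ψ b a, ∃ f : b ⟶ a, pi0 W f = e.total.cls ∧
        connectedComponent ((patching D hUF).cls e) = connectedComponent (φ f) := by
      rintro ⟨⟨z, hz⟩, p, q⟩
      obtain ⟨u, hu, -⟩ := p.exists_rep
      obtain ⟨v, hv, -⟩ := q.exists_rep
      refine ⟨u ≫ v, ?_, ?_⟩
      · rw [pi0_comp, hu, hv]; rfl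
      · rw [hφ z hz.1 hz.2 u v]
        refine connectedComponent_eq_of_type_eq D hUF ?_
        exact congrArg₂ (fun κ μ => (⟨⟨z, hz⟩, κ, μ⟩ : FactorizationType W b a)) hu.symm hv.symm
    rintro ⟨z, p, q⟩ ⟨z', p', q'⟩ ⟨hz, hc⟩ ⟨hz', hc'⟩
    change gr z = gr a + i at hz
    change gr z' = gr a + i at hz'
    let e : Factorization W F₂ Ψ b a := ⟨⟨z, by omega⟩, p, q⟩
    let e' : Factorization W F₂ Ψ b a := ⟨⟨z', by omega⟩, p', q'⟩
    have htot : e.total = e'.total := hc.trans hc'.symm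
    obtain ⟨g, h4, h5⟩ := hcomp e
    obtain ⟨g', h6, h7⟩ := hcomp e'
    have h8 : connectedComponent ((patching D hUF).cls e) =
        connectedComponent ((patching D hUF).cls e') := by
      rw [h5, h7]
      exact connectedComponent_eq_of_pi0_eq D hUF h3 hφ (by rw [h4, h6, htot])
    have h9 := eq_of_connectedComponent_eq D htriv hUF h3 h8
      (Subtype.ext (congrArg CanHom.pt htot))
    have h10 := Rel.eq_of_gr_eq D ((patching D hUF).cls_eq_cls.1 h9) (hz.trans hz'.symm)
    exact congrArg (fun e : Factorization W F₂ Ψ b a =>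
      (⟨e.1.1, e.2.1, e.2.2⟩ : Σ z : Can W F₂ Ψ, CanHom W F₂ Ψ b z × CanHom W F₂ Ψ z a)) h10

end Factorization

/-- The boundary morphisms of `C₁` factor uniquely. -/
theorem GluingData.uniqueFactorization [Finite C] (D : GluingData W F₂ Ψ)
    (htriv : TrivialCoverings W F₂ Ψ) (b a : C) : CanUnique W F₂ Ψ b a := by
  have key : ∀ N : ℕ, ∀ b a : C, gr b - gr a < N → CanUnique W F₂ Ψ b a := by
    intro N
    induction N with
    | zero =>
      intro b a h
      exact D.uniqueFactorization_of_le_two (by push_cast at h; omega)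
    | succ N ih =>
      intro b a h
      push_cast at h
      by_cases h3 : gr a + 3 ≤ gr b
      · exact uniqueFactorization_step D htriv (fun b' a' h' => ih b' a' (by omega)) h3
      · exact D.uniqueFactorization_of_le_two (by omega)
  exact key ((gr b - gr a).toNat + 1) b a (by push_cast; omega)

end Broken

end FlowCat

/-! ### Pulling back charts along local homeomorphisms -/

section PullbackCharts

variable {H : Type*} [TopologicalSpace H] {X Y : Type*} [TopologicalSpace X] [TopologicalSpace Y]
  {p : Y → X}

/-- A restriction of a local homeomorphism to a homeomorphism between open sets, near a given
point. -/
noncomputable def IsLocalHomeomorph.toOpenPartialHomeomorphAt (hp : IsLocalHomeomorph p) (y : Y) :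
    OpenPartialHomeomorph Y X := (hp y).choose

theorem IsLocalHomeomorph.mem_source_at (hp : IsLocalHomeomorph p) (y : Y) :
    y ∈ (hp.toOpenPartialHomeomorphAt y).source := (hp y).choose_spec.1

theorem IsLocalHomeomorph.coe_at (hp : IsLocalHomeomorph p) (y : Y) :
    (hp.toOpenPartialHomeomorphAt y : Y → X) = p := (hp y).choose_spec.2.symm

/-- The charts of the source of a local homeomorphism that are the compositions of a local
homeomorphism with the charts of the target. -/
@[reducible] noncomputable def IsLocalHomeomorph.pullbackCharts [ChartedSpace H X]
    (hp : IsLocalHomeomorph p) : ChartedSpace H Y where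
  atlas := range fun y => (hp.toOpenPartialHomeomorphAt y).trans (chartAt H (p y))
  chartAt y := (hp.toOpenPartialHomeomorphAt y).trans (chartAt H (p y))
  mem_chart_source y := by
    rw [OpenPartialHomeomorph.trans_source]
    exact ⟨hp.mem_source_at y, by rw [mem_preimage, hp.coe_at]; exact mem_chart_source H (p y)⟩
  chart_mem_atlas y := mem_range_self y

variable {E : Type*} [NormedAddCommGroup E] [NormedSpace ℝ E] (I : ModelWithCorners ℝ E H)

theorem IsLocalHomeomorph.isManifold_pullbackCharts [ChartedSpace H X] [IsManifold I ∞ X]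
    (hp : IsLocalHomeomorph p) :
    letI := hp.pullbackCharts (H := H)
    IsManifold I ∞ Y := by
  let _ := hp.pullbackCharts (H := H)
  refine isManifold_of_contDiffOn I ∞ Y ?_
  rintro _ _ ⟨y, rfl⟩ ⟨y', rfl⟩
  have h := ((mem_groupoid_of_pregroupoid (PG := contDiffPregroupoid ∞ I)).1
    (StructureGroupoid.compatible (contDiffGroupoid ∞ I) (chart_mem_atlas H (p y))
      (chart_mem_atlas H (p y')))).1
  have hinv : ∀ x ∈ (hp.toOpenPartialHomeomorphAt y).target,
      p ((hp.toOpenPartialHomeomorphAt y).symm x) = x := fun x hx => by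
    have := (hp.toOpenPartialHomeomorphAt y).right_inv hx
    rwa [hp.coe_at] at this
  refine ContDiffOn.congr_mono h (s₁ := _) ?_ ?_
  · rintro z ⟨hz, -⟩
    simp only [mfld_simps] at hz
    simp only [mfld_simps, hp.coe_at]
    rw [hinv _ hz.1.2]
  · rintro z ⟨hz, hz'⟩
    simp only [mfld_simps, hp.coe_at] at hz
    rw [hinv _ hz.1.2] at hz
    exact ⟨by simpa only [mfld_simps] using ⟨hz.1.1, hz.2.2⟩, hz'⟩

theorem IsLocalHomeomorph.isLocalDiffeomorph_pullbackCharts [ChartedSpace H X] [IsManifold I ∞ X]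
    (hp : IsLocalHomeomorph p) :
    letI := hp.pullbackCharts (H := H)
    IsLocalDiffeomorph I I ∞ p := by
  let _ := hp.pullbackCharts (H := H)
  have := hp.isManifold_pullbackCharts I
  intro y
  have hmem : chartAt H y y ∈ (chartAt H (p y)).target := by
    have h := (chartAt H (p y)).map_source (mem_chart_source H (p y))
    have h' : chartAt H y y = chartAt H (p y) (p y) :=
      congrArg (chartAt H (p y)) (congrFun (hp.coe_at y) y)
    rwa [h']
  let Φ : PartialDiffeomorph I I Y X ∞ :=
    { ((chartAt H y).trans (chartAt H (p y)).symm) with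
      contMDiffOn_toFun := contMDiffOn_chart_symm.comp
        (contMDiffOn_chart.mono inter_subset_left) inter_subset_right
      contMDiffOn_invFun := contMDiffOn_chart_symm.comp
        (contMDiffOn_chart.mono inter_subset_left) inter_subset_right }
  refine ⟨Φ, ⟨mem_chart_source H y, hmem⟩, fun z hz => ?_⟩
  have hz' : z ∈ (hp.toOpenPartialHomeomorphAt y).source ∩
    (hp.toOpenPartialHomeomorphAt y) ⁻¹' (chartAt H (p y)).source := hz.1
  have h1 := (chartAt H (p y)).left_inv hz'.2
  exact (h1.trans (congrFun (hp.coe_at y) z)).symm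

end PullbackCharts

/-! ### Local diffeomorphisms -/

section LocalDiffeomorphisms

variable {E E' E'' : Type*} [NormedAddCommGroup E] [NormedSpace ℝ E] [NormedAddCommGroup E']
  [NormedSpace ℝ E'] [NormedAddCommGroup E''] [NormedSpace ℝ E'']
  {H H' H'' : Type*} [TopologicalSpace H] [TopologicalSpace H'] [TopologicalSpace H'']
  {I : ModelWithCorners ℝ E H} {I' : ModelWithCorners ℝ E' H'} {I'' : ModelWithCorners ℝ E'' H''}
  {X Y Z : Type*} [TopologicalSpace X] [TopologicalSpace Y] [TopologicalSpace Z]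
  [ChartedSpace H X] [ChartedSpace H' Y] [ChartedSpace H'' Z]

/-- The restriction of a partial diffeomorphism to an open subset of its source. -/
noncomputable def PartialDiffeomorph.restrOpen (Φ : PartialDiffeomorph I I' X Y ∞) (U : Set X)
    (hU : IsOpen U) : PartialDiffeomorph I I' X Y ∞ :=
  { (Φ.toOpenPartialHomeomorph.restrOpen U hU) with
    contMDiffOn_toFun := Φ.contMDiffOn_toFun.mono inter_subset_left
    contMDiffOn_invFun := Φ.contMDiffOn_invFun.mono inter_subset_left }

theorem IsLocalDiffeomorph.comp {p : Y → Z} {g : X → Y} (hp : IsLocalDiffeomorph I' I'' ∞ p)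
    (hg : IsLocalDiffeomorph I I' ∞ g) : IsLocalDiffeomorph I I'' ∞ (p ∘ g) :=
  fun x => IsLocalDiffeomorphAt.comp (K := I'') (P := Z) (hg x) (hp _)

theorem IsLocalDiffeomorphAt.congr_of_eventuallyEq {f g : X → Y} {x : X}
    (hf : IsLocalDiffeomorphAt I I' ∞ f x) (h : g =ᶠ[𝓝 x] f) :
    IsLocalDiffeomorphAt I I' ∞ g x := by
  obtain ⟨Φ, hx, he⟩ := hf
  obtain ⟨U, hU, hUo, hxU⟩ := mem_nhds_iff.1 h
  exact ⟨Φ.restrOpen U hUo, ⟨hx, hxU⟩, fun z hz => (hU hz.2).trans (he hz.1)⟩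

/-- A continuous lift of a local diffeomorphism along a local diffeomorphism is a local
diffeomorphism. -/
theorem IsLocalDiffeomorph.of_comp_left {p : Y → Z} {g : X → Y}
    (hp : IsLocalDiffeomorph I' I'' ∞ p) (hg : Continuous g)
    (h : IsLocalDiffeomorph I I'' ∞ (p ∘ g)) : IsLocalDiffeomorph I I' ∞ g := by
  intro x
  have h1 := IsLocalDiffeomorphAt.comp (K := I') (P := Y) (h x)
    (hp (g x)).localInverse_isLocalDiffeomorphAt
  refine h1.congr_of_eventuallyEq ?_
  filter_upwards [hg.continuousAt.preimage_mem_nhds ((hp (g x)).localInverse.open_target.mem_nhds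
    (hp (g x)).localInverse_mem_target)] with z hz
  exact ((hp (g x)).localInverse_left_inv hz).symm

theorem IsLocalDiffeomorph.of_comp_right {p : Y → Z} {g : X → Y}
    (hg : IsLocalDiffeomorph I I' ∞ g) (hs : Function.Surjective g)
    (h : IsLocalDiffeomorph I I'' ∞ (p ∘ g)) : IsLocalDiffeomorph I' I'' ∞ p := by
  intro y
  obtain ⟨x, rfl⟩ := hs y
  have h2 := (hg x).localInverse_left_inv (hg x).localInverse_mem_target
  have h1 := IsLocalDiffeomorphAt.comp (K := I'') (P := Z) (g := p ∘ g)
    (hg x).localInverse_isLocalDiffeomorphAt (h _)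
  refine h1.congr_of_eventuallyEq ?_
  filter_upwards [(hg x).localInverse.open_source.mem_nhds (hg x).localInverse_mem_source] with z hz
  exact congrArg p ((hg x).localInverse_right_inv hz).symm

end LocalDiffeomorphisms

/-! ### Lifting immersions -/

section Immersions

variable {E E' : Type u} [NormedAddCommGroup E] [NormedSpace ℝ E] [NormedAddCommGroup E']
  [NormedSpace ℝ E']
  {H H' : Type*} [TopologicalSpace H] [TopologicalSpace H']
  {I : ModelWithCorners ℝ E H} {I' : ModelWithCorners ℝ E' H'}
  {X Y X' Y' : Type*} [TopologicalSpace X] [TopologicalSpace Y] [TopologicalSpace X']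
  [TopologicalSpace Y']
  [ChartedSpace H X] [ChartedSpace H Y] [ChartedSpace H' X'] [ChartedSpace H' Y']

theorem PartialDiffeomorph.trans_mem_maximalAtlas [IsManifold I ∞ X] [IsManifold I ∞ Y]
    (Φ : PartialDiffeomorph I I Y X ∞)
    {e : OpenPartialHomeomorph X H} (he : e ∈ IsManifold.maximalAtlas I ∞ X) :
    Φ.toOpenPartialHomeomorph.trans e ∈ IsManifold.maximalAtlas I ∞ Y := by
  refine OpenPartialHomeomorph.mem_maximalAtlas_of_contMDiffOn _ ?_ ?_
  · exact (contMDiffOn_of_mem_maximalAtlas (I := I) he).comp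
      (Φ.contMDiffOn_toFun.mono inter_subset_left) inter_subset_right
  · exact Φ.contMDiffOn_invFun.comp
      ((contMDiffOn_symm_of_mem_maximalAtlas (I := I) he).mono inter_subset_left)
      inter_subset_right

/-- A continuous lift of an immersion along local diffeomorphisms is an immersion. -/
theorem Manifold.IsImmersion.lift [IsManifold I ∞ X] [IsManifold I ∞ Y] [IsManifold I' ∞ X']
    [IsManifold I' ∞ Y'] {p : Y → X} {p' : Y' → X'} {g : Y → Y'} {f : X → X'}
    (hf : Manifold.IsImmersion I I' ∞ f) (hp : IsLocalDiffeomorph I I ∞ p)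
    (hp' : IsLocalDiffeomorph I' I' ∞ p') (hg : Continuous g) (h : ∀ y, p' (g y) = f (p y)) :
    Manifold.IsImmersion I I' ∞ g := by
  have hc := hf.isImmersionOfComplement_complement
  refine Manifold.IsImmersionOfComplement.isImmersion (F := hf.complement) fun y => ?_
  have hy := hc (p y)
  obtain ⟨Φ, h1, h2⟩ := hp y
  obtain ⟨Φ', h3, h4⟩ := hp' (g y)
  -- shrink the source of `Φ`, so that `g` maps it to the source of `Φ'`
  let Φ₁ := Φ.restrOpen (g ⁻¹' Φ'.source) (Φ'.open_source.preimage hg)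
  refine Manifold.IsImmersionAtOfComplement.mk_of_continuousAt hg.continuousAt hy.equiv
    (Φ₁.toOpenPartialHomeomorph.trans hy.domChart) (Φ'.toOpenPartialHomeomorph.trans hy.codChart)
    ⟨⟨h1, h3⟩, ?_⟩ ⟨h3, ?_⟩ (Φ₁.trans_mem_maximalAtlas hy.domChart_mem_maximalAtlas)
    (Φ'.trans_mem_maximalAtlas hy.codChart_mem_maximalAtlas) ?_
  · change Φ y ∈ hy.domChart.source
    rw [← h2 h1]
    exact hy.mem_domChart_source
  · change Φ' (g y) ∈ hy.codChart.source
    rw [← h4 h3, h]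
    exact hy.mem_codChart_source
  · intro z hz
    rw [OpenPartialHomeomorph.extend_target] at hz
    obtain ⟨⟨hz1, hz2⟩, hz3⟩ := hz
    have hz4 : hy.domChart.symm (I.symm z) ∈ Φ₁.target := hz2
    have hz5 := Φ₁.map_target hz4
    have hz6 : Φ (Φ₁.toPartialEquiv.symm (hy.domChart.symm (I.symm z))) = hy.domChart.symm (I.symm z) :=
      Φ₁.right_inv hz4
    have hz7 := hy.writtenInCharts (show z ∈ (hy.domChart.extend I).target by
      rw [OpenPartialHomeomorph.extend_target]; exact ⟨hz1, hz3⟩)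
    refine Eq.trans ?_ hz7
    change I' (hy.codChart (Φ' (g (Φ₁.toPartialEquiv.symm (hy.domChart.symm (I.symm z)))))) =
      I' (hy.codChart (f (hy.domChart.symm (I.symm z))))
    rw [← h4 hz5.2, h, h2 hz5.1, hz6]

end Immersions

/-! ### Pulling back faces -/

section Components

variable {X Y : Type*} [TopologicalSpace X] [TopologicalSpace Y] {p : Y → X}

namespace HasComponentSections

/-- As `p` maps components of `Y` homeomorphically onto components of `X`, the components of a
preimage are the parts of the preimages of components that lie in one component of `Y`. -/
theorem connectedComponentIn_preimage (hp : HasComponentSections p) (hc : Continuous p)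
    (S : Set X) {y : Y} (hy : p y ∈ S) : connectedComponentIn (p ⁻¹' S) y =
      connectedComponent y ∩ p ⁻¹' connectedComponentIn S (p y) := by
  refine Subset.antisymm (fun z hz => ⟨?_, ?_⟩) ?_
  · exact isPreconnected_connectedComponentIn.subset_connectedComponent
      (mem_connectedComponentIn (show y ∈ p ⁻¹' S from hy)) hz
  · exact (isPreconnected_connectedComponentIn.image p hc.continuousOn).subset_connectedComponentIn
      ⟨y, mem_connectedComponentIn hy, rfl⟩
      (image_subset_iff.2 (connectedComponentIn_subset _ _)) ⟨z, hz, rfl⟩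
  · obtain ⟨s, hs, hs1, hs2⟩ := hp y
    have hsub : connectedComponentIn S (p y) ⊆ connectedComponent (p y) :=
      isPreconnected_connectedComponentIn.subset_connectedComponent (mem_connectedComponentIn hy)
    have hpre : IsPreconnected
        (s '' ((↑) ⁻¹' connectedComponentIn S (p y) : Set (connectedComponent (p y)))) := by
      refine IsPreconnected.image ?_ s hs.continuousOn
      rw [← Topology.IsInducing.subtypeVal.isPreconnected_image, Subtype.image_preimage_coe,
        inter_eq_self_of_subset_right hsub]
      exact isPreconnected_connectedComponentIn
    rintro z ⟨hz1, hz2⟩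
    have key : ∀ w ∈ connectedComponent y, p w ∈ connectedComponentIn S (p y) →
        w ∈ s '' ((↑) ⁻¹' connectedComponentIn S (p y) : Set (connectedComponent (p y))) := by
      intro w hw hw'
      rw [← hs2] at hw
      obtain ⟨x, rfl⟩ := hw
      rw [hs1] at hw'
      exact ⟨x, hw', rfl⟩
    refine hpre.subset_connectedComponentIn
      (key y mem_connectedComponent (mem_connectedComponentIn hy)) ?_ (key z hz1 hz2)
    rintro _ ⟨x, hx, rfl⟩
    rw [mem_preimage, hs1]
    exact connectedComponentIn_subset _ _ hx

theorem image_inter_preimage (hp : HasComponentSections p) {y : Y} {L : Set X}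
    (hL : L ⊆ connectedComponent (p y)) : p '' (connectedComponent y ∩ p ⁻¹' L) = L := by
  refine Subset.antisymm (image_subset_iff.2 inter_subset_right) fun x hx => ?_
  obtain ⟨y', h1, h2⟩ := hp.exists_eq (_root_.connectedComponent_eq (hL hx)).symm
  exact ⟨y', ⟨connectedComponent_eq_iff_mem.1 h1, by rwa [mem_preimage, h2]⟩, h2⟩

end HasComponentSections

theorem closure_connectedComponent_inter_preimage [LocallyConnectedSpace Y] (hc : Continuous p)
    (ho : IsOpenMap p) (y : Y) (L : Set X) : closure (connectedComponent y ∩ p ⁻¹' L) =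
      connectedComponent y ∩ p ⁻¹' closure L := by
  rw [ho.preimage_closure_eq_closure_preimage hc]
  refine Subset.antisymm ?_ isOpen_connectedComponent.inter_closure
  exact (closure_inter_subset_inter_closure _ _).trans
    (inter_subset_inter_left _ isClosed_connectedComponent.closure_subset)

theorem subset_connectedComponent_of_mem_closure {L : Set X} (hL : IsPreconnected L) {x : X}
    (hx : x ∈ closure L) : closure L ⊆ connectedComponent x :=
  hL.closure.subset_connectedComponent hx

end Components

namespace FlowCat

section PullbackFaces

variable {n : ℕ} {X : Type v} {Y : Type v₂} [TopologicalSpace X] [TopologicalSpace Y]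
  [ChartedSpace (EuclideanQuadrant n) X] [ChartedSpace (EuclideanQuadrant n) Y] {p : Y → X}

/-- The components of the codimension one boundary of `Y` near `y` correspond to those of `X` near
`p y`. -/
theorem isManifoldWithFaces_of_hasComponentSections (hp : HasComponentSections p)
    (hc : Continuous p) (ho : IsOpenMap p) (hd : ∀ y, depth n (p y) = depth n y)
    (hX : IsManifoldWithFaces n X) : IsManifoldWithFaces n Y := by
  have := ChartedSpace.locallyPathConnectedSpace (EuclideanQuadrant n) Y
  intro y
  have hS : {z : Y | depth n z = 1} = p ⁻¹' {x : X | depth n x = 1} := by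
    ext z; simp only [mem_ofPred_eq, mem_preimage, hd]
  rw [← hd y, ← hX (p y), hS]
  have hsub : ∀ L ∈ {L ∈ componentsOf {x : X | depth n x = 1} | p y ∈ closure L},
      L ⊆ connectedComponent (p y) := by
    rintro L ⟨⟨x, hx, rfl⟩, hL⟩
    exact subset_closure.trans
      (subset_connectedComponent_of_mem_closure isPreconnected_connectedComponentIn hL)
  rw [← InjOn.encard_image (f := fun L => connectedComponent y ∩ p ⁻¹' L)
    (s := {L ∈ componentsOf {x : X | depth n x = 1} | p y ∈ closure L})]
  · congr 1
    refine Subset.antisymm ?_ ?_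
    · rintro _ ⟨⟨y₀, hy₀, rfl⟩, hy⟩
      rw [hp.connectedComponentIn_preimage hc {x | depth n x = 1} hy₀,
        closure_connectedComponent_inter_preimage hc ho] at hy
      refine ⟨_, ⟨⟨p y₀, hy₀, rfl⟩, hy.2⟩, ?_⟩
      rw [hp.connectedComponentIn_preimage hc {x | depth n x = 1} hy₀, ← _root_.connectedComponent_eq hy.1]
    · rintro _ ⟨L, hL, rfl⟩
      have hL' := hsub L hL
      obtain ⟨⟨x₀, hx₀, rfl⟩, hy⟩ := hL
      obtain ⟨y₀, h1, rfl⟩ := hp.exists_eq (y := y)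
        (_root_.connectedComponent_eq (hL' (mem_connectedComponentIn hx₀))).symm
      refine ⟨⟨y₀, hx₀, ?_⟩, ?_⟩
      · dsimp only
        rw [hp.connectedComponentIn_preimage hc {x | depth n x = 1} hx₀, h1]
      · dsimp only
        rw [closure_connectedComponent_inter_preimage hc ho]
        exact ⟨mem_connectedComponent, hy⟩
  · intro L hL L' hL' h
    rw [← hp.image_inter_preimage (hsub L hL), ← hp.image_inter_preimage (hsub L' hL')]
    exact congrArg _ h

theorem IsFaceOf.preimage (hp : HasComponentSections p)
    (hc : Continuous p) (ho : IsOpenMap p) (hd : ∀ y, depth n (p y) = depth n y) {k : ℕ}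
    {F G : Set X} (h : IsFaceOf n k F G) : IsFaceOf n k (p ⁻¹' F) (p ⁻¹' G) := by
  have := ChartedSpace.locallyPathConnectedSpace (EuclideanQuadrant n) Y
  obtain ⟨𝒦, h1, h2, rfl⟩ := h
  have hS : {z : Y | z ∈ p ⁻¹' F ∧ depth n z = k + 1} =
      p ⁻¹' {x : X | x ∈ F ∧ depth n x = k + 1} := by
    ext z; simp only [mem_ofPred_eq, mem_preimage, hd]
  let 𝓛 : Set (Set Y) := {K | ∃ y : Y, p y ∈ {x : X | x ∈ F ∧ depth n x = k + 1} ∧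
    connectedComponentIn {x : X | x ∈ F ∧ depth n x = k + 1} (p y) ∈ 𝒦 ∧
    K = connectedComponent y ∩
      p ⁻¹' connectedComponentIn {x : X | x ∈ F ∧ depth n x = k + 1} (p y)}
  refine ⟨𝓛, ?_, ?_, ?_⟩
  · rintro _ ⟨y, hy, hy', rfl⟩
    rw [hS]
    exact ⟨y, hy, (hp.connectedComponentIn_preimage hc _ hy).symm⟩
  · rintro _ ⟨_, ⟨y, hy, hy', rfl⟩, rfl⟩ _ ⟨_, ⟨z, hz, hz', rfl⟩, rfl⟩ hne
    refine disjoint_left.2 fun w hw hw' => hne ?_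
    simp only [id, closure_connectedComponent_inter_preimage hc ho] at hw hw' ⊢
    rw [_root_.connectedComponent_eq hw.1, _root_.connectedComponent_eq hw'.1]
    congr 2
    by_contra hne'
    exact disjoint_left.1 (h2 ⟨_, hy', rfl⟩ ⟨_, hz', rfl⟩ hne') hw.2 hw'.2
  · ext w
    constructor
    · rintro ⟨_, ⟨L, hL, rfl⟩, hw⟩
      obtain ⟨x, hx, rfl⟩ := h1 hL
      obtain ⟨y, h3, rfl⟩ := hp.exists_eq (y := w) (_root_.connectedComponent_eq
        (subset_connectedComponent_of_mem_closure isPreconnected_connectedComponentIn hw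
          (subset_closure (mem_connectedComponentIn hx)))).symm
      refine ⟨_, ⟨_, ⟨y, hx, hL, rfl⟩, rfl⟩, ?_⟩
      rw [closure_connectedComponent_inter_preimage hc ho]
      exact ⟨connectedComponent_eq_iff_mem.1 h3.symm, hw⟩
    · rintro ⟨_, ⟨_, ⟨y, hy, hL, rfl⟩, rfl⟩, hw⟩
      rw [closure_connectedComponent_inter_preimage hc ho] at hw
      exact ⟨_, ⟨_, hL, rfl⟩, hw.2⟩

theorem IsFaceStructure.preimage (hp : HasComponentSections p)
    (hc : Continuous p) (ho : IsOpenMap p) (hd : ∀ y, depth n (p y) = depth n y) {m : ℕ}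
    {D : ℕ → Set X} (h : IsFaceStructure n m D) : IsFaceStructure n m fun i => p ⁻¹' D i where
  outside i hi := by rw [h.outside i hi, preimage_empty]
  isFace i h1 h2 := by
    have := (h.isFace i h1 h2).preimage hp hc ho hd
    rwa [preimage_univ] at this
  union := by
    simp only [← preimage_iUnion, h.union]
    unfold bdry
    rw [ho.preimage_closure_eq_closure_preimage hc]
    congr 1
    ext y
    simp only [mem_ofPred_eq, mem_preimage, hd]
  inter i j h1 h2 h3 h4 h5 := by
    obtain ⟨h6, h7⟩ := h.inter i j h1 h2 h3 h4 h5
    exact ⟨h6.preimage hp hc ho hd, h7.preimage hp hc ho hd⟩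

end PullbackFaces

theorem depth_pullbackCharts {n : ℕ} {X : Type v} {Y : Type v₂} [TopologicalSpace X]
    [TopologicalSpace Y] [ChartedSpace (EuclideanQuadrant n) X] {p : Y → X}
    (hp : IsLocalHomeomorph p) (y : Y) :
    letI := hp.pullbackCharts (H := EuclideanQuadrant n)
    depth n (p y) = depth n y := by
  have h : chartAt (EuclideanQuadrant n) (p y) (hp.toOpenPartialHomeomorphAt y y) =
    chartAt (EuclideanQuadrant n) (p y) (p y) := by rw [hp.coe_at]
  unfold depth
  rw [← h]
  rfl

end FlowCat

/-! ### Charts with values in quadrants -/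

theorem IsLocalDiffeomorph.prodMap {E₁ E₂ H₁ H₂ X₁ X₂ Y₁ Y₂ : Type*}
    [NormedAddCommGroup E₁] [NormedSpace ℝ E₁] [NormedAddCommGroup E₂] [NormedSpace ℝ E₂]
    [TopologicalSpace H₁] [TopologicalSpace H₂] [TopologicalSpace X₁] [TopologicalSpace X₂]
    [TopologicalSpace Y₁] [TopologicalSpace Y₂] [ChartedSpace H₁ X₁] [ChartedSpace H₁ Y₁]
    [ChartedSpace H₂ X₂] [ChartedSpace H₂ Y₂]
    {I₁ : ModelWithCorners ℝ E₁ H₁} {I₂ : ModelWithCorners ℝ E₂ H₂} {p₁ : Y₁ → X₁} {p₂ : Y₂ → X₂}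
    (h₁ : IsLocalDiffeomorph I₁ I₁ ∞ p₁) (h₂ : IsLocalDiffeomorph I₂ I₂ ∞ p₂) :
    IsLocalDiffeomorph (I₁.prod I₂) (I₁.prod I₂) ∞ (Prod.map p₁ p₂) := by
  rintro ⟨y₁, y₂⟩
  obtain ⟨Φ₁, hy₁, he₁⟩ := h₁ y₁
  obtain ⟨Φ₂, hy₂, he₂⟩ := h₂ y₂
  let Φ : PartialDiffeomorph (I₁.prod I₂) (I₁.prod I₂) (Y₁ × Y₂) (X₁ × X₂) ∞ :=
    { (Φ₁.toOpenPartialHomeomorph.prod Φ₂.toOpenPartialHomeomorph) with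
      contMDiffOn_toFun := Φ₁.contMDiffOn_toFun.prodMap Φ₂.contMDiffOn_toFun
      contMDiffOn_invFun := Φ₁.contMDiffOn_invFun.prodMap Φ₂.contMDiffOn_invFun }
  exact ⟨Φ, ⟨hy₁, hy₂⟩, fun z hz => Prod.ext (he₁ hz.1) (he₂ hz.2)⟩

section Quadrants

variable {n m : ℕ} {X : Type v} {Y : Type v₂} [TopologicalSpace X] [TopologicalSpace Y]
  [ChartedSpace (EuclideanQuadrant n) X] {p : Y → X}

/-- The charts of the source of a local homeomorphism, with values in `[0,∞)ᵐ`, that are pulled back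
from charts with values in `[0,∞)ⁿ`, where `n = m`. -/
@[reducible] noncomputable def IsLocalHomeomorph.pullbackQuadrant (hp : IsLocalHomeomorph p)
    (h : n = m) : ChartedSpace (EuclideanQuadrant m) Y := h ▸ hp.pullbackCharts

theorem IsLocalHomeomorph.isManifold_pullbackQuadrant
    [IsManifold (modelWithCornersEuclideanQuadrant n) ∞ X] (hp : IsLocalHomeomorph p) (h : n = m) :
    letI := hp.pullbackQuadrant h
    IsManifold (modelWithCornersEuclideanQuadrant m) ∞ Y := by
  subst h
  exact hp.isManifold_pullbackCharts _

theorem IsLocalHomeomorph.isLocalDiffeomorph_pullbackQuadrant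
    [IsManifold (modelWithCornersEuclideanQuadrant n) ∞ X] (hp : IsLocalHomeomorph p) (h : n = m) :
    letI := hp.pullbackQuadrant h
    IsLocalDiffeomorph (modelWithCornersEuclideanQuadrant m)
      (modelWithCornersEuclideanQuadrant n) ∞ p := by
  subst h
  exact hp.isLocalDiffeomorph_pullbackCharts _

theorem IsLocalHomeomorph.isManifoldWithFaces_pullbackQuadrant (hp : IsLocalHomeomorph p)
    (h : n = m) (hs : HasComponentSections p) (hX : FlowCat.IsManifoldWithFaces n X) :
    letI := hp.pullbackQuadrant h
    FlowCat.IsManifoldWithFaces m Y := by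
  subst h
  let _ := hp.pullbackCharts (H := EuclideanQuadrant n)
  exact FlowCat.isManifoldWithFaces_of_hasComponentSections hs hp.continuous hp.isOpenMap
    (FlowCat.depth_pullbackCharts hp) hX

theorem IsLocalHomeomorph.isFaceStructure_pullbackQuadrant (hp : IsLocalHomeomorph p)
    (h : n = m) (hs : HasComponentSections p) {D : ℕ → Set X}
    (hD : FlowCat.IsFaceStructure n n D) :
    letI := hp.pullbackQuadrant h
    FlowCat.IsFaceStructure m m fun i => p ⁻¹' D i := by
  subst h
  let _ := hp.pullbackCharts (H := EuclideanQuadrant n)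
  exact hD.preimage hs hp.continuous hp.isOpenMap (FlowCat.depth_pullbackCharts hp)

/-- A continuous lift of an immersion along local diffeomorphisms is an immersion, for an immersion
of a product. -/
theorem Manifold.IsImmersion.lift_quadrant {n₁ m₁ n₂ m₂ : ℕ} (h : n = m) (h₁ : n₁ = m₁)
    (h₂ : n₂ = m₂) {X₁ X₂ Y₁ Y₂ : Type*} [TopologicalSpace X₁] [TopologicalSpace X₂]
    [TopologicalSpace Y₁] [TopologicalSpace Y₂] [ChartedSpace (EuclideanQuadrant m) Y]
    [ChartedSpace (EuclideanQuadrant n₁) X₁] [ChartedSpace (EuclideanQuadrant n₂) X₂]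
    [ChartedSpace (EuclideanQuadrant m₁) Y₁] [ChartedSpace (EuclideanQuadrant m₂) Y₂]
    [IsManifold (modelWithCornersEuclideanQuadrant n) ∞ X]
    [IsManifold (modelWithCornersEuclideanQuadrant n₁) ∞ X₁]
    [IsManifold (modelWithCornersEuclideanQuadrant n₂) ∞ X₂]
    [IsManifold (modelWithCornersEuclideanQuadrant m) ∞ Y]
    [IsManifold (modelWithCornersEuclideanQuadrant m₁) ∞ Y₁]
    [IsManifold (modelWithCornersEuclideanQuadrant m₂) ∞ Y₂]
    {p₁ : Y₁ → X₁} {p₂ : Y₂ → X₂} {g : Y₁ × Y₂ → Y} {f : X₁ × X₂ → X}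
    (hf : Manifold.IsImmersion ((modelWithCornersEuclideanQuadrant n₁).prod
      (modelWithCornersEuclideanQuadrant n₂)) (modelWithCornersEuclideanQuadrant n) ∞ f)
    (hp : IsLocalDiffeomorph (modelWithCornersEuclideanQuadrant m)
      (modelWithCornersEuclideanQuadrant n) ∞ p)
    (hp₁ : IsLocalDiffeomorph (modelWithCornersEuclideanQuadrant m₁)
      (modelWithCornersEuclideanQuadrant n₁) ∞ p₁)
    (hp₂ : IsLocalDiffeomorph (modelWithCornersEuclideanQuadrant m₂)
      (modelWithCornersEuclideanQuadrant n₂) ∞ p₂)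
    (hg : Continuous g) (he : ∀ y, p (g y) = f (Prod.map p₁ p₂ y)) :
    Manifold.IsImmersion ((modelWithCornersEuclideanQuadrant m₁).prod
      (modelWithCornersEuclideanQuadrant m₂)) (modelWithCornersEuclideanQuadrant m) ∞ g := by
  subst h h₁ h₂
  exact hf.lift (hp₁.prodMap hp₂) hp hg he

end Quadrants

/-! ### The flow category `C₁` -/

namespace FlowCat

section CanonicalTopology

variable {C : Type u} [Category.{v} C] {gr : C → ℤ} {W : WindowFlows gr}
  {C₂ : Type u₂} [Category.{v} C₂] {gr₂ : C₂ → ℤ} {F₂ : FlowStructure C₂ gr₂} {Ψ : C ⥤ C₂}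

instance (b a : C) : TopologicalSpace (Pi0 W b a) := ⊥

instance (b a : C) : DiscreteTopology (Pi0 W b a) := ⟨rfl⟩

/-- The class and the image in `C₂` of a morphism of `C₁`. -/
def CanHom.toProd {b a : C} (f : CanHom W F₂ Ψ b a) :
    Pi0 W b a × F₂.Mod (Ψ.obj b) (Ψ.obj a) := (f.cls, f.pt)

/-- The space of morphisms of `C₁` is the disjoint union, over the classes, of components of
moduli spaces of `C₂`. -/
instance CanHom.topologicalSpace (b a : C) : TopologicalSpace (CanHom W F₂ Ψ b a) :=
  TopologicalSpace.induced CanHom.toProd inferInstance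

/-- The map from the space of morphisms of `C₁` to a moduli space of `C₂`. -/
def CanHom.proj (b a : C) (f : CanHom W F₂ Ψ b a) : F₂.Mod (Ψ.obj b) (Ψ.obj a) := f.pt

namespace CanHom

theorem isEmbedding_toProd (b a : C) :
    Topology.IsEmbedding (toProd : CanHom W F₂ Ψ b a → _) :=
  ⟨⟨rfl⟩, fun _ _ h => CanHom.ext (congrArg Prod.fst h) (congrArg Prod.snd h)⟩

theorem continuous_cls (b a : C) : Continuous (cls : CanHom W F₂ Ψ b a → Pi0 W b a) :=
  continuous_fst.comp (isEmbedding_toProd b a).continuous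

theorem continuous_proj (b a : C) : Continuous (proj b a : CanHom W F₂ Ψ b a → _) :=
  continuous_snd.comp (isEmbedding_toProd b a).continuous

theorem cls_eq_of_connectedComponent_eq {b a : C} {f g : CanHom W F₂ Ψ b a}
    (h : connectedComponent f = connectedComponent g) : f.cls = g.cls := by
  have h' := (continuous_cls b a).connectedComponent_eq h
  rw [connectedComponent_eq_singleton, connectedComponent_eq_singleton] at h'
  exact singleton_injective h'

theorem continuous_of_toProd {Z : Type*} [TopologicalSpace Z] {b a : C}
    {f : Z → CanHom W F₂ Ψ b a} (h1 : Continuous fun z => (f z).cls)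
    (h2 : Continuous fun z => proj b a (f z)) : Continuous f :=
  (isEmbedding_toProd b a).continuous_iff.2 (h1.prodMk h2)

theorem isLocalHomeomorph_proj (b a : C) :
    IsLocalHomeomorph (proj b a : CanHom W F₂ Ψ b a → _) := by
  refine isLocalHomeomorph_iff_isOpenEmbedding_restrict.2 fun f => ?_
  have hU : IsOpen {g : CanHom W F₂ Ψ b a | g.cls = f.cls} :=
    (isOpen_discrete {f.cls}).preimage (continuous_cls b a)
  refine ⟨_, hU.mem_nhds rfl, ⟨⟨?_, ?_⟩, ?_⟩⟩
  · refine Topology.IsInducing.of_comp (g := fun x => ((f.cls, x) : Pi0 W b a × F₂.Mod _ _))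
      ((continuous_proj b a).comp continuous_subtype_val) (by fun_prop) ?_
    have : (fun x => ((f.cls, x) : Pi0 W b a × F₂.Mod _ _)) ∘
        domRestrict {g : CanHom W F₂ Ψ b a | g.cls = f.cls} (proj b a) = toProd ∘ Subtype.val := by
      funext g
      exact Prod.ext g.2.symm rfl
    rw [this]
    exact (isEmbedding_toProd b a).isInducing.comp Topology.IsInducing.subtypeVal
  · rintro ⟨g, hg⟩ ⟨g', hg'⟩ h
    exact Subtype.ext (CanHom.ext (hg.trans hg'.symm) h)
  · have : range (domRestrict {g : CanHom W F₂ Ψ b a | g.cls = f.cls} (proj b a)) =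
        carrier F₂ Ψ f.cls := by
      refine Set.ext fun x => ⟨?_, fun hx => ⟨⟨⟨f.cls, x, hx⟩, rfl⟩, rfl⟩⟩
      rintro ⟨⟨g, hg⟩, rfl⟩
      have := g.pt_mem
      rw [show g.cls = f.cls from hg] at this
      exact this
    rw [this]
    exact (isClopen_carrier f.cls).isOpen

instance t2Space (b a : C) : T2Space (CanHom W F₂ Ψ b a) :=
  (isEmbedding_toProd b a).t2Space

theorem compactSpace [Finite C] (hC : IsGluedFromWindows gr) (b a : C) :
    CompactSpace (CanHom W F₂ Ψ b a) := by
  have := finite_pi0 (W := W) hC b a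
  have hcl : Topology.IsClosedEmbedding (toProd : CanHom W F₂ Ψ b a → _) := by
    refine ⟨isEmbedding_toProd b a, ?_⟩
    have : range (toProd : CanHom W F₂ Ψ b a → _) =
        ⋃ κ, {κ} ×ˢ (show Set (F₂.Mod _ _) from carrier F₂ Ψ κ) := by
      refine Set.ext fun ⟨κ, x⟩ => ⟨?_, fun h => ?_⟩
      · rintro ⟨f, hf⟩
        obtain ⟨rfl, rfl⟩ := Prod.mk.inj hf
        exact mem_iUnion.2 ⟨_, rfl, f.pt_mem⟩
      · obtain ⟨κ', rfl, hx⟩ := mem_iUnion.1 h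
        exact ⟨⟨κ, x, hx⟩, rfl⟩
    rw [this]
    exact isClosed_iUnion_of_finite fun κ => isClosed_singleton.prod (isClopen_carrier κ).isClosed
  exact hcl.compactSpace

theorem continuous_comp (b z a : C) : Continuous fun t : CanHom W F₂ Ψ z a × CanHom W F₂ Ψ b z =>
    t.2.comp t.1 := by
  refine continuous_of_toProd ?_ ?_
  · exact (continuous_of_discreteTopology (f := fun t : Pi0 W b z × Pi0 W z a => t.1.comp W t.2)).comp
      (((continuous_cls b z).comp continuous_snd).prodMk ((continuous_cls z a).comp continuous_fst))
  · exact (F₂.continuous_comp _ _ _).comp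
      (((continuous_proj z a).comp continuous_fst).prodMk
        ((continuous_proj b z).comp continuous_snd))

end CanHom

variable (W F₂ Ψ)

/-- The grading of `C₁` that is pulled back from `C₂`. It agrees with that of `C`. -/
abbrev coverGr : Can W F₂ Ψ → ℤ := fun x => gr₂ ((canCover W F₂ Ψ).obj x)

/-- The dimensions of the moduli spaces of `C₁` are those of `C₂`. -/
theorem mdim_coverGr (x y : Can W F₂ Ψ) : mdim gr₂ ((canCover W F₂ Ψ).obj x)
    ((canCover W F₂ Ψ).obj y) = mdim (coverGr W F₂ Ψ) x y := rfl

/-- The charts and the faces of the moduli spaces of `C₁`, pulled back from `C₂`. -/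
@[reducible] noncomputable def canModuli : ModuliData (Can W F₂ Ψ) (coverGr W F₂ Ψ) where
  top x y := CanHom.topologicalSpace (W := W) (F₂ := F₂) (Ψ := Ψ) x y
  charts x y := @IsLocalHomeomorph.pullbackQuadrant _ _ _ _ _
    (CanHom.topologicalSpace (W := W) (F₂ := F₂) (Ψ := Ψ) x y) _ _
    (CanHom.isLocalHomeomorph_proj (W := W) (F₂ := F₂) (Ψ := Ψ) x y) (mdim_coverGr W F₂ Ψ x y)
  face := canFace W F₂ Ψ

/-- The map of moduli spaces given by the functor from `C₁` to `C₂`. -/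
def canMap (x y : Can W F₂ Ψ) : (canModuli W F₂ Ψ).Mod x y →
    F₂.Mod ((canCover W F₂ Ψ).obj x) ((canCover W F₂ Ψ).obj y) :=
  fun f => CanHom.proj (W := W) (F₂ := F₂) (Ψ := Ψ) x y f

theorem isLocalHomeomorph_canMap (x y : Can W F₂ Ψ) : IsLocalHomeomorph (canMap W F₂ Ψ x y) :=
  CanHom.isLocalHomeomorph_proj (W := W) (F₂ := F₂) (Ψ := Ψ) x y

instance (x y : Can W F₂ Ψ) :
    IsManifold (mmodel (coverGr W F₂ Ψ) x y) ∞ ((canModuli W F₂ Ψ).Mod x y) :=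
  have := F₂.smooth ((canCover W F₂ Ψ).obj x) ((canCover W F₂ Ψ).obj y)
  (isLocalHomeomorph_canMap W F₂ Ψ x y).isManifold_pullbackQuadrant (mdim_coverGr W F₂ Ψ x y)

instance (x y : Can W F₂ Ψ) : T2Space ((canModuli W F₂ Ψ).Mod x y) :=
  CanHom.t2Space (W := W) (F₂ := F₂) (Ψ := Ψ) x y

theorem isLocalDiffeomorph_canMap (x y : Can W F₂ Ψ) :
    IsLocalDiffeomorph (mmodel (coverGr W F₂ Ψ) x y)
      (mmodel gr₂ ((canCover W F₂ Ψ).obj x) ((canCover W F₂ Ψ).obj y)) ∞ (canMap W F₂ Ψ x y) :=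
  have := F₂.smooth ((canCover W F₂ Ψ).obj x) ((canCover W F₂ Ψ).obj y)
  (isLocalHomeomorph_canMap W F₂ Ψ x y).isLocalDiffeomorph_pullbackQuadrant
    (mdim_coverGr W F₂ Ψ x y)

variable {W F₂ Ψ}

namespace GluingData

theorem coverGr_eq (D : GluingData W F₂ Ψ) (x : Can W F₂ Ψ) :
    coverGr W F₂ Ψ x = canGr W F₂ Ψ x := D.gr_obj x

theorem hasComponentSections_canMap [Finite C] (D : GluingData W F₂ Ψ) (x y : Can W F₂ Ψ) :
    HasComponentSections (canMap W F₂ Ψ x y) :=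
  have : CompactSpace ((canModuli W F₂ Ψ).Mod x y) :=
    CanHom.compactSpace (W := W) (F₂ := F₂) (Ψ := Ψ) D.glued x y
  (isLocalHomeomorph_canMap W F₂ Ψ x y).hasComponentSections_of_disc (D.isDisc _ _)

theorem isFaceCategory_coverGr (D : GluingData W F₂ Ψ) :
    IsFaceCategory (coverGr W F₂ Ψ) (canFace W F₂ Ψ) := by
  have h : coverGr W F₂ Ψ = canGr W F₂ Ψ := funext D.coverGr_eq
  rw [h]
  exact D.isFaceCategory

theorem uniqueFactorization_coverGr [Finite C] (D : GluingData W F₂ Ψ)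
    (ht : TrivialCoverings W F₂ Ψ) (x y : Can W F₂ Ψ) :
    UniqueFactorization (coverGr W F₂ Ψ) (canFace W F₂ Ψ) x y := by
  have h : coverGr W F₂ Ψ = canGr W F₂ Ψ := funext D.coverGr_eq
  rw [h]
  exact D.uniqueFactorization ht x y

/-- The flow category that extends the glued windows. -/
noncomputable def canFlow [Finite C] (D : GluingData W F₂ Ψ) (ht : TrivialCoverings W F₂ Ψ) :
    FlowStructure (Can W F₂ Ψ) (coverGr W F₂ Ψ) where
  toModuliData := canModuli W F₂ Ψ
  finite := inferInstanceAs (Finite C)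
  hom_self := D.isFaceCategory_coverGr.eq_id
  hom_empty x y hne hxy := ⟨fun f => (D.isFaceCategory_coverGr.gr_lt f hne).not_ge hxy⟩
  t2 x y := inferInstance
  compact x y := CanHom.compactSpace (W := W) (F₂ := F₂) (Ψ := Ψ) D.glued x y
  smooth x y := inferInstance
  withFaces x y := (isLocalHomeomorph_canMap W F₂ Ψ x y).isManifoldWithFaces_pullbackQuadrant
    (mdim_coverGr W F₂ Ψ x y) (D.hasComponentSections_canMap x y) (F₂.withFaces _ _)
  faceStructure x y := (isLocalHomeomorph_canMap W F₂ Ψ x y).isFaceStructure_pullbackQuadrant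
    (mdim_coverGr W F₂ Ψ x y) (D.hasComponentSections_canMap x y) (F₂.faceStructure _ _)
  comp_embedding x z y h1 h2 := by
    have : CompactSpace ((canModuli W F₂ Ψ).Mod z y) :=
      CanHom.compactSpace (W := W) (F₂ := F₂) (Ψ := Ψ) D.glued z y
    have : CompactSpace ((canModuli W F₂ Ψ).Mod x z) :=
      CanHom.compactSpace (W := W) (F₂ := F₂) (Ψ := Ψ) D.glued x z
    have := F₂.smooth ((canCover W F₂ Ψ).obj x) ((canCover W F₂ Ψ).obj y)
    have := F₂.smooth ((canCover W F₂ Ψ).obj x) ((canCover W F₂ Ψ).obj z)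
    have := F₂.smooth ((canCover W F₂ Ψ).obj z) ((canCover W F₂ Ψ).obj y)
    have hc : Continuous ((canModuli W F₂ Ψ).comp x z y) :=
      CanHom.continuous_comp (W := W) (F₂ := F₂) (Ψ := Ψ) x z y
    -- an injective continuous map of compact Hausdorff spaces is an embedding; that the composition
    -- is an immersion follows from the corresponding fact in `C₂`
    refine ⟨?_, (hc.isClosedEmbedding ?_).isEmbedding⟩
    · exact (F₂.comp_embedding _ _ _ h1 h2).isImmersion.lift_quadrant
        (mdim_coverGr W F₂ Ψ x y) (mdim_coverGr W F₂ Ψ z y) (mdim_coverGr W F₂ Ψ x z)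
        (isLocalDiffeomorph_canMap W F₂ Ψ x y) (isLocalDiffeomorph_canMap W F₂ Ψ z y)
        (isLocalDiffeomorph_canMap W F₂ Ψ x z) hc fun _ => rfl
    · rintro ⟨v, u⟩ ⟨v', u'⟩ h
      have := D.isFaceCategory_coverGr.sigma_eq (D.uniqueFactorization_coverGr ht x y)
        (u := u) (v := v) (u' := u') (v' := v') h rfl h1 h2
      obtain ⟨rfl, rfl⟩ := Prod.mk.inj (eq_of_heq (Sigma.mk.inj this).2)
      rfl
  comp_mem x z y m h1 h2 h3 := by
    rintro _ ⟨⟨v, u⟩, rfl⟩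
    exact D.isFaceCategory_coverGr.comp_mem u v m h1 h2 h3
  comp_face_lt x z y m h1 h2 h3 i hi := Set.ext fun ⟨v, u⟩ =>
    D.isFaceCategory_coverGr.comp_lt u v m h1 h2 h3 i hi
  comp_face_gt x z y m h1 h2 h3 i hi := Set.ext fun ⟨v, u⟩ =>
    D.isFaceCategory_coverGr.comp_gt u v m h1 h2 h3 i hi
  face_eq x y i hxy h1 h2 := by
    have h3 : coverGr W F₂ Ψ y + i < coverGr W F₂ Ψ x := by unfold mdim at h2; omega
    refine Set.ext fun f => ⟨fun hf => ?_, fun hf => ?_⟩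
    · obtain ⟨z, u, v, hz, h⟩ := (D.uniqueFactorization_coverGr ht x y).exists_comp h1 h3 hf
      exact mem_iUnion₂.2 ⟨z, hz, (v, u), h⟩
    · obtain ⟨z, hz, ⟨v, u⟩, rfl⟩ := mem_iUnion₂.1 hf
      exact D.isFaceCategory_coverGr.comp_mem u v i h1 hz (hz.trans_lt h3)
  face_disjoint x y i hxy h1 h2 := by
    have h3 : coverGr W F₂ Ψ y + i < coverGr W F₂ Ψ x := by unfold mdim at h2; omega
    intro z hz z' hz' hne
    refine disjoint_left.2 ?_
    rintro _ ⟨⟨v, u⟩, rfl⟩ ⟨⟨v', u'⟩, h⟩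
    simp only [mem_ofPred_eq] at hz hz'
    have := D.isFaceCategory_coverGr.sigma_eq (D.uniqueFactorization_coverGr ht x y)
      (u := u) (v := v) (u' := u') (v' := v') h.symm (hz.trans hz'.symm) (by omega) (by omega)
    exact hne (Sigma.mk.inj this).1

theorem isFlowMorphism_canCover [Finite C] (D : GluingData W F₂ Ψ)
    (ht : TrivialCoverings W F₂ Ψ) : IsFlowMorphism (D.canFlow ht) F₂ (canCover W F₂ Ψ) :=
  ⟨fun _ => rfl, isLocalDiffeomorph_canMap W F₂ Ψ⟩

theorem continuous_of_window (D : GluingData W F₂ Ψ) {i : ℤ} {x y : C} (hx : InWindow gr i x) (hy : InWindow gr i y) :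
    Continuous fun f : (W i).Mod ⟨x, hx⟩ ⟨y, hy⟩ =>
      (CanHom.of (InducedCategory.Hom.hom f) : CanHom W F₂ Ψ x y) := by
  refine CanHom.continuous_of_toProd ?_ ?_
  · refine continuous_discrete_rng.2 fun κ => (isClopen_of_connectedComponent_eq ?_).isOpen
    intro f g h hf
    exact (pi0_eq_of_component_windowHom_eq hx hy h).symm.trans hf
  · exact ((D.flowMorphism i).isLocalHomeomorph ⟨x, hx⟩ ⟨y, hy⟩).continuous

theorem isFlowMorphism_canIncl [Finite C] (D : GluingData W F₂ Ψ)
    (ht : TrivialCoverings W F₂ Ψ) (i : ℤ) : IsFlowMorphism (W i) (D.canFlow ht)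
    ((InWindow gr i).ι ⋙ canIncl W F₂ Ψ) where
  gr_obj x := D.gr_obj x.obj
  localDiffeo x y := IsLocalDiffeomorph.of_comp_left
    (p := canMap W F₂ Ψ (((InWindow gr i).ι ⋙ canIncl W F₂ Ψ).obj x)
      (((InWindow gr i).ι ⋙ canIncl W F₂ Ψ).obj y)) (isLocalDiffeomorph_canMap W F₂ Ψ _ _)
    (D.continuous_of_window x.2 y.2) ((D.flowMorphism i).localDiffeo x y)

theorem isFlowIsoOnto_canIncl [Finite C] (D : GluingData W F₂ Ψ)
    (ht : TrivialCoverings W F₂ Ψ) (i : ℤ) : IsFlowIsoOnto (W i) (D.canFlow ht)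
    ((InWindow gr i).ι ⋙ canIncl W F₂ Ψ) {x | i ≤ coverGr W F₂ Ψ x ∧ coverGr W F₂ Ψ x ≤ i + 2} where
  isFlowMorphism := D.isFlowMorphism_canIncl ht i
  obj_injective x y h := ObjectProperty.FullSubcategory.ext h
  obj_range := by
    refine Set.ext fun x => ⟨?_, fun ⟨h1, h2⟩ => ⟨⟨x, ?_⟩, rfl⟩⟩
    · rintro ⟨⟨x, h1, h2⟩, rfl⟩
      exact ⟨h1.trans (D.gr_obj x).ge, (D.gr_obj x).le.trans h2⟩
    · exact ⟨h1.trans (D.coverGr_eq x).le, (D.coverGr_eq x).ge.trans h2⟩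
  map_bijective x y := by
    have h : gr x.obj ≤ gr y.obj + 2 := by have := x.2.2; have := y.2.1; omega
    have h1 := D.of_bijective h
    exact ⟨fun f g hfg => InducedCategory.hom_ext (h1.1 hfg), fun f =>
      let ⟨f₀, hf₀⟩ := h1.2 f
      ⟨windowHom x.2 y.2 f₀, hf₀⟩⟩
  map_face x y j := Set.ext fun f => (D.isFlowMorphism_canIncl ht i).map_mem_face_iff f j

/-- A morphism of `C` that lies in `∂ᵢ` factors in `C`. -/
theorem exists_comp_of_mem_face [Finite C] (D : GluingData W F₂ Ψ) (ht : TrivialCoverings W F₂ Ψ)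
    {b a : C} (f : b ⟶ a) {i : ℕ} (h1 : 1 ≤ i) (h2 : gr a + i < gr b)
    (hf : (canIncl W F₂ Ψ).map f ∈ canFace W F₂ Ψ b a i) :
    ∃ (z : C) (u : b ⟶ z) (v : z ⟶ a), gr z = gr a + i ∧ u ≫ v = f := by
  have key : ∀ N : ℕ, ∀ b a : C, gr b - gr a < N → ∀ (f : b ⟶ a) (i : ℕ), 1 ≤ i →
      gr a + i < gr b → (canIncl W F₂ Ψ).map f ∈ canFace W F₂ Ψ b a i →
      ∃ (z : C) (u : b ⟶ z) (v : z ⟶ a), gr z = gr a + i ∧ u ≫ v = f := by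
    intro N
    induction N with
    | zero =>
      intro b a h f i h1 h2
      push_cast at h
      omega
    | succ N ih =>
      intro b a h f i h1 h2 hf
      push_cast at h
      by_cases h3 : gr b ≤ gr a + 2
      · obtain ⟨z, u, v, hz, hc⟩ := (D.uniqueFactorization ht b a).exists_comp h1 h2 hf
        change gr z = gr a + i at hz
        obtain ⟨u, rfl⟩ := (D.of_bijective (b := b) (a := z) (by omega)).2 u
        obtain ⟨v, rfl⟩ := (D.of_bijective (b := z) (a := a) (by omega)).2 v
        exact ⟨z, u, v, hz, (D.of_bijective h3).1 ((CanHom.of_comp W F₂ Ψ u v).trans hc)⟩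
      · obtain ⟨z, u, v, hz, hz', rfl⟩ := exists_comp_of_three_le W D.glued f (by omega)
        obtain ⟨j, hj⟩ := Int.le.dest hz.le
        rw [Functor.map_comp] at hf
        rcases lt_trichotomy i j with hij | rfl | hij
        · have hf' := (D.isFaceCategory.comp_lt ((canIncl W F₂ Ψ).map u) ((canIncl W F₂ Ψ).map v) j
            (by omega) hj.symm hz' i hij).1 hf
          obtain ⟨w, p, q, hw, rfl⟩ := ih z a (by omega) v i h1 (by omega) hf'
          exact ⟨w, u ≫ p, q, hw, Category.assoc _ _ _⟩
        · exact ⟨z, u, v, hj.symm, rfl⟩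
        · have hf' := (D.isFaceCategory.comp_gt ((canIncl W F₂ Ψ).map u) ((canIncl W F₂ Ψ).map v) j
            (by omega) hj.symm hz' i hij).1 hf
          obtain ⟨w, p, q, hw, rfl⟩ := ih b z (by omega) u (i - j) (by omega) (by omega) hf'
          exact ⟨w, p, q ≫ v, by omega, (Category.assoc _ _ _).symm⟩
  exact key ((gr b - gr a).toNat + 1) b a (by push_cast; omega) f i h1 h2 hf

/-- The functor from `C` to `C₁` is injective on morphisms: a morphism of `C` of degree at least three
is a composition in `C`, so by unique factorization in `C₁` this reduces to smaller degrees. -/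
theorem faithful_canIncl [Finite C] (D : GluingData W F₂ Ψ) (ht : TrivialCoverings W F₂ Ψ) :
    (canIncl W F₂ Ψ).Faithful := by
  have key : ∀ N : ℕ, ∀ b a : C, gr b - gr a < N →
      Function.Injective (CanHom.of : (b ⟶ a) → CanHom W F₂ Ψ b a) := by
    intro N
    induction N with
    | zero =>
      intro b a h f
      have := gr_le_of_hom W D.glued f
      push_cast at h
      omega
    | succ N ih =>
      intro b a h f g hfg
      push_cast at h
      by_cases h3 : gr b ≤ gr a + 2
      · exact (D.of_bijective h3).1 hfg
      · obtain ⟨z, u, v, hz, hz', rfl⟩ := exists_comp_of_three_le W D.glued f (by omega)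
        obtain ⟨j, hj⟩ := Int.le.dest hz.le
        have hg : (canIncl W F₂ Ψ).map g ∈ canFace W F₂ Ψ b a j := by
          have h4 := D.isFaceCategory.comp_mem ((canIncl W F₂ Ψ).map u) ((canIncl W F₂ Ψ).map v) j
            (by omega) hj.symm hz'
          rw [← Functor.map_comp] at h4
          exact Eq.mp (congrArg (· ∈ canFace W F₂ Ψ b a j) hfg) h4
        obtain ⟨w, u', v', hw, rfl⟩ := D.exists_comp_of_mem_face ht g (by omega) (by omega) hg
        have h5 := D.isFaceCategory.sigma_eq (D.uniqueFactorization ht b a)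
          (u := (canIncl W F₂ Ψ).map u) (v := (canIncl W F₂ Ψ).map v)
          (u' := (canIncl W F₂ Ψ).map u') (v' := (canIncl W F₂ Ψ).map v')
          (((CanHom.of_comp W F₂ Ψ u v).symm.trans hfg).trans (CanHom.of_comp W F₂ Ψ u' v')) (hj.symm.trans hw.symm) hz hz'
        obtain ⟨h6, h7⟩ := Sigma.mk.inj h5
        obtain rfl : z = w := h6
        obtain ⟨h8, h9⟩ := Prod.mk.inj (eq_of_heq h7)
        rw [ih b z (by omega) h8, ih z a (by omega) h9]
  exact ⟨fun {b a} f g h => key ((gr b - gr a).toNat + 1) b a (by push_cast; omega) h⟩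

/-- The canonical extension. -/
noncomputable def extension [Finite C] (D : GluingData W F₂ Ψ) (ht : TrivialCoverings W F₂ Ψ) :
    DiscCoverExtension W F₂ Ψ where
  C₁ := Can W F₂ Ψ
  gr₁ := coverGr W F₂ Ψ
  flow := D.canFlow ht
  cover := canCover W F₂ Ψ
  isDiscCover := ⟨D.isFlowMorphism_canCover ht, D.isDisc⟩
  incl := canIncl W F₂ Ψ
  incl_obj := Function.bijective_id
  incl_gr := D.gr_obj
  incl_faithful := D.faithful_canIncl ht
  incl_window := D.isFlowIsoOnto_canIncl ht
  incl_cover := rfl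

end GluingData

end CanonicalTopology

end FlowCat

/-! ### Extensions of the windows -/

section Components

variable {X Y : Type*} [TopologicalSpace X] [TopologicalSpace Y] {p : Y → X}

theorem HasComponentSections.nonempty_homeomorph (hp : HasComponentSections p) (hc : Continuous p)
    (y : Y) : Nonempty (connectedComponent y ≃ₜ connectedComponent (p y)) := by
  obtain ⟨s, h1, h2, h3⟩ := hp y
  refine ⟨{ toFun := fun z => ⟨p z, hc.mapsTo_connectedComponent y z.2⟩
            invFun := fun x => ⟨s x, h3 ▸ mem_range_self x⟩
            left_inv := fun z => ?_
            right_inv := fun x => Subtype.ext (h2 x)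
            continuous_toFun := by fun_prop
            continuous_invFun := by fun_prop }⟩
  obtain ⟨z, hz⟩ := z
  obtain ⟨x, rfl⟩ : z ∈ range s := h3 ▸ hz
  refine Subtype.ext (congrArg s (Subtype.ext (h2 x)))

end Components

namespace FlowCat

section Morphisms

variable {C : Type u} [Category.{v} C] {gr : C → ℤ} {C₂ : Type u₂} [Category.{v₂} C₂] {gr₂ : C₂ → ℤ}
  {F : FlowStructure C gr} {F₂ : FlowStructure C₂ gr₂} {H : C ⥤ C₂}

theorem IsFlowMorphism.isDisc (h : IsFlowMorphism F F₂ H) (hF₂ : F₂.IsDisc) : F.IsDisc := by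
  intro x y f
  obtain ⟨φ⟩ := (h.hasComponentSections hF₂ x y).nonempty_homeomorph
    (h.isLocalHomeomorph x y).continuous f
  obtain ⟨ψ⟩ := hF₂ _ _ (modMap F F₂ H x y f)
  have hd : mdim gr x y = mdim gr₂ (H.obj x) (H.obj y) := by
    unfold mdim; rw [h.gr_obj, h.gr_obj]
  rw [hd]
  exact ⟨φ.trans ψ⟩

theorem IsFlowIsoOnto.component_eq {S : Set C₂} (h : IsFlowIsoOnto F F₂ H S) {x y : C} {f g : x ⟶ y}
    (hfg : F₂.component (H.map f) = F₂.component (H.map g)) : F.component f = F.component g := by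
  let φ := (h.isFlowMorphism.isLocalHomeomorph x y).toHomeomorphOfBijective (h.map_bijective x y)
  have h1 := φ.symm.continuous.connectedComponent_eq hfg
  have h2 : ∀ f : F.Mod x y, φ.symm (modMap F F₂ H x y f) = f := φ.symm_apply_apply
  exact (congrArg connectedComponent (h2 f).symm).trans (h1.trans (congrArg connectedComponent (h2 g)))

/-- A component of positive dimension which is a disc contains an edge. -/
theorem FlowStructure.exists_isEdge (hF : F.IsDisc) {x y : C} (f : x ⟶ y) (h : gr y + 2 ≤ gr x) :
    ∃ g : x ⟶ y, F.component g = F.component f ∧ F.IsEdge g := by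
  obtain ⟨θ, -, hr⟩ := F.exists_isOpenEmbedding_sphere hF f
  have : Nonempty (Fin (mdim gr x y)) := ⟨⟨0, by unfold mdim; omega⟩⟩
  obtain ⟨q, hq⟩ := (NormedSpace.sphere_nonempty (E := EuclideanSpace ℝ (Fin (mdim gr x y)))
    (x := 0) (r := 1)).2 zero_le_one
  let s := θ ⟨q, hq⟩
  exact ⟨s.1, hr.subset (mem_range_self _), (F.mem_bdry_iff _).1 s.2⟩

/-- The edges of a disc of dimension at least two form a connected space. -/
theorem FlowStructure.isPreconnected_isEdge (hF : F.IsDisc) {x y : C} (f : x ⟶ y)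
    (h : gr y + 3 ≤ gr x) : IsPreconnected {s : bdry (mdim gr x y) (F.Mod x y) |
      F.component s.1 = F.component f} := by
  obtain ⟨θ, hθ, hr⟩ := F.exists_isOpenEmbedding_sphere hF f
  have hrank : 1 < Module.rank ℝ (EuclideanSpace ℝ (Fin (mdim gr x y))) := by
    rw [← Module.finrank_eq_rank, finrank_euclideanSpace_fin]
    unfold mdim
    exact_mod_cast (by omega : 1 < (gr x - gr y - 1).toNat)
  have := isPreconnected_iff_preconnectedSpace.1
    (isPreconnected_sphere hrank (0 : EuclideanSpace ℝ (Fin (mdim gr x y))) 1)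
  rw [← hr]
  exact isPreconnected_range hθ.continuous

end Morphisms

section Extensions

variable {C : Type u} [Category.{v} C] {gr : C → ℤ} {C₂ : Type u₂} [Category.{v} C₂] {gr₂ : C₂ → ℤ}
  {A : Type u} [Category.{v} A] {grA : A → ℤ}

/-- The functors `I` and `P` exhibit the flow category `A` as an extension of the windows of `C`,
and as a cover of `C₂`. -/
structure IsExtension (W : WindowFlows gr) (F : FlowStructure A grA) (F₂ : FlowStructure C₂ gr₂)
    (I : C ⥤ A) (P : A ⥤ C₂) : Prop where
  gluingData : GluingData W F₂ (I ⋙ P)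
  cover : IsFlowMorphism F F₂ P
  obj_surjective : Function.Surjective I.obj
  gr_obj : ∀ x, grA (I.obj x) = gr x
  window : ∀ i : ℤ, IsFlowIsoOnto (W i) F ((InWindow gr i).ι ⋙ I)
    {x | i ≤ grA x ∧ grA x ≤ i + 2}

namespace IsExtension

variable {W : WindowFlows gr} {F : FlowStructure A grA} {F₂ : FlowStructure C₂ gr₂}
    {I : C ⥤ A} {P : A ⥤ C₂}

theorem isDisc (h : IsExtension W F F₂ I P) : F.IsDisc := h.cover.isDisc h.gluingData.isDisc

theorem component_eq_of_pi0_eq (h : IsExtension W F F₂ I P) {b a : C} {f g : b ⟶ a}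
    (hfg : pi0 W f = pi0 W g) : F.component (I.map f) = F.component (I.map g) :=
  component_map_eq_of_pi0_eq (fun i => (h.window i).isFlowMorphism) hfg

/-- Every component of a moduli space of `A` contains a morphism of `C`. -/
theorem exists_component_eq (h : IsExtension W F F₂ I P) {b a : C} (f : I.obj b ⟶ I.obj a) :
    ∃ f₀ : b ⟶ a, F.component (I.map f₀) = F.component f := by
  have key : ∀ N : ℕ, ∀ b a : C, gr b - gr a < N → ∀ f : I.obj b ⟶ I.obj a,
      ∃ f₀ : b ⟶ a, F.component (I.map f₀) = F.component f := by
    intro N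
    induction N with
    | zero =>
      intro b a hN f
      have h1 := F.isFaceCategory.gr_le f
      rw [h.gr_obj, h.gr_obj] at h1
      push_cast at hN
      omega
    | succ N ih =>
      intro b a hN f
      push_cast at hN
      have h1 := F.isFaceCategory.gr_le f
      have hb := h.gr_obj b
      have ha := h.gr_obj a
      by_cases h3 : gr b ≤ gr a + 2
      · obtain ⟨f₀, hf₀⟩ := ((h.window (gr a)).map_bijective ⟨b, by constructor <;> omega⟩
          ⟨a, by constructor <;> omega⟩).2 f
        exact ⟨InducedCategory.Hom.hom f₀, congrArg (F.component) hf₀⟩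
      -- move to an edge of the disc, factor it, and move the factors into `C`
      · obtain ⟨g, hg, hg'⟩ := F.exists_isEdge h.isDisc f (by omega)
        obtain ⟨i, hi, hi', hgi⟩ := (F.isEdge_iff g).1 hg'
        obtain ⟨z, u, v, hz, rfl⟩ := (F.mem_face_iff hi hi' g).1 hgi
        obtain ⟨z, rfl⟩ := h.obj_surjective z
        rw [h.gr_obj] at hz
        obtain ⟨u₀, hu₀⟩ := ih b z (by omega) u
        obtain ⟨v₀, hv₀⟩ := ih z a (by omega) v
        refine ⟨u₀ ≫ v₀, ?_⟩
        rw [I.map_comp, F.component_comp hu₀ hv₀, hg]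
  exact key ((gr b - gr a).toNat + 1) b a (by push_cast; omega) f

/-- The edge `g` of a moduli space of `A` is a composition of morphisms in the components of
morphisms of `C` whose composition has the class `κ`. -/
def EdgeClass (W : WindowFlows gr) (F : FlowStructure A grA) (I : C ⥤ A) {b a : C}
    (g : I.obj b ⟶ I.obj a) (κ : Pi0 W b a) : Prop :=
  ∃ (z : C) (u : I.obj b ⟶ I.obj z) (v : I.obj z ⟶ I.obj a) (u₀ : b ⟶ z) (v₀ : z ⟶ a),
    gr a < gr z ∧ gr z < gr b ∧ u ≫ v = g ∧ F.component (I.map u₀) = F.component u ∧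
      F.component (I.map v₀) = F.component v ∧ pi0 W (u₀ ≫ v₀) = κ

theorem exists_edgeClass (h : IsExtension W F F₂ I P) {b a : C} (g : I.obj b ⟶ I.obj a)
    (hg : F.IsEdge g) : ∃ κ, EdgeClass W F I g κ := by
  obtain ⟨i, hi, hi', hgi⟩ := (F.isEdge_iff g).1 hg
  obtain ⟨z, u, v, hz, rfl⟩ := (F.mem_face_iff hi hi' g).1 hgi
  obtain ⟨z, rfl⟩ := h.obj_surjective z
  obtain ⟨u₀, hu₀⟩ := h.exists_component_eq u
  obtain ⟨v₀, hv₀⟩ := h.exists_component_eq v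
  rw [h.gr_obj, h.gr_obj] at hz hi'
  exact ⟨_, z, u, v, u₀, v₀, by omega, by omega, rfl, hu₀, hv₀, rfl⟩

/-- In degrees below that of `b ⟶ a`, morphisms of `C` in the same component of a moduli space of
`A` have the same class. -/
def LowerClasses (W : WindowFlows gr) (F : FlowStructure A grA) (I : C ⥤ A) (N : ℤ) : Prop :=
  ∀ x y : C, gr x - gr y < N → ∀ f g : x ⟶ y,
    F.component (I.map f) = F.component (I.map g) → pi0 W f = pi0 W g

theorem EdgeClass.unique (h : IsExtension W F F₂ I P) {b a : C}
    (hL : LowerClasses W F I (gr b - gr a)) {g : I.obj b ⟶ I.obj a} {κ κ' : Pi0 W b a}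
    (hκ : EdgeClass W F I g κ) (hκ' : EdgeClass W F I g κ') : κ = κ' := by
  have key : ∀ {z z' : C} {u : I.obj b ⟶ I.obj z} {v : I.obj z ⟶ I.obj a}
      {u' : I.obj b ⟶ I.obj z'} {v' : I.obj z' ⟶ I.obj a} {u₀ : b ⟶ z} {v₀ : z ⟶ a}
      {u₀' : b ⟶ z'} {v₀' : z' ⟶ a}, gr a < gr z' → gr z' ≤ gr z → gr z < gr b →
      u ≫ v = u' ≫ v' → F.component (I.map u₀) = F.component u →
      F.component (I.map v₀) = F.component v → F.component (I.map u₀') = F.component u' →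
      F.component (I.map v₀') = F.component v' → pi0 W (u₀ ≫ v₀) = pi0 W (u₀' ≫ v₀') := by
    intro z z' u v u' v' u₀ v₀ u₀' v₀' h1 h2 h3 hc hu hv hu' hv'
    obtain ⟨l, rfl, rfl⟩ := F.isFaceCategory.exists_lift (F.uniqueFactorization _ _)
      (F.uniqueFactorization _ _) hc (by rwa [h.gr_obj, h.gr_obj])
    obtain ⟨l₀, hl₀⟩ := h.exists_component_eq l
    have h4 : pi0 W (u₀ ≫ l₀) = pi0 W u₀' := hL b z' (by omega) _ _ (by
      rw [I.map_comp, hu']; exact F.component_comp hu hl₀)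
    have h5 : pi0 W (l₀ ≫ v₀') = pi0 W v₀ := hL z a (by omega) _ _ (by
      rw [I.map_comp, hv]; exact F.component_comp hl₀ hv')
    rw [pi0_comp W u₀ v₀, ← h5, ← pi0_comp, ← Category.assoc, pi0_comp W _ v₀', h4, ← pi0_comp]
  obtain ⟨z, u, v, u₀, v₀, h1, h2, rfl, h3, h4, rfl⟩ := hκ
  obtain ⟨z', u', v', u₀', v₀', h1', h2', hc, h3', h4', rfl⟩ := hκ'
  rcases le_total (gr z') (gr z) with hz | hz
  · exact key h1' hz h2 hc.symm h3 h4 h3' h4'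
  · exact (key h1 hz h2' hc h3' h4' h3 h4).symm

theorem edgeClass_eventually [Finite C] (h : IsExtension W F F₂ I P) {b a : C}
    (hL : LowerClasses W F I (gr b - gr a)) {g : F.Mod (I.obj b) (I.obj a)} {κ : Pi0 W b a}
    (hκ : EdgeClass W F I (b := b) (a := a) g κ) :
    ∀ᶠ g' : F.Mod (I.obj b) (I.obj a) in 𝓝 g, F.IsEdge (x := I.obj b) (y := I.obj a) g' →
      EdgeClass W F I (b := b) (a := a) g' κ := by
  have : Finite A := Finite.of_surjective _ h.obj_surjective
  filter_upwards [F.eventually_exists_comp g] with g' hg' he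
  obtain ⟨i, hi, hi', hgi⟩ := (F.isEdge_iff _).1 he
  obtain ⟨-, z, u, u', v, v', hz, hc, hc', hu, hv⟩ := hg' i hi hi' hgi
  obtain ⟨z, rfl⟩ := h.obj_surjective z
  obtain ⟨u₀, hu₀⟩ := h.exists_component_eq u
  obtain ⟨v₀, hv₀⟩ := h.exists_component_eq v
  rw [h.gr_obj, h.gr_obj] at hz hi'
  have h1 : EdgeClass W F I g (pi0 W (u₀ ≫ v₀)) :=
    ⟨z, u, v, u₀, v₀, by omega, by omega, hc, hu₀, hv₀, rfl⟩
  rw [hκ.unique h hL h1]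
  exact ⟨z, u', v', u₀, v₀, by omega, by omega, hc', hu₀.trans hu.symm, hv₀.trans hv.symm, rfl⟩

/-- Morphisms of `C` in the same component of a moduli space of `A` have the same class: the class
is locally constant on the boundary sphere of the component. -/
theorem pi0_eq_of_component_eq [Finite C] (h : IsExtension W F F₂ I P) {b a : C} {f g : b ⟶ a}
    (hfg : F.component (I.map f) = F.component (I.map g)) : pi0 W f = pi0 W g := by
  have key : ∀ N : ℕ, LowerClasses W F I N := by
    intro N
    induction N with
    | zero =>
      intro b a hN f
      have := gr_le_of_hom W h.gluingData.glued f
      push_cast at hN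
      omega
    | succ N ih =>
      intro b a hN f g hfg
      push_cast at hN
      by_cases h3 : gr b ≤ gr a + 2
      · have hb : InWindow gr (gr a) b := ⟨gr_le_of_hom W h.gluingData.glued f, h3⟩
        have ha : InWindow gr (gr a) a := ⟨le_rfl, by omega⟩
        exact pi0_eq_of_component_windowHom_eq hb ha ((h.window (gr a)).component_eq
          (f := windowHom hb ha f) (g := windowHom hb ha g) hfg)
      · have hL : LowerClasses W F I (gr b - gr a) := fun x y hxy => ih x y (by omega)
        have hex : ∀ f : b ⟶ a, F.IsEdge (I.map f) ∧ EdgeClass W F I (I.map f) (pi0 W f) := by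
          intro f
          obtain ⟨z, u, v, hz, hz', rfl⟩ := exists_comp_of_three_le W h.gluingData.glued f (by omega)
          rw [I.map_comp]
          exact ⟨F.isEdge_comp _ _ (by rwa [h.gr_obj, h.gr_obj]) (by rwa [h.gr_obj, h.gr_obj]),
            z, I.map u, I.map v, u, v, hz, hz', rfl, rfl, rfl, rfl⟩
        have hclass : ∀ s : bdry (mdim grA (I.obj b) (I.obj a)) (F.Mod (I.obj b) (I.obj a)),
            ∃ κ, EdgeClass W F I (b := b) (a := a) s.1 κ := fun s =>
          h.exists_edgeClass _ ((F.mem_bdry_iff _).1 s.2)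
        choose κ hκ using hclass
        -- the class of the edges is locally constant on the sphere of edges, which is connected
        have hcont : IsLocallyConstant κ := by
          refine (IsLocallyConstant.iff_eventually_eq κ).2 fun s => ?_
          filter_upwards [continuous_subtype_val.continuousAt.eventually
            (h.edgeClass_eventually hL (hκ s))] with s' hs'
          exact (hκ s').unique h hL (hs' ((F.mem_bdry_iff _).1 s'.2))
        have hpre := F.isPreconnected_isEdge h.isDisc (I.map f)
          (by rw [h.gr_obj, h.gr_obj]; omega)
        have hf := (F.mem_bdry_iff (I.map f)).2 (hex f).1
        have hg := (F.mem_bdry_iff (I.map g)).2 (hex g).1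
        have h4 := hcont.apply_eq_of_isPreconnected hpre (x := ⟨I.map f, hf⟩) (y := ⟨I.map g, hg⟩)
          rfl hfg.symm
        exact ((hex f).2.unique h hL (hκ ⟨I.map f, hf⟩)).trans
          (h4.trans ((hκ ⟨I.map g, hg⟩).unique h hL (hex g).2))
  exact key ((gr b - gr a).toNat + 1) b a (by push_cast; omega) f g hfg

/-- A morphism of `C₁` corresponds to exactly one morphism of `A` with the same class and the same
image in `C₂`. -/
theorem exists_lift (h : IsExtension W F F₂ I P) {b a : C} (φ : CanHom W F₂ (I ⋙ P) b a) :
    ∃ g : I.obj b ⟶ I.obj a, P.map g = φ.pt ∧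
      ∀ f₀ : b ⟶ a, pi0 W f₀ = φ.cls → F.component g = F.component (I.map f₀) := by
  obtain ⟨f₀, h1, h2⟩ := φ.exists_rep
  obtain ⟨g, hg, hg'⟩ := (h.cover.hasComponentSections h.gluingData.isDisc _ _).exists_eq
    (y := I.map f₀) (x := φ.pt) h2.symm
  exact ⟨g, hg', fun f₁ hf₁ => Eq.trans hg (h.component_eq_of_pi0_eq (h1.trans hf₁.symm))⟩

/-- The morphism of `A` that corresponds to a morphism of `C₁`. -/
noncomputable def lift (h : IsExtension W F F₂ I P) {b a : C} (φ : CanHom W F₂ (I ⋙ P) b a) :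
    I.obj b ⟶ I.obj a := (h.exists_lift φ).choose

theorem map_lift (h : IsExtension W F F₂ I P) {b a : C} (φ : CanHom W F₂ (I ⋙ P) b a) :
    P.map (h.lift φ) = φ.pt := (h.exists_lift φ).choose_spec.1

theorem component_lift (h : IsExtension W F F₂ I P) {b a : C} (φ : CanHom W F₂ (I ⋙ P) b a)
    {f₀ : b ⟶ a} (hf₀ : pi0 W f₀ = φ.cls) : F.component (h.lift φ) = F.component (I.map f₀) :=
  (h.exists_lift φ).choose_spec.2 f₀ hf₀

theorem eq_lift (h : IsExtension W F F₂ I P) {b a : C} (φ : CanHom W F₂ (I ⋙ P) b a)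
    {g : I.obj b ⟶ I.obj a} (hg : P.map g = φ.pt) {f₀ : b ⟶ a} (hf₀ : pi0 W f₀ = φ.cls)
    (hg' : F.component g = F.component (I.map f₀)) : g = h.lift φ :=
  (h.cover.hasComponentSections h.gluingData.isDisc _ _).injective
    (hg'.trans (h.component_lift φ hf₀).symm) (hg.trans (h.map_lift φ).symm)

theorem lift_of (h : IsExtension W F F₂ I P) {b a : C} (f : b ⟶ a) :
    h.lift (CanHom.of f) = I.map f := (h.eq_lift (CanHom.of f) (g := I.map f) rfl rfl rfl).symm

theorem lift_comp (h : IsExtension W F F₂ I P) {b z a : C} (φ : CanHom W F₂ (I ⋙ P) b z)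
    (χ : CanHom W F₂ (I ⋙ P) z a) : h.lift (φ.comp χ) = h.lift φ ≫ h.lift χ := by
  obtain ⟨f₀, hf₀, -⟩ := φ.exists_rep
  obtain ⟨g₀, hg₀, -⟩ := χ.exists_rep
  refine (h.eq_lift (φ.comp χ) ?_ (f₀ := f₀ ≫ g₀) ?_ ?_).symm
  · rw [P.map_comp, h.map_lift, h.map_lift]; rfl
  · rw [pi0_comp, hf₀, hg₀]; rfl
  · rw [I.map_comp]
    exact F.component_comp (h.component_lift φ hf₀) (h.component_lift χ hg₀)

theorem lift_bijective [Finite C] (h : IsExtension W F F₂ I P) (b a : C) :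
    Function.Bijective (h.lift : CanHom W F₂ (I ⋙ P) b a → _) := by
  constructor
  · intro φ χ hφ
    obtain ⟨f₀, hf₀, -⟩ := φ.exists_rep
    obtain ⟨g₀, hg₀, -⟩ := χ.exists_rep
    refine CanHom.ext ?_ ?_
    · rw [← hf₀, ← hg₀]
      refine h.pi0_eq_of_component_eq ?_
      rw [← h.component_lift φ hf₀, ← h.component_lift χ hg₀, hφ]
    · rw [← h.map_lift, ← h.map_lift, hφ]
  · intro g
    obtain ⟨f₀, hf₀⟩ := h.exists_component_eq g
    exact ⟨⟨pi0 W f₀, P.map g, f₀, rfl, h.cover.component_map hf₀⟩,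
      (h.eq_lift ⟨pi0 W f₀, P.map g, f₀, rfl, h.cover.component_map hf₀⟩ rfl rfl hf₀.symm).symm⟩

theorem continuous_lift (h : IsExtension W F F₂ I P) (b a : C) :
    Continuous fun φ : CanHom W F₂ (I ⋙ P) b a =>
      (show F.Mod (I.obj b) (I.obj a) from h.lift φ) := by
  refine continuous_iff_continuousAt.2 fun φ => ?_
  -- on the morphisms with the same class as `φ`, a section over a component gives the lift
  obtain ⟨s, hs, hs1, hs2⟩ := h.cover.hasComponentSections h.gluingData.isDisc _ _ (h.lift φ)
  let U : Set (CanHom W F₂ (I ⋙ P) b a) := {χ | χ.cls = φ.cls}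
  have hU : IsOpen U := (isOpen_discrete {φ.cls}).preimage (CanHom.continuous_cls b a)
  have hmem : ∀ χ : U, CanHom.proj b a χ.1 ∈ connectedComponent (α := F₂.Mod _ _)
      (modMap F F₂ P (I.obj b) (I.obj a) (h.lift φ)) := fun χ => by
    have h1 := h.gluingData.component_pt_eq χ.2
    rw [← h.map_lift φ] at h1
    exact F₂.component_eq_iff.1 h1
  have hcont : Continuous fun χ : U => s ⟨CanHom.proj b a χ.1, hmem χ⟩ :=
    hs.comp (((CanHom.continuous_proj b a).comp continuous_subtype_val).subtype_mk _)
  have heq : ∀ χ : U, s ⟨CanHom.proj b a χ.1, hmem χ⟩ = h.lift χ.1 := by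
    intro χ
    obtain ⟨f₀, hf₀, -⟩ := φ.exists_rep
    refine h.eq_lift χ.1 (hs1 _) (hf₀.trans χ.2.symm) ?_
    rw [← h.component_lift φ hf₀]
    exact F.component_eq_iff.2 (hs2.subset (mem_range_self _))
  refine ContinuousOn.continuousAt (s := U) ?_ (hU.mem_nhds rfl)
  rw [continuousOn_iff_continuous_domRestrict]
  exact hcont.congr heq

/-- The functor from `C₁` to `A`. -/
noncomputable def liftFunctor (h : IsExtension W F F₂ I P) : Can W F₂ (I ⋙ P) ⥤ A where
  obj x := I.obj x
  map f := h.lift f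
  map_id x := (h.lift_of (𝟙 (show C from x))).trans (I.map_id _)
  map_comp f g := h.lift_comp f g

theorem isFlowMorphism_liftFunctor [Finite C] (h : IsExtension W F F₂ I P)
    (ht : TrivialCoverings W F₂ (I ⋙ P)) :
    IsFlowMorphism (h.gluingData.canFlow ht) F h.liftFunctor where
  gr_obj x := (h.cover.gr_obj _).symm
  localDiffeo x y := by
    refine IsLocalDiffeomorph.of_comp_left (h.cover.localDiffeo (h.liftFunctor.obj x)
      (h.liftFunctor.obj y)) (h.continuous_lift x y) ?_
    have h1 : modMap F F₂ P (h.liftFunctor.obj x) (h.liftFunctor.obj y) ∘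
        modMap (h.gluingData.canFlow ht) F h.liftFunctor x y = canMap W F₂ (I ⋙ P) x y :=
      funext fun φ => h.map_lift φ
    rw [h1]
    exact isLocalDiffeomorph_canMap W F₂ (I ⋙ P) x y

theorem canIncl_liftFunctor (h : IsExtension W F F₂ I P) :
    canIncl W F₂ (I ⋙ P) ⋙ h.liftFunctor = I :=
  CategoryTheory.Functor.hext (fun _ => rfl) fun _ _ f => heq_of_eq (h.lift_of f)

theorem liftFunctor_cover (h : IsExtension W F F₂ I P) :
    h.liftFunctor ⋙ P = canCover W F₂ (I ⋙ P) :=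
  CategoryTheory.Functor.hext (fun _ => rfl) fun _ _ f => heq_of_eq (h.map_lift f)

end IsExtension

end Extensions

end FlowCat

/-! ### Isomorphisms of flow categories -/

namespace FlowCat

section Isomorphisms

universe u₃ v₃

variable {C : Type u} [Category.{v} C] {gr : C → ℤ} {C₂ : Type u₂} [Category.{v₂} C₂] {gr₂ : C₂ → ℤ}
  {C₃ : Type u₃} [Category.{v₃} C₃] {gr₃ : C₃ → ℤ}
  {F : FlowStructure C gr} {F₂ : FlowStructure C₂ gr₂} {F₃ : FlowStructure C₃ gr₃}
  {H : C ⥤ C₂} {H' : C₂ ⥤ C₃}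

theorem IsFlowMorphism.comp (h : IsFlowMorphism F F₂ H) (h' : IsFlowMorphism F₂ F₃ H') :
    IsFlowMorphism F F₃ (H ⋙ H') :=
  ⟨fun x => (h'.gr_obj _).trans (h.gr_obj x), fun x y =>
    (h'.localDiffeo _ _).comp (h.localDiffeo x y)⟩

/-- A morphism of flow categories that is bijective on objects and on morphisms is an
isomorphism. -/
theorem IsFlowMorphism.isFlowIsoOnto (h : IsFlowMorphism F F₂ H) (ho : Function.Bijective H.obj)
    (hm : ∀ x y, Function.Bijective (modMap F F₂ H x y)) : IsFlowIsoOnto F F₂ H univ where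
  isFlowMorphism := h
  obj_injective := ho.1
  obj_range := ho.2.range_eq
  map_bijective := hm
  map_face _ _ i := Set.ext fun f => h.map_mem_face_iff f i

theorem IsFlowIsoOnto.obj_bijective (h : IsFlowIsoOnto F F₂ H univ) : Function.Bijective H.obj :=
  ⟨h.obj_injective, range_eq_univ.1 h.obj_range⟩

theorem IsFlowIsoOnto.comp (h : IsFlowIsoOnto F F₂ H univ) (h' : IsFlowIsoOnto F₂ F₃ H' univ) :
    IsFlowIsoOnto F F₃ (H ⋙ H') univ :=
  (h.isFlowMorphism.comp h'.isFlowMorphism).isFlowIsoOnto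
    (h'.obj_bijective.comp h.obj_bijective)
    fun x y => (h'.map_bijective _ _).comp (h.map_bijective x y)

/-- A functor that is bijective on objects and on morphisms has a strict inverse. -/
theorem exists_inverse_of_bijective (ho : Function.Bijective H.obj)
    (hm : ∀ x y, Function.Bijective (H.map : (x ⟶ y) → _)) :
    ∃ K : C₂ ⥤ C, H ⋙ K = 𝟭 C ∧ K ⋙ H = 𝟭 C₂ := by
  have : H.Faithful := ⟨fun h => (hm _ _).1 h⟩
  have : H.Full := ⟨fun f => (hm _ _).2 f⟩
  let e := Equiv.ofBijective H.obj ho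
  have he : ∀ y, H.obj (e.symm y) = y := e.apply_symm_apply
  have he' : ∀ x, e.symm (H.obj x) = x := e.symm_apply_apply
  let K : C₂ ⥤ C :=
    { obj := e.symm
      map := fun {x y} f => H.preimage (eqToHom (he x) ≫ f ≫ eqToHom (he y).symm)
      map_id := fun x => H.map_injective (by simp)
      map_comp := fun f g => H.map_injective (by simp) }
  refine ⟨K, CategoryTheory.Functor.ext he' fun x y f => H.map_injective ?_,
    CategoryTheory.Functor.ext he fun x y f => ?_⟩
  · simp [K, eqToHom_map]
  · simp [K]

theorem isFlowIsoOnto_of_eq_id {H : C ⥤ C} (h : H = 𝟭 C) : IsFlowIsoOnto F F H univ := by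
  subst h
  refine IsFlowMorphism.isFlowIsoOnto ⟨fun _ => rfl, fun x y => ?_⟩ Function.bijective_id
    fun x y => Function.bijective_id
  exact (Diffeomorph.refl (mmodel gr x y) (F.Mod x y) ∞).isLocalDiffeomorph

theorem IsFlowIsoOnto.exists_inverse (h : IsFlowIsoOnto F F₂ H univ) :
    ∃ K : C₂ ⥤ C, IsFlowIsoOnto F₂ F K univ ∧ H ⋙ K = 𝟭 C ∧ K ⋙ H = 𝟭 C₂ := by
  obtain ⟨K, h1, h2⟩ := exists_inverse_of_bijective h.obj_bijective h.map_bijective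
  have hid : IsFlowIsoOnto F F (H ⋙ K) univ := isFlowIsoOnto_of_eq_id h1
  have hid' : IsFlowIsoOnto F₂ F₂ (K ⋙ H) univ := isFlowIsoOnto_of_eq_id h2
  refine ⟨K, IsFlowMorphism.isFlowIsoOnto ⟨fun x => ?_, fun x y => ?_⟩ ⟨?_, ?_⟩ fun x y => ?_,
    h1, h2⟩
  · rw [← h.isFlowMorphism.gr_obj]
    exact hid'.isFlowMorphism.gr_obj x
  · obtain ⟨x, rfl⟩ := h.obj_bijective.2 x
    obtain ⟨y, rfl⟩ := h.obj_bijective.2 y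
    exact (h.isFlowMorphism.localDiffeo x y).of_comp_right (h.map_bijective x y).2
      (hid.isFlowMorphism.localDiffeo x y)
  · exact Function.Injective.of_comp (f := H.obj) hid'.obj_injective
  · exact Function.Surjective.of_comp (g := H.obj) hid.obj_bijective.2
  · obtain ⟨x, rfl⟩ := h.obj_bijective.2 x
    obtain ⟨y, rfl⟩ := h.obj_bijective.2 y
    exact (Function.Bijective.of_comp_iff (modMap F₂ F K (H.obj x) (H.obj y))
      (h.map_bijective x y)).1 (hid.map_bijective x y)

/-- Two morphisms in a cover by discs agree if they have the same image, and lie in the components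
of equal morphisms. -/
theorem IsFlowMorphism.heq_of_heq_map (h : IsFlowMorphism F F₂ H) (hF₂ : F₂.IsDisc) {x y x' y' : C}
    (hx : x = x') (hy : y = y') {f g : x ⟶ y} {f' g' : x' ⟶ y'} (hf : HEq (H.map f) (H.map f'))
    (hg : HEq g g') (hc : F.component f = F.component g) (hc' : F.component f' = F.component g') :
    HEq f f' := by
  subst hx hy
  obtain rfl := eq_of_heq hg
  exact heq_of_eq ((h.hasComponentSections hF₂ x y).injective (Eq.trans hc hc'.symm)
    (eq_of_heq hf))

end Isomorphisms

/-! ### Uniqueness -/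

section Uniqueness

variable {C : Type u} [Category.{v} C] {gr : C → ℤ} {W : WindowFlows gr}
  {C₂ : Type u₂} [Category.{v} C₂] {gr₂ : C₂ → ℤ} {F₂ : FlowStructure C₂ gr₂} {Ψ : C ⥤ C₂}

/-- A morphism of flow categories over `C₂` that is defined on `C₁` is determined by its restriction
to `C`. -/
theorem GluingData.eq_of_canIncl_comp_eq [Finite C] (D : GluingData W F₂ Ψ)
    (ht : TrivialCoverings W F₂ Ψ) {A : Type u} [Category.{v} A] {grA : A → ℤ}
    {F : FlowStructure A grA} {P : A ⥤ C₂} (hP : IsFlowMorphism F F₂ P) {H H' : Can W F₂ Ψ ⥤ A}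
    (hH : IsFlowMorphism (D.canFlow ht) F H) (hH' : IsFlowMorphism (D.canFlow ht) F H')
    (hi : canIncl W F₂ Ψ ⋙ H = canIncl W F₂ Ψ ⋙ H') (hp : H ⋙ P = H' ⋙ P) : H = H' := by
  have hobj : ∀ x, H.obj x = H'.obj x := fun x => CategoryTheory.Functor.congr_obj hi x
  refine CategoryTheory.Functor.hext hobj fun b a φ => ?_
  obtain ⟨f₀, hf₀, hf₀'⟩ := CanHom.exists_rep φ
  -- the morphism `φ` lies in the component of a morphism of `C`
  have hc : (D.canFlow ht).component φ = (D.canFlow ht).component ((canIncl W F₂ Ψ).map f₀) := by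
    obtain ⟨φ', h1, h2⟩ := (D.hasComponentSections_canMap b a).exists_eq
      (y := (canIncl W F₂ Ψ).map f₀) (x := canMap W F₂ Ψ b a φ) hf₀'.symm
    obtain rfl : φ' = φ := CanHom.ext ((CanHom.cls_eq_of_connectedComponent_eq (W := W) (F₂ := F₂)
      (Ψ := Ψ) (b := b) (a := a) h1).trans hf₀) h2
    exact h1
  refine hP.heq_of_heq_map D.isDisc (hobj b) (hobj a) (g := H.map ((canIncl W F₂ Ψ).map f₀))
    (g' := H'.map ((canIncl W F₂ Ψ).map f₀)) ?_ ?_ (hH.component_map hc) (hH'.component_map hc)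
  · have : ∀ K : Can W F₂ Ψ ⥤ C₂, H ⋙ P = K → HEq (P.map (H.map φ)) (K.map φ) := by
      rintro _ rfl; rfl
    exact this _ hp
  · have : ∀ K : C ⥤ A, canIncl W F₂ Ψ ⋙ H = K →
        HEq (H.map ((canIncl W F₂ Ψ).map f₀)) (K.map f₀) := by
      rintro _ rfl; rfl
    exact this _ hi

/-- Every extension is isomorphic to `C₁`, compatibly with the functors from `C` and to `C₂`. -/
theorem GluingData.exists_iso_extension [Finite C] (D : GluingData W F₂ Ψ)
    (ht : TrivialCoverings W F₂ Ψ) (E : DiscCoverExtension W F₂ Ψ) :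
    ∃ Θ : Can W F₂ Ψ ⥤ E.C₁, IsFlowIsoOnto (D.canFlow ht) E.flow Θ univ ∧
      canIncl W F₂ Ψ ⋙ Θ = E.incl ∧ Θ ⋙ E.cover = canCover W F₂ Ψ := by
  obtain ⟨C₁, gr₁, F₁, P, hP, I, hI, hgr, -, hW, rfl⟩ := E
  have h : IsExtension W F₁ F₂ I P := ⟨D, hP.isFlowMorphism, hI.2, hgr, hW⟩
  exact ⟨h.liftFunctor, (h.isFlowMorphism_liftFunctor ht).isFlowIsoOnto hI h.lift_bijective,
    h.canIncl_liftFunctor, h.liftFunctor_cover⟩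

/-- Any two extensions are isomorphic, by a unique isomorphism. -/
theorem GluingData.exists_unique_iso [Finite C] (D : GluingData W F₂ Ψ)
    (ht : TrivialCoverings W F₂ Ψ) (E E' : DiscCoverExtension W F₂ Ψ) :
    ∃ G : E.C₁ ⥤ E'.C₁,
      (IsFlowIsoOnto E.flow E'.flow G Set.univ ∧
        E.incl ⋙ G = E'.incl ∧ G ⋙ E'.cover = E.cover) ∧
      ∀ G' : E.C₁ ⥤ E'.C₁, IsFlowMorphism E.flow E'.flow G' →
        E.incl ⋙ G' = E'.incl → G' ⋙ E'.cover = E.cover → G' = G := by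
  obtain ⟨Θ, h1, h2, h3⟩ := D.exists_iso_extension ht E
  obtain ⟨Θ', h1', h2', h3'⟩ := D.exists_iso_extension ht E'
  obtain ⟨K, hK, hK1, hK2⟩ := h1.exists_inverse
  refine ⟨K ⋙ Θ', ⟨hK.comp h1', ?_, ?_⟩, fun G' hG' hi hp => ?_⟩
  · rw [← h2, Functor.assoc, ← Functor.assoc Θ, hK1, Functor.id_comp, h2']
  · rw [Functor.assoc, h3', ← h3, ← Functor.assoc, hK2, Functor.id_comp]
  · have h4 : Θ ⋙ G' = Θ' := D.eq_of_canIncl_comp_eq ht E'.isDiscCover.isFlowMorphism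
      (h1.isFlowMorphism.comp hG') h1'.isFlowMorphism
      (by rw [← Functor.assoc, h2, hi, h2']) (by rw [Functor.assoc, hp, h3, h3'])
    rw [← h4, ← Functor.assoc, hK2, Functor.id_comp]

end Uniqueness

end FlowCat

theorem mainTheorem9
    {C : Type u} [Category.{v} C] [Finite C] {gr : C → ℤ}
    (W : WindowFlows gr) (hC : IsGluedFromWindows gr)
    {C₂ : Type u₂} [Category.{v} C₂] {gr₂ : C₂ → ℤ}
    (F₂ : FlowStructure C₂ gr₂) (hF₂ : F₂.IsDisc)
    (Ψ : C ⥤ C₂) (hgr : ∀ x, gr₂ (Ψ.obj x) = gr x)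
    (hΨ : ∀ i : ℤ, IsFlowMorphism (W i) F₂ ((InWindow gr i).ι ⋙ Ψ)) :
    (∀ (b a : C) (h : gr b = gr a + 3),
      ((∀ f : BrokenHom W b a h, ∃ c, f ∈ range (glueMap W b a h c)) ∧
        (∀ c, Function.Injective (glueMap W b a h c)) ∧
        ∃ k : ℕ, Nonempty (BrokenHom W b a h ≃ₜ Fin k × Circle)) ∧
      ∃ hb : ∀ f, brokenMap W F₂ Ψ b a h f ∈
          bdry (mdim gr₂ (Ψ.obj b) (Ψ.obj a)) (F₂.Mod (Ψ.obj b) (Ψ.obj a)),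
        IsCoveringMap (Set.codRestrict (brokenMap W F₂ Ψ b a h) _ hb)) ∧
    ((∀ (b a : C) (h : gr b = gr a + 3) (f : BrokenHom W b a h),
        IsTrivialCovering (Set.imageFactorization (brokenMap W F₂ Ψ b a h)
          (connectedComponent f))) →
      Nonempty (DiscCoverExtension W F₂ Ψ) ∧
      ∀ E E' : DiscCoverExtension W F₂ Ψ,
        ∃ G : E.C₁ ⥤ E'.C₁,
          (IsFlowIsoOnto E.flow E'.flow G Set.univ ∧
            E.incl ⋙ G = E'.incl ∧ G ⋙ E'.cover = E.cover) ∧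
          ∀ G' : E.C₁ ⥤ E'.C₁, IsFlowMorphism E.flow E'.flow G' →
            E.incl ⋙ G' = E'.incl → G' ⋙ E'.cover = E.cover → G' = G) := by
  have D : GluingData W F₂ Ψ := ⟨hC, hF₂, hgr, hΨ⟩
  exact ⟨fun b a h => D.broken h, fun ht => ⟨⟨D.extension ht⟩, D.exists_unique_iso ht⟩⟩
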